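/- **Setting.** Fix $\alpha, r, \beta \in (0,1)$. For each $n$ there are $n$ subjects with effects $\mu_i \in \{0, \mu\}$, where $\mu = \mu_n = \sqrt{2 r \log n}$. A subject is a non-null if $\mu_i > 0$. The number $n_1$ of non-nulls satisfies $n_1/n = n^{-\beta}$, up to a factor tending to one (as $n_1$ is an integer). The potential outcomes are $Y_i^C \sim N(0,1)$ and $Y_i^T \sim N(\mu_i,1)$ (with any coupling of the two). The assignments $A_i \in \{0,1\}$ are fair coin flips independent of the potential outcomes. Subjects are independent. One observes $A_i$, $Y_i = A_i Y_i^T + (1-A_i) Y_i^C$ and the covariate $X_i = \mathbb 1\{\mu_i > 0\}$. The power of a procedure with rejection set $\mathcal R$ is $\mathbb E\big[\,|\mathcal R \cap \mathrm{Pos}| / \max(|\mathrm{Pos}|,1)\big]$, where $\mathrm{Pos}=\{i : \mu_i>0\}$. **Automated Crossfit-I³ at level $\alpha$.** Split $[n]$ uniformly at random, independently of the data, into halves $\mathcal I$ and $\mathcal{II}$ of sizes $\lfloor n/2\rfloor$ and $\lceil n/2\rceil$. On $\mathcal I$, let $\widehat m(x)$ be the average of $Y_j$ over the $j \in \mathcal{II}$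 with $X_j = x$, let $\widehat\Delta_k = 4(A_k - \tfrac12)(Y_k - \widehat m(X_k))$, and let $\mathrm{Pred}(x)$ be the average of $\widehat\Delta_j$ over the $j \in \mathcal{II}$ with $X_j = x$. Start from $\mathcal R_0 = \mathcal I$. At each step exclude one subject of $\mathcal R_t$ for which $\mathrm{Pred}(X_i)$ is smallest; ties are broken by any (measurable) rule that uses the outcomes, the covariates, the split, the assignments outside $\mathcal R_t$ and the number $|\mathcal R_t^+|$. Let $\mathcal R_t^{+} = \{i\in\mathcal R_t : \widehat\Delta_i>0\}$, $\mathcal R_t^- = \mathcal R_t \setminus \mathcal R_t^+$, and let $\tau$ be the first $t$ with $(|\mathcal R_t^-|+1)/\max(|\mathcal R_t^+|,1) \le \alpha/2$. Reject $\mathcal R_\tau^+$ (nothing if there is no such $t$). Do the same on $\mathcal{II}$ with the roles of the halves exchanged; the final rejection set is the union. **Linear-BH at level $\alpha$.** In each arm $a\in\{T,C\}$ fit $Y$ on $X$ with an intercept by least squares, giving $\widehat l^{a}$. Let $\widehat\sigma_a^2$ be the residual sum of squares divided by (size of the arm $-\,2$), and let $\widehat{\mathrm{Var}}(\widehat l^a(x))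 = \widehat\sigma_a^2\,(1,x)(\mathbb X_a^\top \mathbb X_a)^{-1}(1,x)^\top$, with $\mathbb X_a$ the design matrix of the arm. Let $\widetilde Y_i^a$ be $Y_i$ with estimated variance $\widehat\sigma_a^2$ if $i$ is in arm $a$, and $\widehat l^a(X_i)$ with estimated variance $\widehat{\mathrm{Var}}(\widehat l^a(X_i))$ otherwise. Let $\widehat\Delta_i^{\mathrm{BH}} = \widetilde Y_i^T - \widetilde Y_i^C$, let $\widehat{\mathrm{Var}}(\widehat\Delta_i^{\mathrm{BH}})$ be the sum of the two estimated variances, and let $P_i = 1 - \Phi\big(\widehat\Delta_i^{\mathrm{BH}} / \widehat{\mathrm{Var}}(\widehat\Delta_i^{\mathrm{BH}})^{1/2}\big)$, with $\Phi$ the standard Gaussian distribution function. Apply the Benjamini–Hochberg procedure at level $\alpha$ to $P_1,\dots,P_n$. **Theorem.** As $n \to \infty$, for all fixed $\alpha, r, \beta \in (0,1)$: the power of the automated Crossfit-I³ converges to one; the power of linear-BH converges to zero if $r < \beta$ and to one if $r > \beta$. -/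

import Mathlib

open MeasureTheory ProbabilityTheory Filter Topology

namespace CrossfitICube

noncomputable section

/-! ### The sparse Gaussian randomized experiment -/

/-- The observed outcome: the treated outcome if the subject is treated, else the control one. -/
def observed {n : ℕ} (A : Fin n → Bool) (YC YT : Fin n → ℝ) (i : Fin n) : ℝ :=
  if A i then YT i else YC i

/-- The model with `n` subjects and effects `μ i`: `YC i ~ N(0,1)` and `YT i ~ N(μ i, 1)` (with an
arbitrary coupling of the two potential outcomes of one subject), fair coin assignments that are
independent of the potential outcomes, independent subjects, and an independent uniformly random
splitting set `I` of size `⌊n/2⌋` (the other half is `Iᶜ`). -/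
structure IsGaussianTrial {Ω : Type*} [MeasurableSpace Ω] (P : Measure Ω) {n : ℕ} (μ : Fin n → ℝ)
    (YC YT : Fin n → Ω → ℝ) (A : Fin n → Ω → Bool) (I : Ω → Finset (Fin n)) : Prop where
  measurable_YC : ∀ i, Measurable (YC i)
  measurable_YT : ∀ i, Measurable (YT i)
  measurable_A : ∀ i, Measurable (A i)
  measurable_I : Measurable (fun ω i => decide (i ∈ I ω))
  law_YC : ∀ i, P.map (YC i) = gaussianReal 0 1
  law_YT : ∀ i, P.map (YT i) = gaussianReal (μ i) 1
  law_A : ∀ i, P {ω | A i ω = true} = 1 / 2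
  law_I : ∀ s : Finset (Fin n), s.card = n / 2 → P {ω | I ω = s} = 1 / (n.choose (n / 2) : ENNReal)
  indep_assignment : ∀ i, IndepFun (fun ω => (YC i ω, YT i ω)) (A i) P
  indep_subjects : iIndepFun (fun i ω => (YC i ω, YT i ω, A i ω)) P
  indep_split : IndepFun (fun ω i => (YC i ω, YT i ω, A i ω)) (fun ω i => decide (i ∈ I ω)) P

/-- The signal strength `√(2 r log n)`. -/
def signal (r : ℝ) (n : ℕ) : ℝ := Real.sqrt (2 * r * Real.log n)

/-- The subjects with a positive effect. -/
def nonNulls {n : ℕ} (μ : Fin n → ℝ) : Finset (Fin n) := {i | 0 < μ i}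

/-- The ideal covariate `X i = 1{μ i > 0}`. -/
def idealCovariate {n : ℕ} (μ : Fin n → ℝ) (i : Fin n) : ℝ := if 0 < μ i then 1 else 0

/-- The effects are `0` or the signal, and the fraction of non-nulls is `n ^ (-β)` (up to a factor
tending to one, since the number of non-nulls is an integer). -/
def IsSparse (r β : ℝ) (μ : (n : ℕ) → Fin n → ℝ) : Prop :=
  (∀ n i, μ n i = 0 ∨ μ n i = signal r n) ∧
    Tendsto (fun n : ℕ => ((nonNulls (μ n)).card / n : ℝ) / (n : ℝ) ^ (-β)) atTop (𝓝 1)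

/-- The power of a random rejection set: the expected proportion of identified non-nulls. -/
def power {Ω : Type*} [MeasurableSpace Ω] (P : Measure Ω) {n : ℕ} (Pos : Finset (Fin n))
    (R : Ω → Finset (Fin n)) : ℝ :=
  ∫ ω, ((R ω ∩ Pos).card : ℝ) / max (Pos.card : ℝ) 1 ∂P

/-! ### The automated Crossfit-I³ -/

/-- The average of `V k` over the `k ∈ T` with covariate value `x`. -/
def groupMean {n : ℕ} (T : Finset (Fin n)) (X V : Fin n → ℝ) (x : ℝ) : ℝ :=
  (∑ k ∈ T with X k = x, V k) / ({k ∈ T | X k = x} : Finset (Fin n)).card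

/-- The estimated effect `4 (A i - 1/2) (Y i - m̂ (X i))`, where the outcome model `m̂` is the
average outcome, in the training set `T`, of the subjects with the same covariate. -/
def effectEst {n : ℕ} (T : Finset (Fin n)) (X : Fin n → ℝ) (A : Fin n → Bool) (Y : Fin n → ℝ)
    (i : Fin n) : ℝ :=
  4 * ((if A i then 1 else 0) - 1 / 2) * (Y i - groupMean T X Y (X i))

/-- The predicted effect at `x`: the average estimated effect, in the training set `T`, of the
subjects with covariate value `x`. -/
def pred {n : ℕ} (T : Finset (Fin n)) (X : Fin n → ℝ) (A : Fin n → Bool) (Y : Fin n → ℝ)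
    (x : ℝ) : ℝ :=
  groupMean T X (effectEst T X A Y) x

/-- The members of `R` whose estimated effect is positive. -/
def posPart {n : ℕ} (Δ : Fin n → ℝ) (R : Finset (Fin n)) : Finset (Fin n) := {i ∈ R | 0 < Δ i}

/-- The members of `R` whose estimated effect is nonpositive. -/
def negPart {n : ℕ} (Δ : Fin n → ℝ) (R : Finset (Fin n)) : Finset (Fin n) := {i ∈ R | Δ i ≤ 0}

/-- The estimated false discovery rate of a candidate set. -/
def fdrHat {n : ℕ} (Δ : Fin n → ℝ) (R : Finset (Fin n)) : ℝ :=
  ((negPart Δ R).card + 1 : ℝ) / max ((posPart Δ R).card : ℝ) 1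

/-- A rule that picks one member of a nonempty set `C` of candidates with the same (lowest)
prediction. It may use what is known to the analyst: the outcomes `Y`, the half `I` under study, the
assignments revealed so far (`none` for a hidden one), and the number of candidates with a
positive estimated effect. -/
abbrev TieRule (n : ℕ) : Type :=
  (Y : Fin n → ℝ) → (I : Finset (Fin n)) → (revealed : Fin n → Option Bool) → (posCount : ℕ) →
    (C : Finset (Fin n)) → C.Nonempty → {i : Fin n // i ∈ C}

/-- Measurability of the picked subject in the outcomes (the other arguments are discrete). -/
def TieRule.IsMeasurable {n : ℕ} (tie : TieRule n) : Prop :=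
  ∀ I revealed posCount C hC, Measurable (fun Y => (tie Y I revealed posCount C hC : Fin n))

/-- The members of `R` with the lowest prediction. -/
def lowest {n : ℕ} (score : Fin n → ℝ) (R : Finset (Fin n)) : Finset (Fin n) :=
  {i ∈ R | ∀ j ∈ R, score i ≤ score j}

/-- The candidate sets `R_0 = I ⊇ R_1 ⊇ …` of the procedure run on `I`, trained on `Iᶜ`: each step
excludes one subject with the lowest prediction. -/
def candidates {n : ℕ} (tie : TieRule n) (X : Fin n → ℝ) (A : Fin n → Bool) (Y : Fin n → ℝ)
    (I : Finset (Fin n)) : ℕ → Finset (Fin n)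
  | 0 => I
  | t + 1 =>
    let R := candidates tie X A Y I t
    let C := lowest (fun i => pred Iᶜ X A Y (X i)) R
    if hC : C.Nonempty then
      R.erase (tie Y I (fun k => if k ∈ R then none else some (A k))
        (posPart (effectEst Iᶜ X A Y) R).card C hC)
    else R

open Classical in
/-- The rejections of the procedure run on `I` at level `a`: the candidates with a positive estimated
effect at the first time when the estimated false discovery rate is at most `a`, and none if this
never happens. -/
def iCube {n : ℕ} (tie : TieRule n) (a : ℝ) (X : Fin n → ℝ) (A : Fin n → Bool) (Y : Fin n → ℝ)
    (I : Finset (Fin n)) : Finset (Fin n) :=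
  if h : ∃ t, fdrHat (effectEst Iᶜ X A Y) (candidates tie X A Y I t) ≤ a then
    posPart (effectEst Iᶜ X A Y) (candidates tie X A Y I (Nat.find h))
  else ∅

/-- The automated Crossfit-I³ at level `α` with splitting set `I`: the union of the rejections in
the two halves, each at level `α / 2`. -/
def crossfitICube {n : ℕ} (tie : TieRule n) (α : ℝ) (X : Fin n → ℝ) (A : Fin n → Bool)
    (Y : Fin n → ℝ) (I : Finset (Fin n)) : Finset (Fin n) :=
  iCube tie (α / 2) X A Y I ∪ iCube tie (α / 2) X A Y Iᶜ

/-! ### The linear-BH procedure -/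

/-- The regressors `(1, x)`: intercept and one covariate. -/
def regressor (x : ℝ) : Fin 2 → ℝ := ![1, x]

/-- The matrix `𝕏ᵀ𝕏` of the regression in the arm with assignment `a`. -/
def gram {n : ℕ} (X : Fin n → ℝ) (A : Fin n → Bool) (a : Bool) : Matrix (Fin 2) (Fin 2) ℝ :=
  ∑ i with A i = a, Matrix.vecMulVec (regressor (X i)) (regressor (X i))

/-- The least squares coefficients `(𝕏ᵀ𝕏)⁻¹ 𝕏ᵀY` of the regression in the arm `a`. -/
def olsCoef {n : ℕ} (X : Fin n → ℝ) (A : Fin n → Bool) (Y : Fin n → ℝ) (a : Bool) : Fin 2 → ℝ :=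
  Matrix.mulVec (gram X A a)⁻¹ (∑ i with A i = a, Y i • regressor (X i))

/-- The fitted linear prediction of the outcome in the arm `a`. -/
def olsFit {n : ℕ} (X : Fin n → ℝ) (A : Fin n → Bool) (Y : Fin n → ℝ) (a : Bool) (x : ℝ) : ℝ :=
  dotProduct (regressor x) (olsCoef X A Y a)

/-- The estimated noise variance in the arm `a`: the residual sum of squares divided by the size of
the arm minus two (one covariate and the intercept). -/
def noiseVar {n : ℕ} (X : Fin n → ℝ) (A : Fin n → Bool) (Y : Fin n → ℝ) (a : Bool) : ℝ :=
  (∑ i with A i = a, (Y i - olsFit X A Y a (X i)) ^ 2) /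
    ((({i | A i = a} : Finset (Fin n)).card : ℝ) - 1 - 1)

/-- The estimated variance of the fitted prediction at `x` in the arm `a`. -/
def fitVar {n : ℕ} (X : Fin n → ℝ) (A : Fin n → Bool) (Y : Fin n → ℝ) (a : Bool) (x : ℝ) : ℝ :=
  noiseVar X A Y a * dotProduct (regressor x) (Matrix.mulVec (gram X A a)⁻¹ (regressor x))

/-- The potential outcome under `a`: observed if the subject is in that arm, else imputed. -/
def imputed {n : ℕ} (X : Fin n → ℝ) (A : Fin n → Bool) (Y : Fin n → ℝ) (a : Bool) (i : Fin n) : ℝ :=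
  if A i = a then Y i else olsFit X A Y a (X i)

/-- The estimated variance of `imputed`. -/
def imputedVar {n : ℕ} (X : Fin n → ℝ) (A : Fin n → Bool) (Y : Fin n → ℝ) (a : Bool)
    (i : Fin n) : ℝ :=
  if A i = a then noiseVar X A Y a else fitVar X A Y a (X i)

/-- The one-sided p-value of subject `i` under the linear model. -/
def linearPValue {n : ℕ} (X : Fin n → ℝ) (A : Fin n → Bool) (Y : Fin n → ℝ) (i : Fin n) : ℝ :=
  1 - cdf (gaussianReal 0 1)
    ((imputed X A Y true i - imputed X A Y false i) /
      Real.sqrt (imputedVar X A Y true i + imputedVar X A Y false i))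

/-- The number of Benjamini-Hochberg rejections at level `α`: the largest `k ≤ n` such that at least
`k` of the p-values are at most `k α / n`. -/
def bhCount {n : ℕ} (α : ℝ) (p : Fin n → ℝ) : ℕ :=
  Nat.findGreatest (fun k => k ≤ ({i | p i ≤ k * α / n} : Finset (Fin n)).card) n

/-- The Benjamini-Hochberg rejection set at level `α`. -/
def bhReject {n : ℕ} (α : ℝ) (p : Fin n → ℝ) : Finset (Fin n) :=
  {i | 0 < bhCount α p ∧ p i ≤ bhCount α p * α / n}

/-- The linear-BH procedure at level `α`. -/
def linearBH {n : ℕ} (α : ℝ) (X : Fin n → ℝ) (A : Fin n → Bool) (Y : Fin n → ℝ) :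
    Finset (Fin n) :=
  bhReject α (linearPValue X A Y)

end

end CrossfitICube

open CrossfitICube

/-!
# The power of the automated Crossfit-I³ and of linear-BH

Everything is expressed through the noise `ε i = Y i - μ i 1{A i}`, which is standard Gaussian,
independent of the assignment, and independent over the subjects and of the split. Two groups of
subjects matter, the nulls and the non-nulls; both grow to infinity, so sums over a group (or
over its part in a half of the split or in an arm) of the assignments, the noise and the squared
noise obey laws of large numbers at a polynomial rate, by second moments alone
(`whp_weightedSum`, `whp_split_count`). Also, only a vanishing fraction of the non-nulls has a
noise above a diverging level (`whp_card_large_noise`).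

*Crossfit-I³.* The signal tends to infinity, so with high probability the predicted effect of
the non-nulls exceeds that of the nulls, in both halves. Hence every step excludes a null as
long as there is one, whatever the tie rule does (`inter_subset_candidates`). When only the
non-nulls of a half are left, few of their estimated effects are nonpositive and the stopping
criterion is met; so the procedure stops at that time or before, and it rejects all non-nulls
with a positive estimated effect, which are almost all (`mem_iCube_of_balanced`).

*Linear-BH.* The covariate is binary, so least squares fits the group means, and the p-values
are `gaussianTail z` where `z` is `μ i ± ε i` up to a small error in location and scale
(`pValueApprox_of_regular`). If `β < r`, choose `q` between them: almost all of the about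
`n ^ (1 - β)` non-nulls have a p-value below `n ^ (-q)`, which is below the Benjamini-Hochberg
threshold of that many rejections. If `r < β`, choose `r < q < q' < β`. More than `n ^ (1 - q')`
rejections would outnumber the non-nulls, so `k` rejections would need almost `k` null p-values
below `k α / n`; as `α < 1` this is excluded, for all such `k` at once, by Chernoff's bound
(`whp_exceedances_lt`). Here the errors in location and scale must not change the tail
probabilities by more than a factor `1 + o(1)`, which their polynomial rate ensures
(`eventually_exists_threshold`). So only p-values below `n ^ (-q')` are rejected; these require
`z` above `√(2 q log n)`, which a vanishing fraction of the non-nulls attains.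

The tie rule and the least squares formulas also have to be measurable in the data, since the
power is a Bochner integral.
-/

/-! ### Events of probability tending to one -/

/-- The events `E n` hold with probability tending to one: the (outer) probabilities of their
complements tend to zero. No measurability of the events is required. -/
def WithHighProb {Ω : ℕ → Type*} [∀ n, MeasurableSpace (Ω n)] (P : (n : ℕ) → Measure (Ω n))
    (E : (n : ℕ) → Ω n → Prop) : Prop :=
  Tendsto (fun n => P n {ω | ¬ E n ω}) atTop (𝓝 0)

namespace WithHighProb

variable {Ω : ℕ → Type*} [∀ n, MeasurableSpace (Ω n)] {P : (n : ℕ) → Measure (Ω n)}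
  {E F : (n : ℕ) → Ω n → Prop}

lemma mono (hE : WithHighProb P E) (h : ∀ᶠ n in atTop, ∀ ω, E n ω → F n ω) :
    WithHighProb P F := by
  refine tendsto_of_tendsto_of_tendsto_of_le_of_le' tendsto_const_nhds hE
    (Eventually.of_forall fun _ => zero_le) ?_
  filter_upwards [h] with n hn
  exact measure_mono fun ω hω hEω => hω (hn ω hEω)

lemma and (hE : WithHighProb P E) (hF : WithHighProb P F) :
    WithHighProb P (fun n ω => E n ω ∧ F n ω) := by
  have h := hE.add hF
  rw [add_zero] at h
  refine tendsto_of_tendsto_of_tendsto_of_le_of_le' tendsto_const_nhds h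
    (Eventually.of_forall fun _ => zero_le) (Eventually.of_forall fun n => ?_)
  refine (measure_mono fun ω hω => ?_).trans (measure_union_le _ _)
  simp only [Set.mem_ofPred_eq, Set.mem_union] at hω ⊢
  tauto

lemma of_le {u : ℕ → ℝ} (hu : Tendsto u atTop (𝓝 0))
    (h : ∀ᶠ n in atTop, P n {ω | ¬ E n ω} ≤ ENNReal.ofReal (u n)) : WithHighProb P E := by
  have := ENNReal.tendsto_ofReal hu
  rw [ENNReal.ofReal_zero] at this
  exact tendsto_of_tendsto_of_tendsto_of_le_of_le' tendsto_const_nhds this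
    (Eventually.of_forall fun _ => zero_le) h

lemma tendsto_real [∀ n, IsProbabilityMeasure (P n)] (hE : WithHighProb P E) :
    Tendsto (fun n => (P n).real {ω | ¬ E n ω}) atTop (𝓝 0) := by
  exact (ENNReal.tendsto_toReal ENNReal.zero_ne_top).comp hE

/-- Bounded convergence: if `f n ∈ [0, 1]` is at least `1 - η` with high probability, for every
`η > 0`, then its expectation tends to one. -/
lemma tendsto_integral_one [∀ n, IsProbabilityMeasure (P n)] {f : (n : ℕ) → Ω n → ℝ}
    (hm : ∀ n, Measurable (f n)) (h0 : ∀ n ω, 0 ≤ f n ω) (h1 : ∀ n ω, f n ω ≤ 1)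
    (h : ∀ η : ℝ, 0 < η → WithHighProb P (fun n ω => 1 - η ≤ f n ω)) :
    Tendsto (fun n => ∫ ω, f n ω ∂P n) atTop (𝓝 1) := by
  have hint : ∀ n, Integrable (f n) (P n) := fun n =>
    Integrable.of_bound (hm n).aestronglyMeasurable 1 (Eventually.of_forall fun ω => by
      rw [Real.norm_eq_abs, abs_of_nonneg (h0 n ω)]; exact h1 n ω)
  have hle : ∀ n, ∫ ω, f n ω ∂P n ≤ 1 := fun n => by
    calc ∫ ω, f n ω ∂P n ≤ ∫ _, (1 : ℝ) ∂P n :=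
          integral_mono (hint n) (integrable_const _) (h1 n)
      _ = 1 := by simp
  rw [tendsto_order]
  refine ⟨fun a ha => ?_, fun a ha => Eventually.of_forall fun n => (hle n).trans_lt ha⟩
  set η := (1 - a) / 3 with hη
  have hηpos : 0 < η := by rw [hη]; linarith
  have hev := (h η hηpos).tendsto_real.eventually (gt_mem_nhds hηpos)
  filter_upwards [hev] with n hn
  have hms : MeasurableSet {ω | ¬ 1 - η ≤ f n ω} :=
    (measurableSet_le measurable_const (hm n)).compl
  have key : ∀ ω, 1 - η - Set.indicator {ω | ¬ 1 - η ≤ f n ω} (fun _ => (1 : ℝ)) ω ≤ f n ω := by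
    intro ω
    by_cases hω : 1 - η ≤ f n ω
    · rw [Set.indicator_of_notMem (by simpa using hω)]; linarith
    · rw [Set.indicator_of_mem (by simpa using hω)]; linarith [h0 n ω]
  have hi : Integrable (Set.indicator {ω | ¬ 1 - η ≤ f n ω} (fun _ => (1 : ℝ))) (P n) :=
    (integrable_const _).indicator hms
  have := integral_mono ((integrable_const (1 - η)).sub hi) (hint n) key
  simp only [Pi.sub_apply] at this
  rw [integral_sub (integrable_const _) hi, integral_indicator hms] at this
  simp only [integral_const, probReal_univ, smul_eq_mul, one_mul, mul_one,
    measureReal_restrict_apply_univ] at this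
  linarith

lemma tendsto_integral_zero [∀ n, IsProbabilityMeasure (P n)] {f : (n : ℕ) → Ω n → ℝ}
    (hm : ∀ n, Measurable (f n)) (h0 : ∀ n ω, 0 ≤ f n ω) (h1 : ∀ n ω, f n ω ≤ 1)
    (h : ∀ η : ℝ, 0 < η → WithHighProb P (fun n ω => f n ω ≤ η)) :
    Tendsto (fun n => ∫ ω, f n ω ∂P n) atTop (𝓝 0) := by
  have hint : ∀ n, Integrable (f n) (P n) := fun n =>
    Integrable.of_bound (hm n).aestronglyMeasurable 1 (Eventually.of_forall fun ω => by
      rw [Real.norm_eq_abs, abs_of_nonneg (h0 n ω)]; exact h1 n ω)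
  have := tendsto_integral_one (P := P) (f := fun n ω => 1 - f n ω)
    (fun n => measurable_const.sub (hm n)) (fun n ω => by linarith [h1 n ω])
    (fun n ω => by linarith [h0 n ω])
    (fun η hη => (h η hη).mono (Eventually.of_forall fun n ω hω => by linarith))
  have h2 := this.const_sub 1
  simp only [sub_self] at h2
  refine h2.congr fun n => ?_
  rw [integral_sub (integrable_const _) (hint n)]
  simp

end WithHighProb

/-! ### A second moment bound -/

/-- Chebyshev's inequality for a sum of square integrable variables with nonpositive pairwise
correlations. -/
lemma measure_abs_sum_gt_le {Ω ι : Type*} [MeasurableSpace Ω] {P : Measure Ω}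
    [IsProbabilityMeasure P] {Z : ι → Ω → ℝ} {S : Finset ι} {C t : ℝ} (ht : 0 < t)
    (hZ : ∀ i ∈ S, MemLp (Z i) 2 P) (hC : ∀ i ∈ S, ∫ ω, Z i ω * Z i ω ∂P ≤ C)
    (hcov : ∀ i ∈ S, ∀ j ∈ S, i ≠ j → ∫ ω, Z i ω * Z j ω ∂P ≤ 0) :
    P {ω | ¬ |∑ i ∈ S, Z i ω| ≤ t} ≤ ENNReal.ofReal (C * S.card / t ^ 2) := by
  have hint : ∀ i ∈ S, ∀ j ∈ S, Integrable (fun ω => Z i ω * Z j ω) P := fun i hi j hj =>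
    (hZ i hi).integrable_mul (hZ j hj)
  have hsq : ∀ ω, (∑ i ∈ S, Z i ω) ^ 2 = ∑ i ∈ S, ∑ j ∈ S, Z i ω * Z j ω := fun ω => by
    rw [sq, Finset.sum_mul_sum]
  have hI : Integrable (fun ω => (∑ i ∈ S, Z i ω) ^ 2) P := by
    simp only [hsq]
    exact integrable_finsetSum _ fun i hi => integrable_finsetSum _ fun j hj => hint i hi j hj
  have hE : ∫ ω, (∑ i ∈ S, Z i ω) ^ 2 ∂P ≤ C * S.card := by
    simp only [hsq]
    rw [integral_finsetSum _ fun i hi => integrable_finsetSum _ fun j hj => hint i hi j hj]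
    calc ∑ i ∈ S, ∫ ω, ∑ j ∈ S, Z i ω * Z j ω ∂P ≤ ∑ i ∈ S, C := by
          refine Finset.sum_le_sum fun i hi => ?_
          rw [integral_finsetSum _ fun j hj => hint i hi j hj]
          classical
          rw [← Finset.add_sum_erase _ _ hi]
          have := Finset.sum_nonpos (s := S.erase i) (f := fun j => ∫ ω, Z i ω * Z j ω ∂P)
            fun j hj => hcov i hi j (Finset.mem_of_mem_erase hj) (Finset.ne_of_mem_erase hj).symm
          linarith [hC i hi]
      _ = C * S.card := by rw [Finset.sum_const, nsmul_eq_mul, mul_comm]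
  have hmk := mul_meas_ge_le_integral_of_nonneg
    (Eventually.of_forall fun ω => sq_nonneg (∑ i ∈ S, Z i ω)) hI (t ^ 2)
  have hsub : {ω | ¬ |∑ i ∈ S, Z i ω| ≤ t} ⊆ {ω | t ^ 2 ≤ (∑ i ∈ S, Z i ω) ^ 2} := by
    intro ω hω
    simp only [Set.mem_ofPred_eq, not_le] at hω ⊢
    rw [← sq_abs (∑ i ∈ S, Z i ω)]
    gcongr
  refine (measure_mono hsub).trans ?_
  rw [← ofReal_measureReal]
  refine ENNReal.ofReal_le_ofReal ?_
  rw [le_div_iff₀ (by positivity)]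
  linarith

/-! ### Gaussian tails -/

/-- The upper tail `1 - Φ` of the standard Gaussian distribution. -/
noncomputable def gaussianTail (t : ℝ) : ℝ := 1 - cdf (gaussianReal 0 1) t

lemma gaussianTail_eq_Ioi (t : ℝ) : gaussianTail t = (gaussianReal 0 1).real (Set.Ioi t) := by
  rw [gaussianTail, cdf_eq_real, ← Set.compl_Iic, probReal_compl_eq_one_sub measurableSet_Iic]

lemma gaussianTail_eq_Ici (t : ℝ) : gaussianTail t = (gaussianReal 0 1).real (Set.Ici t) := by
  rw [gaussianTail_eq_Ioi]
  have := nullSingletonClass_gaussianReal (μ := 0) (v := 1) one_ne_zero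
  exact measureReal_congr Ioi_ae_eq_Ici

lemma gaussianTail_antitone : Antitone gaussianTail := fun s t hst => by
  unfold gaussianTail
  linarith [monotone_cdf (gaussianReal 0 1) hst]

lemma gaussianTail_nonneg (t : ℝ) : 0 ≤ gaussianTail t := by
  rw [gaussianTail_eq_Ici]; exact measureReal_nonneg

lemma gaussianTail_le_exp {t : ℝ} (ht : 0 ≤ t) : gaussianTail t ≤ Real.exp (-t ^ 2 / 2) := by
  have h := measure_ge_le_exp_mul_mgf (μ := gaussianReal 0 1) (X := id) (t := t) t ht
    (integrable_exp_mul_gaussianReal t)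
  rw [mgf_id_gaussianReal, ← Real.exp_add] at h
  rw [gaussianTail_eq_Ici]
  refine h.trans (Real.exp_le_exp.2 ?_)
  simp only [NNReal.coe_one]
  nlinarith

lemma gaussianPDFReal_std (x : ℝ) :
    gaussianPDFReal 0 1 x = (Real.sqrt (2 * Real.pi))⁻¹ * Real.exp (-x ^ 2 / 2) := by
  simp [gaussianPDFReal]

/-- A lower bound for the tail: `[t, t + 1]` has length one and the density is at least its value at
`t + 1` there. -/
lemma le_gaussianTail {t : ℝ} (ht : 0 ≤ t) :
    (Real.sqrt (2 * Real.pi))⁻¹ * Real.exp (-(t + 1) ^ 2 / 2) ≤ gaussianTail t := by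
  rw [gaussianTail_eq_Ici]
  calc _ = ∫ _ in Set.Icc t (t + 1),
          (Real.sqrt (2 * Real.pi))⁻¹ * Real.exp (-(t + 1) ^ 2 / 2) := by simp
    _ ≤ ∫ x in Set.Icc t (t + 1), gaussianPDFReal 0 1 x := by
        refine setIntegral_mono_on (integrableOn_const (by simp)) (integrable_gaussianPDFReal 0 1).integrableOn
          measurableSet_Icc fun x hx => ?_
        rw [gaussianPDFReal_std]
        gcongr
        · linarith [hx.1]
        · exact hx.2
    _ = (gaussianReal 0 1).real (Set.Icc t (t + 1)) := by
        rw [Measure.real, gaussianReal_apply_eq_integral 0 one_ne_zero, ENNReal.toReal_ofReal]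
        exact setIntegral_nonneg measurableSet_Icc fun x _ => gaussianPDFReal_nonneg _ _ _
    _ ≤ _ := measureReal_mono Set.Icc_subset_Ici_self

/-- Shifting the threshold down by `h` multiplies the tail by at most `exp (M h)`, up to the tail
beyond `M`: this is the likelihood ratio of `N(h, 1)` to `N(0, 1)` on `(-∞, M]`. -/
lemma gaussianTail_sub_le {t h M : ℝ} (hh : 0 ≤ h) :
    gaussianTail (t - h) ≤ Real.exp (M * h) * gaussianTail t + gaussianTail (M - h) := by
  have hshift : ∀ s : ℝ, gaussianTail (s - h) = (gaussianReal h 1).real (Set.Ici s) := fun s => by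
    have h1 := gaussianReal_map_add_const (μ := 0) (v := 1) h
    rw [zero_add] at h1
    rw [← h1, map_measureReal_apply (by fun_prop) measurableSet_Ici, gaussianTail_eq_Ici]
    congr 1
    ext x
    simp
  have hden : ∀ x ≤ M, gaussianPDF h 1 x ≤ ENNReal.ofReal (Real.exp (M * h)) * gaussianPDF 0 1 x := by
    intro x hx
    rw [gaussianPDF, gaussianPDF, ← ENNReal.ofReal_mul (Real.exp_nonneg _)]
    refine ENNReal.ofReal_le_ofReal ?_
    simp only [gaussianPDFReal, NNReal.coe_one, mul_one, sub_zero]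
    rw [mul_left_comm, ← Real.exp_add]
    gcongr
    nlinarith [sq_nonneg h]
  have hsub : Set.Ici t ⊆ (Set.Ici t ∩ Set.Iic M) ∪ Set.Ici M := by
    intro x hx
    rcases le_total x M with hxM | hxM
    · exact Or.inl ⟨hx, hxM⟩
    · exact Or.inr hxM
  have hmeas : MeasurableSet (Set.Ici t ∩ Set.Iic M) := measurableSet_Ici.inter measurableSet_Iic
  have h1 : gaussianReal h 1 (Set.Ici t ∩ Set.Iic M) ≤
      ENNReal.ofReal (Real.exp (M * h)) * gaussianReal 0 1 (Set.Ici t) := by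
    rw [gaussianReal_apply _ one_ne_zero, gaussianReal_apply _ one_ne_zero,
      ← lintegral_const_mul _ (measurable_gaussianPDF 0 1)]
    exact (setLIntegral_mono ((measurable_gaussianPDF 0 1).const_mul _)
      fun x hx => hden x hx.2).trans (lintegral_mono_set Set.inter_subset_left)
  have h2 : (gaussianReal h 1).real (Set.Ici t ∩ Set.Iic M) ≤
      Real.exp (M * h) * (gaussianReal 0 1).real (Set.Ici t) := by
    have := ENNReal.toReal_mono (ENNReal.mul_ne_top ENNReal.ofReal_ne_top (measure_ne_top _ _)) h1
    rwa [ENNReal.toReal_mul, ENNReal.toReal_ofReal (Real.exp_nonneg _)] at this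
  rw [hshift, hshift, gaussianTail_eq_Ici]
  exact (measureReal_mono hsub).trans ((measureReal_union_le _ _).trans (by gcongr))

lemma exists_gaussianTail_gt {a : ℝ} (ha : a < 1) : ∃ L, a < gaussianTail L := by
  have h : Tendsto gaussianTail atBot (𝓝 1) := by
    have := (tendsto_cdf_atBot (gaussianReal 0 1)).const_sub 1
    rwa [sub_zero] at this
  exact (h.eventually (lt_mem_nhds ha)).exists

/-- An approximate upper quantile. -/
lemma exists_gaussianTail_le {v δ L t : ℝ} (hL : v < gaussianTail L)
    (ht : gaussianTail t ≤ v) (hδ : 0 < δ) :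
    ∃ τ, L ≤ τ ∧ τ ≤ t ∧ gaussianTail τ ≤ v ∧ ∀ z, gaussianTail z ≤ v → τ - δ ≤ z := by
  set S : Set ℝ := {z | gaussianTail z ≤ v}
  have hLS : ∀ z ∈ S, L ≤ z := fun z hz => by
    by_contra hlt
    exact absurd (gaussianTail_antitone (not_le.1 hlt).le) (not_le.2 (lt_of_le_of_lt hz hL))
  have hbdd : BddBelow S := ⟨L, hLS⟩
  obtain ⟨τ, hτ, hlt⟩ := exists_lt_of_csInf_lt (s := S) ⟨t, ht⟩ (lt_add_of_pos_right (sInf S) hδ)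
  by_cases htt : τ ≤ t
  · exact ⟨τ, hLS τ hτ, htt, hτ, fun z hz => by linarith [csInf_le hbdd hz]⟩
  · exact ⟨t, hLS t ht, le_rfl, ht, fun z hz => by linarith [csInf_le hbdd hz]⟩

/-! ### The noise variables -/

/-- The noise in the observed outcome of subject `i`, so that `Y i = μ i 1{A i} + noise`. -/
def noise {Ω : Type*} {n : ℕ} (μ : Fin n → ℝ) (YC YT : Fin n → Ω → ℝ) (A : Fin n → Ω → Bool)
    (i : Fin n) (ω : Ω) : ℝ :=
  if A i ω then YT i ω - μ i else YC i ω

/-- The noise with its sign flipped in the control arm: the difference between the two potential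
outcomes, the unobserved one being replaced by its mean, is `μ i + signedNoise`. -/
def signedNoise {Ω : Type*} {n : ℕ} (μ : Fin n → ℝ) (YC YT : Fin n → Ω → ℝ) (A : Fin n → Ω → Bool)
    (i : Fin n) (ω : Ω) : ℝ :=
  if A i ω then noise μ YC YT A i ω else -noise μ YC YT A i ω

lemma abs_signedNoise {Ω : Type*} {n : ℕ} (μ : Fin n → ℝ) (YC YT : Fin n → Ω → ℝ)
    (A : Fin n → Ω → Bool) (i : Fin n) (ω : Ω) :
    |signedNoise μ YC YT A i ω| = |noise μ YC YT A i ω| := by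
  unfold signedNoise
  split_ifs <;> simp

lemma observed_eq_add_noise {Ω : Type*} {n : ℕ} (μ : Fin n → ℝ) (YC YT : Fin n → Ω → ℝ)
    (A : Fin n → Ω → Bool) (i : Fin n) (ω : Ω) :
    observed (fun i => A i ω) (fun i => YC i ω) (fun i => YT i ω) i =
      (if A i ω then μ i else 0) + noise μ YC YT A i ω := by
  unfold observed noise
  split_ifs <;> ring

namespace CrossfitICube.IsGaussianTrial

variable {Ω : Type*} [MeasurableSpace Ω] {P : Measure Ω} {n : ℕ}
  {μ : Fin n → ℝ} {YC YT : Fin n → Ω → ℝ} {A : Fin n → Ω → Bool} {I : Ω → Finset (Fin n)}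

lemma measurableSet_arm (h : IsGaussianTrial P μ YC YT A I) (i : Fin n) (b : Bool) :
    MeasurableSet {ω | A i ω = b} :=
  h.measurable_A i (measurableSet_singleton b)

lemma measurable_noise (h : IsGaussianTrial P μ YC YT A I) (i : Fin n) :
    Measurable (noise μ YC YT A i) :=
  Measurable.ite (h.measurableSet_arm i true) ((h.measurable_YT i).sub_const _) (h.measurable_YC i)

lemma measurable_signedNoise (h : IsGaussianTrial P μ YC YT A I) (i : Fin n) :
    Measurable (signedNoise μ YC YT A i) :=
  Measurable.ite (h.measurableSet_arm i true) (h.measurable_noise i) (h.measurable_noise i).neg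

lemma measurable_split (h : IsGaussianTrial P μ YC YT A I) (i : Fin n) :
    Measurable (fun ω => decide (i ∈ I ω)) :=
  (measurable_pi_apply i).comp h.measurable_I

lemma measure_noise_inter_arm (h : IsGaussianTrial P μ YC YT A I) (i : Fin n) (b : Bool)
    {s : Set ℝ} (hs : MeasurableSet s) :
    P (noise μ YC YT A i ⁻¹' s ∩ {ω | A i ω = b}) =
      gaussianReal 0 1 s * P {ω | A i ω = b} := by
  have hA : ∀ b, {ω | A i ω = b} = A i ⁻¹' {b} := fun b => rfl
  cases b with
  | true =>
    have hind := ((h.indep_assignment i).comp measurable_snd measurable_id).measure_inter_preimage_eq_mul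
      ((fun x => x - μ i) ⁻¹' s) {true} ((measurable_id.sub_const _) hs) (measurableSet_singleton _)
    have hlaw : P ((fun ω => YT i ω) ⁻¹' ((fun x => x - μ i) ⁻¹' s)) = gaussianReal 0 1 s := by
      have hsub : Measurable fun x : ℝ => x - μ i := by fun_prop
      rw [← Measure.map_apply (h.measurable_YT i) (hsub hs), h.law_YT,
        ← Measure.map_apply hsub hs, gaussianReal_map_sub_const, sub_self]
    rw [hA, ← hlaw]
    refine Eq.trans (congrArg P ?_) hind
    ext ω
    simp only [Set.mem_inter_iff, Set.mem_preimage, Set.mem_singleton_iff, Function.comp, id]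
    constructor
    · rintro ⟨h1, h2⟩; simpa [noise, h2] using h1
    · rintro ⟨h1, h2⟩; simpa [noise, h2] using h1
  | false =>
    have hind := ((h.indep_assignment i).comp measurable_fst measurable_id).measure_inter_preimage_eq_mul
      s {false} hs (measurableSet_singleton _)
    have hlaw : P ((fun ω => YC i ω) ⁻¹' s) = gaussianReal 0 1 s := by
      rw [← Measure.map_apply (h.measurable_YC i) hs, h.law_YC]
    rw [hA, ← hlaw]
    refine Eq.trans (congrArg P ?_) hind
    ext ω
    simp only [Set.mem_inter_iff, Set.mem_preimage, Set.mem_singleton_iff, Function.comp, id]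
    constructor
    · rintro ⟨h1, h2⟩; simpa [noise, h2] using h1
    · rintro ⟨h1, h2⟩; simpa [noise, h2] using h1

lemma measure_eq_sum_arms (h : IsGaussianTrial P μ YC YT A I) (i : Fin n) (s : Set Ω) :
    P s = P (s ∩ {ω | A i ω = true}) + P (s ∩ {ω | A i ω = false}) := by
  rw [← measure_inter_add_sdiff s (h.measurableSet_arm i true)]
  congr 2
  ext ω
  simp

lemma noise_law [IsProbabilityMeasure P] (h : IsGaussianTrial P μ YC YT A I) (i : Fin n) :
    P.map (noise μ YC YT A i) = gaussianReal 0 1 := by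
  ext s hs
  rw [Measure.map_apply (h.measurable_noise i) hs, h.measure_eq_sum_arms i,
    h.measure_noise_inter_arm i _ hs, h.measure_noise_inter_arm i _ hs, ← mul_add]
  have := h.measure_eq_sum_arms i Set.univ
  simp only [Set.univ_inter, measure_univ] at this
  rw [← this, mul_one]

lemma measurePreserving_noise [IsProbabilityMeasure P] (h : IsGaussianTrial P μ YC YT A I)
    (i : Fin n) : MeasurePreserving (noise μ YC YT A i) P (gaussianReal 0 1) :=
  ⟨h.measurable_noise i, h.noise_law i⟩

lemma indep_noise_arm [IsProbabilityMeasure P] (h : IsGaussianTrial P μ YC YT A I) (i : Fin n) :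
    IndepFun (noise μ YC YT A i) (A i) P := by
  have key : ∀ b, ∀ s : Set ℝ, MeasurableSet s →
      P (noise μ YC YT A i ⁻¹' s ∩ A i ⁻¹' {b}) =
        P (noise μ YC YT A i ⁻¹' s) * P (A i ⁻¹' {b}) := fun b s hs => by
    rw [← Measure.map_apply (h.measurable_noise i) hs, h.noise_law]
    exact h.measure_noise_inter_arm i b hs
  rw [indepFun_iff_measure_inter_preimage_eq_mul]
  intro s t hs ht
  by_cases h1 : true ∈ t <;> by_cases h2 : false ∈ t
  · have : t = Set.univ := by ext b; cases b <;> simp [h1, h2]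
    rw [this, Set.preimage_univ, Set.inter_univ, measure_univ, mul_one]
  · have : t = {true} := by ext b; cases b <;> simp [h1, h2]
    rw [this]; exact key _ s hs
  · have : t = {false} := by ext b; cases b <;> simp [h1, h2]
    rw [this]; exact key _ s hs
  · have : t = ∅ := by ext b; cases b <;> simp [h1, h2]
    simp [this]

/-- The tail of the signed noise is Gaussian, by the symmetry of the Gaussian law. -/
lemma signedNoise_tail [IsProbabilityMeasure P] (h : IsGaussianTrial P μ YC YT A I) (i : Fin n)
    (t : ℝ) : P.real {ω | t ≤ signedNoise μ YC YT A i ω} = gaussianTail t := by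
  have hneg : gaussianReal 0 1 (Set.Iic (-t)) = gaussianReal 0 1 (Set.Ici t) := by
    have h1 := gaussianReal_map_neg (μ := 0) (v := 1)
    rw [neg_zero] at h1
    conv_rhs => rw [← h1, Measure.map_apply measurable_neg measurableSet_Ici]
    congr 1
    ext x
    simp
  rw [gaussianTail_eq_Ici, Measure.real, Measure.real]
  congr 1
  have e1 : {ω | t ≤ signedNoise μ YC YT A i ω} ∩ {ω | A i ω = true} =
      noise μ YC YT A i ⁻¹' Set.Ici t ∩ {ω | A i ω = true} := by
    ext ω
    simp +contextual [signedNoise]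
  have e2 : {ω | t ≤ signedNoise μ YC YT A i ω} ∩ {ω | A i ω = false} =
      noise μ YC YT A i ⁻¹' Set.Iic (-t) ∩ {ω | A i ω = false} := by
    ext ω
    simp +contextual [signedNoise, le_neg]
  rw [h.measure_eq_sum_arms i, e1, e2, h.measure_noise_inter_arm i _ measurableSet_Ici,
    h.measure_noise_inter_arm i _ measurableSet_Iic, hneg, ← mul_add]
  have := h.measure_eq_sum_arms i Set.univ
  simp only [Set.univ_inter, measure_univ] at this
  rw [← this, mul_one]

lemma iIndepFun_noise_arm (h : IsGaussianTrial P μ YC YT A I) :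
    iIndepFun (fun i ω => (noise μ YC YT A i ω, A i ω)) P := by
  refine h.indep_subjects.comp
    (fun i (x : ℝ × ℝ × Bool) => ((if x.2.2 then x.2.1 - μ i else x.1), x.2.2)) fun i => ?_
  refine Measurable.prodMk (Measurable.ite ?_ (by fun_prop) (by fun_prop)) (by fun_prop)
  exact (measurable_snd.comp measurable_snd) (measurableSet_singleton true)

lemma indep_noise_split (h : IsGaussianTrial P μ YC YT A I) :
    IndepFun (fun ω i => decide (i ∈ I ω)) (fun ω i => (noise μ YC YT A i ω, A i ω)) P := by
  refine (h.indep_split.comp (φ := fun (x : Fin n → ℝ × ℝ × Bool) (i : Fin n) =>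
    ((if (x i).2.2 then (x i).2.1 - μ i else (x i).1), (x i).2.2)) (ψ := id) ?_ measurable_id).symm
  refine measurable_pi_lambda _ fun i => ?_
  refine Measurable.prodMk (Measurable.ite ?_ (by fun_prop) (by fun_prop)) (by fun_prop)
  exact (measurable_snd.comp (measurable_snd.comp (measurable_pi_apply i)))
    (measurableSet_singleton true)

lemma integral_arm [IsProbabilityMeasure P] (h : IsGaussianTrial P μ YC YT A I) (i : Fin n)
    (w : Bool → ℝ) : ∫ ω, w (A i ω) ∂P = (w true + w false) / 2 := by
  have hT : P.real {ω | A i ω = true} = 1 / 2 := by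
    rw [Measure.real, h.law_A]; simp
  have hF : P.real {ω | A i ω = false} = 1 / 2 := by
    have : {ω | A i ω = false} = {ω | A i ω = true}ᶜ := by ext; simp
    rw [this, probReal_compl_eq_one_sub (h.measurableSet_arm i true), hT]
    norm_num
  have := Measure.isProbabilityMeasure_map (μ := P) (h.measurable_A i).aemeasurable
  rw [← integral_map (φ := A i) (f := w) (h.measurable_A i).aemeasurable
    (measurable_of_finite w).aestronglyMeasurable, integral_fintype (Integrable.of_finite),
    Fintype.sum_bool, map_measureReal_apply (h.measurable_A i) (measurableSet_singleton _),
    map_measureReal_apply (h.measurable_A i) (measurableSet_singleton _)]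
  change P.real {ω | A i ω = true} • _ + P.real {ω | A i ω = false} • _ = _
  rw [hT, hF]
  simp only [smul_eq_mul]
  ring

/-! ### Laws of large numbers -/

/-- The law of large numbers behind all averages of the two procedures: `m` selects a half of the
split (or everything), `w` an arm (or a contrast of the arms), and `k` is the statistic. -/
lemma measure_weightedSum_le [IsProbabilityMeasure P] (h : IsGaussianTrial P μ YC YT A I)
    (S : Finset (Fin n)) {m w : Bool → ℝ} {k : ℝ → ℝ} (hk : Measurable k)
    (hk2 : MemLp k 2 (gaussianReal 0 1)) (hm : ∀ b, |m b| ≤ 1) (hw : ∀ b, |w b| ≤ 1)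
    (h0 : (w true + w false) * ∫ x, k x ∂gaussianReal 0 1 = 0) {t : ℝ} (ht : 0 < t) :
    P {ω | ¬ |∑ i ∈ S, m (decide (i ∈ I ω)) * (w (A i ω) * k (noise μ YC YT A i ω))| ≤ t} ≤
      ENNReal.ofReal ((∫ x, k x * k x ∂gaussianReal 0 1) * S.card / t ^ 2) := by
  have hmm : ∀ i, Measurable fun ω => m (decide (i ∈ I ω)) := fun i =>
    (measurable_of_finite m).comp (h.measurable_split i)
  have hwm : ∀ i, Measurable fun ω => w (A i ω) := fun i =>
    (measurable_of_finite w).comp (h.measurable_A i)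
  have hkm : ∀ i, Measurable fun ω => k (noise μ YC YT A i ω) := fun i =>
    hk.comp (h.measurable_noise i)
  have hkL : ∀ i, MemLp (fun ω => k (noise μ YC YT A i ω)) 2 P := fun i =>
    hk2.comp_measurePreserving (h.measurePreserving_noise i)
  have hbd : ∀ i ω, |m (decide (i ∈ I ω)) * (w (A i ω) * k (noise μ YC YT A i ω))| ≤
      |k (noise μ YC YT A i ω)| := fun i ω => by
    rw [abs_mul, abs_mul, ← mul_assoc]
    exact mul_le_of_le_one_left (abs_nonneg _) (mul_le_one₀ (hm _) (abs_nonneg _) (hw _))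
  have hZ : ∀ i, MemLp (fun ω => m (decide (i ∈ I ω)) * (w (A i ω) * k (noise μ YC YT A i ω))) 2 P :=
    fun i => (hkL i).mono ((hmm i).mul ((hwm i).mul (hkm i))).aestronglyMeasurable
      (Eventually.of_forall fun ω => hbd i ω)
  have hU : ∀ i, ∫ ω, w (A i ω) * k (noise μ YC YT A i ω) ∂P = 0 := fun i => by
    have hind := ((h.indep_noise_arm i).comp hk (measurable_of_finite w)).symm
    have := hind.integral_fun_mul_eq_mul_integral (hwm i).aestronglyMeasurable
      (hkm i).aestronglyMeasurable
    simp only [Function.comp] at this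
    rw [this, h.integral_arm, ← integral_map (φ := noise μ YC YT A i)
      (h.measurable_noise i).aemeasurable hk.aestronglyMeasurable, h.noise_law]
    linear_combination h0 / 2
  refine measure_abs_sum_gt_le ht (fun i _ => hZ i) (fun i _ => ?_) fun i _ j _ hij => le_of_eq ?_
  · have e : ∫ x, k x * k x ∂gaussianReal 0 1 =
        ∫ ω, k (noise μ YC YT A i ω) * k (noise μ YC YT A i ω) ∂P := by
      rw [← h.noise_law i, integral_map (h.measurable_noise i).aemeasurable
        (f := fun x => k x * k x) (hk.mul hk).aestronglyMeasurable]
    rw [e]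
    refine integral_mono ((hZ i).integrable_mul (hZ i)) ((hkL i).integrable_mul (hkL i)) fun ω => ?_
    exact abs_le_iff_mul_self_le.1 (hbd i ω)
  · have hU2 : ∫ ω, (w (A i ω) * k (noise μ YC YT A i ω)) *
        (w (A j ω) * k (noise μ YC YT A j ω)) ∂P = 0 := by
      have hg : Measurable fun x : ℝ × Bool => w x.2 * k x.1 :=
        ((measurable_of_finite w).comp measurable_snd).mul (hk.comp measurable_fst)
      have := ((h.iIndepFun_noise_arm.indepFun hij).comp hg hg).integral_fun_mul_eq_mul_integral
        ((hwm i).mul (hkm i)).aestronglyMeasurable ((hwm j).mul (hkm j)).aestronglyMeasurable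
      simp only [Function.comp] at this
      rw [this, hU, zero_mul]
    have hind := h.indep_noise_split.comp
      (φ := fun x : Fin n → Bool => m (x i) * m (x j))
      (ψ := fun x : Fin n → ℝ × Bool => (w (x i).2 * k (x i).1) * (w (x j).2 * k (x j).1))
      (measurable_of_finite _) (by
        have : ∀ i, Measurable fun x : Fin n → ℝ × Bool => w (x i).2 * k (x i).1 := fun i =>
          ((measurable_of_finite w).comp (measurable_snd.comp (measurable_pi_apply i))).mul
            (hk.comp (measurable_fst.comp (measurable_pi_apply i)))
        exact (this i).mul (this j))
    have := hind.integral_fun_mul_eq_mul_integral ((hmm i).mul (hmm j)).aestronglyMeasurable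
      (((hwm i).mul (hkm i)).mul ((hwm j).mul (hkm j))).aestronglyMeasurable
    simp only [Function.comp] at this
    rw [hU2, mul_zero] at this
    rw [← this]
    congr 1
    ext ω
    ring

/-- Few subjects have a large noise: by Markov's and Chebyshev's inequalities. -/
lemma measure_card_large_noise_le [IsProbabilityMeasure P] (h : IsGaussianTrial P μ YC YT A I)
    (S : Finset (Fin n)) {K η : ℝ} (hK : 0 < K) (hη : 0 < η) :
    P {ω | ¬ ((S.filter fun i => K ≤ |noise μ YC YT A i ω|).card : ℝ) ≤ η * S.card} ≤
      ENNReal.ofReal (1 / (η * K ^ 2)) := by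
  rcases S.eq_empty_or_nonempty with rfl | hS
  · simp
  have hcard : (0 : ℝ) < S.card := by exact_mod_cast hS.card_pos
  have hms : ∀ i, MeasurableSet {ω | K ≤ |noise μ YC YT A i ω|} := fun i =>
    measurableSet_le measurable_const (h.measurable_noise i).abs
  have hp : ∀ i, P.real {ω | K ≤ |noise μ YC YT A i ω|} ≤ 1 / K ^ 2 := fun i => by
    have h1 := meas_ge_le_variance_div_sq (μ := gaussianReal 0 1) (X := id)
      (memLp_id_gaussianReal' 2 (by simp)) hK
    simp only [variance_id_gaussianReal, id_eq, integral_id_gaussianReal, NNReal.coe_one] at h1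
    have h2 : P {ω | K ≤ |noise μ YC YT A i ω|} = gaussianReal 0 1 {x | K ≤ |x - 0|} := by
      rw [← h.noise_law i, Measure.map_apply (h.measurable_noise i)
        (measurableSet_le measurable_const (by fun_prop))]
      simp
    rw [Measure.real, h2]
    exact ENNReal.toReal_le_of_le_ofReal (by positivity) h1
  have hsum : ∀ ω, ((S.filter fun i => K ≤ |noise μ YC YT A i ω|).card : ℝ) =
      ∑ i ∈ S, Set.indicator {ω | K ≤ |noise μ YC YT A i ω|} (fun _ => (1 : ℝ)) ω := fun ω => by
    rw [Finset.card_filter]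
    push_cast
    refine Finset.sum_congr rfl fun i _ => ?_
    simp [Set.indicator_apply]
  have hint : ∀ i ∈ S, Integrable
      (Set.indicator {ω | K ≤ |noise μ YC YT A i ω|} (fun _ => (1 : ℝ))) P := fun i _ =>
    (integrable_const _).indicator (hms i)
  have hE : ∫ ω, ((S.filter fun i => K ≤ |noise μ YC YT A i ω|).card : ℝ) ∂P ≤
      S.card * (1 / K ^ 2) := by
    simp only [hsum]
    rw [integral_finsetSum _ hint, ← nsmul_eq_mul]
    refine Finset.sum_le_card_nsmul _ _ _ fun i _ => ?_
    rw [integral_indicator (hms i)]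
    simpa using hp i
  have hI : Integrable (fun ω => ((S.filter fun i => K ≤ |noise μ YC YT A i ω|).card : ℝ)) P := by
    simp only [hsum]
    exact integrable_finsetSum _ hint
  have hmk := mul_meas_ge_le_integral_of_nonneg
    (Eventually.of_forall fun ω => Nat.cast_nonneg _) hI (η * S.card)
  refine (measure_mono (t := {ω | η * S.card ≤
    ((S.filter fun i => K ≤ |noise μ YC YT A i ω|).card : ℝ)})
    fun ω hω => (not_le.1 hω).le).trans ?_
  rw [← ofReal_measureReal]
  refine ENNReal.ofReal_le_ofReal ?_
  have h3 := hmk.trans hE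
  rw [le_div_iff₀ (by positivity)]
  have h4 : S.card * (P.real {ω | η * S.card ≤
    ((S.filter fun i => K ≤ |noise μ YC YT A i ω|).card : ℝ)} * η) ≤ S.card * (1 / K ^ 2) := by
    linarith
  have h5 := le_of_mul_le_mul_left h4 hcard
  rw [le_div_iff₀ (by positivity)] at h5
  linarith

/-- Chernoff's bound for the number of exceedances of a threshold by the signed noise. -/
lemma measure_card_exceedances_le [IsProbabilityMeasure P] (h : IsGaussianTrial P μ YC YT A I)
    (S : Finset (Fin n)) {t b l : ℝ} (hl : 0 ≤ l) :
    P {ω | b ≤ ((S.filter fun i => t ≤ signedNoise μ YC YT A i ω).card : ℝ)} ≤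
      ENNReal.ofReal (Real.exp (S.card * (gaussianTail t * (Real.exp l - 1)) - l * b)) := by
  set f : ℝ → ℝ := Set.indicator (Set.Ici t) (fun _ => (1 : ℝ)) with hf
  have hfm : Measurable f := measurable_const.indicator measurableSet_Ici
  set V : Fin n → Ω → ℝ := fun i ω => f (signedNoise μ YC YT A i ω) with hV
  have hVm : ∀ i, Measurable (V i) := fun i => hfm.comp (h.measurable_signedNoise i)
  have hVind : iIndepFun V P := by
    refine h.iIndepFun_noise_arm.comp
      (fun _ (x : ℝ × Bool) => f (if x.2 then x.1 else -x.1)) fun i => hfm.comp ?_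
    exact Measurable.ite (measurable_snd (measurableSet_singleton true)) measurable_fst
      measurable_fst.neg
  have hms : ∀ i, MeasurableSet {ω | t ≤ signedNoise μ YC YT A i ω} := fun i =>
    measurableSet_le measurable_const (h.measurable_signedNoise i)
  have hexp : ∀ i ω, Real.exp (l * V i ω) =
      1 + Set.indicator {ω | t ≤ signedNoise μ YC YT A i ω} (fun _ => Real.exp l - 1) ω := by
    intro i ω
    by_cases hω : t ≤ signedNoise μ YC YT A i ω
    · simp [hV, hf, hω]
    · simp [hV, hf, hω]
  have hmgf : ∀ i, mgf (V i) P l = 1 + gaussianTail t * (Real.exp l - 1) := fun i => by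
    rw [mgf]
    simp only [hexp]
    rw [integral_add (integrable_const _) ((integrable_const _).indicator (hms i)),
      integral_indicator (hms i)]
    simp [h.signedNoise_tail i t]
  have hsum : ∀ ω, ((S.filter fun i => t ≤ signedNoise μ YC YT A i ω).card : ℝ) =
      (∑ i ∈ S, V i) ω := fun ω => by
    rw [Finset.card_filter, Finset.sum_apply]
    push_cast
    refine Finset.sum_congr rfl fun i _ => ?_
    simp [hV, hf, Set.indicator_apply]
  have hint : Integrable (fun ω => Real.exp (l * (∑ i ∈ S, V i) ω)) P := by
    refine Integrable.of_bound (C := Real.exp (l * S.card)) ?_ (Eventually.of_forall fun ω => ?_)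
    · simp only [Finset.sum_apply]
      exact (Real.measurable_exp.comp
        ((Finset.measurable_sum S fun i _ => hVm i).const_mul l)).aestronglyMeasurable
    · rw [Real.norm_eq_abs, Real.abs_exp, ← hsum]
      gcongr
      exact S.filter_subset _
  have hch := measure_ge_le_exp_mul_mgf (μ := P) b hl hint
  rw [hVind.mgf_sum hVm, Finset.prod_congr rfl fun i _ => hmgf i, Finset.prod_const] at hch
  simp only [← hsum] at hch
  rw [← ofReal_measureReal]
  refine ENNReal.ofReal_le_ofReal (hch.trans ?_)
  have h1 : 1 + gaussianTail t * (Real.exp l - 1) ≤ Real.exp (gaussianTail t * (Real.exp l - 1)) := by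
    linarith [Real.add_one_le_exp (gaussianTail t * (Real.exp l - 1))]
  have h0 : 0 ≤ 1 + gaussianTail t * (Real.exp l - 1) := by
    have := mul_nonneg (gaussianTail_nonneg t) (sub_nonneg.2 (Real.one_le_exp hl))
    linarith
  calc _ ≤ Real.exp (-l * b) * Real.exp (gaussianTail t * (Real.exp l - 1)) ^ S.card := by gcongr
    _ = _ := by rw [← Real.exp_nat_mul, ← Real.exp_add]; congr 1; ring

end CrossfitICube.IsGaussianTrial

/-! ### The random split -/

/-- The centred membership indicator. -/
noncomputable def centredMem {n : ℕ} (i : Fin n) (s : Finset (Fin n)) : ℝ :=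
  (if i ∈ s then 1 else 0) - 1 / 2

lemma centredMem_mul_self {n : ℕ} (i : Fin n) (s : Finset (Fin n)) :
    centredMem i s * centredMem i s = 1 / 4 := by
  unfold centredMem
  split_ifs <;> norm_num

lemma abs_centredMem {n : ℕ} (i : Fin n) (s : Finset (Fin n)) : |centredMem i s| = 1 / 2 := by
  unfold centredMem
  split_ifs <;> norm_num [abs_of_pos, abs_of_neg]

lemma sum_centredMem {n : ℕ} (S s : Finset (Fin n)) :
    ∑ i ∈ S, centredMem i s = ((S ∩ s).card : ℝ) - S.card / 2 := by
  simp only [centredMem]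
  rw [Finset.sum_sub_distrib, Finset.sum_const, nsmul_eq_mul, ← Finset.filter_mem_eq_inter,
    Finset.card_filter]
  push_cast
  ring

/-- Memberships of two subjects in a uniformly random half are nonpositively correlated: by symmetry
the correlations with a fixed subject `k` are all equal, and they sum up to a constant since the size
of the half is fixed. -/
lemma sum_centredMem_mul_nonpos {n : ℕ} {k l : Fin n} (hkl : k ≠ l) :
    ∑ s ∈ (Finset.univ : Finset (Fin n)).powersetCard (n / 2), centredMem k s * centredMem l s
      ≤ 0 := by
  set U := (Finset.univ : Finset (Fin n)).powersetCard (n / 2) with hU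
  have hcard : ∀ s ∈ U, s.card = n / 2 := fun s hs => (Finset.mem_powersetCard.1 hs).2
  have hsym : ∀ l' ∈ Finset.univ.erase k, ∑ s ∈ U, centredMem k s * centredMem l' s =
      ∑ s ∈ U, centredMem k s * centredMem l s := by
    intro l' hl'
    have hl'k : l' ≠ k := Finset.ne_of_mem_erase hl'
    refine Finset.sum_equiv (Equiv.swap l l').finsetCongr (fun s => ?_) fun s _ => ?_
    · simp [hU, Finset.mem_powersetCard]
    · have h1 : ∀ i, i ∈ (Equiv.swap l l').finsetCongr s ↔ Equiv.swap l l' i ∈ s := fun i => by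
        simp [Equiv.finsetCongr_apply, Finset.mem_map_equiv]
      simp only [centredMem, h1, Equiv.swap_apply_left,
        Equiv.swap_apply_of_ne_of_ne hkl hl'k.symm]
  have hn : 2 ≤ n := by
    have h1 := k.2
    have h2 := l.2
    have : (k : ℕ) ≠ l := fun h => hkl (Fin.ext h)
    omega
  have htot : ∀ s ∈ U, ∑ l' ∈ Finset.univ.erase k, centredMem k s * centredMem l' s ≤ 0 := by
    intro s hs
    have h1 : ∑ l', centredMem k s * centredMem l' s =
        centredMem k s * (((n / 2 : ℕ) : ℝ) - n / 2) := by
      rw [← Finset.mul_sum, sum_centredMem, Finset.univ_inter, hcard s hs]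
      simp
    rw [← Finset.add_sum_erase _ _ (Finset.mem_univ k), centredMem_mul_self] at h1
    have h2 : |((n / 2 : ℕ) : ℝ) - n / 2| ≤ 1 / 2 := by
      rcases Nat.even_or_odd' n with ⟨m, rfl | rfl⟩
      · norm_num
      · have : (2 * m + 1) / 2 = m := by omega
        rw [this, abs_le]
        push_cast
        constructor <;> linarith
    have h3 : centredMem k s * (((n / 2 : ℕ) : ℝ) - n / 2) ≤ 1 / 4 := by
      refine (le_abs_self _).trans ?_
      rw [abs_mul, abs_centredMem]
      linarith
    linarith
  have hsum := Finset.sum_nonpos htot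
  rw [Finset.sum_comm, Finset.sum_congr rfl hsym, Finset.sum_const, nsmul_eq_mul,
    Finset.card_erase_of_mem (Finset.mem_univ k), Finset.card_univ, Fintype.card_fin] at hsum
  have hpos : (0 : ℝ) < ((n - 1 : ℕ) : ℝ) := by exact_mod_cast (by omega : 0 < n - 1)
  exact nonpos_of_mul_nonpos_right hsum hpos

namespace CrossfitICube.IsGaussianTrial

section

variable {Ω : Type*} [MeasurableSpace Ω] {P : Measure Ω} {n : ℕ}
  {μ : Fin n → ℝ} {YC YT : Fin n → Ω → ℝ} {A : Fin n → Ω → Bool} {I : Ω → Finset (Fin n)}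

lemma measurableSet_split (h : IsGaussianTrial P μ YC YT A I) (s : Finset (Fin n)) :
    MeasurableSet {ω | I ω = s} := by
  have : {ω | I ω = s} = (fun ω i => decide (i ∈ I ω)) ⁻¹' {fun i => decide (i ∈ s)} := by
    ext ω
    simp [funext_iff, Finset.ext_iff]
  rw [this]
  exact h.measurable_I (measurableSet_singleton _)

lemma integral_split_eq_sum [IsProbabilityMeasure P] (h : IsGaussianTrial P μ YC YT A I)
    (F : Finset (Fin n) → ℝ) : ∫ ω, F (I ω) ∂P = ∑ s, P.real {ω | I ω = s} * F s := by
  have h1 : ∀ ω, F (I ω) = ∑ s, Set.indicator {ω | I ω = s} (fun _ => F s) ω := fun ω => by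
    simp [Set.indicator_apply]
  simp only [h1]
  rw [integral_finsetSum _ fun s _ => (integrable_const _).indicator (h.measurableSet_split s)]
  refine Finset.sum_congr rfl fun s _ => ?_
  rw [integral_indicator (h.measurableSet_split s)]
  simp

lemma integral_split [IsProbabilityMeasure P] (h : IsGaussianTrial P μ YC YT A I)
    (F : Finset (Fin n) → ℝ) :
    ∫ ω, F (I ω) ∂P = (1 / (n.choose (n / 2) : ℝ)) *
      ∑ s ∈ (Finset.univ : Finset (Fin n)).powersetCard (n / 2), F s := by
  set U := (Finset.univ : Finset (Fin n)).powersetCard (n / 2) with hU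
  have hch : (0 : ℝ) < n.choose (n / 2) := by
    exact_mod_cast Nat.choose_pos (Nat.div_le_self n 2)
  have hp : ∀ s ∈ U, P.real {ω | I ω = s} = 1 / (n.choose (n / 2) : ℝ) := fun s hs => by
    rw [Measure.real, h.law_I s (Finset.mem_powersetCard.1 hs).2]
    simp
  have hU1 : ∑ s ∈ U, P.real {ω | I ω = s} = 1 := by
    rw [Finset.sum_congr rfl hp, Finset.sum_const, hU, Finset.card_powersetCard,
      Finset.card_univ, Fintype.card_fin, nsmul_eq_mul]
    field_simp
  have htot : ∑ s, P.real {ω | I ω = s} = 1 := by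
    have := h.integral_split_eq_sum fun _ => 1
    simpa using this.symm
  -- the sets of the right size carry all the mass
  have hz : ∀ s ∉ U, P.real {ω | I ω = s} = 0 := by
    rw [← Finset.sum_add_sum_compl U, hU1] at htot
    have h0 : ∑ s ∈ Uᶜ, P.real {ω | I ω = s} = 0 := by linarith
    intro s hs
    exact (Finset.sum_eq_zero_iff_of_nonneg fun s _ => measureReal_nonneg).1 h0 s
      (Finset.mem_compl.2 hs)
  rw [h.integral_split_eq_sum, ← Finset.sum_subset (Finset.subset_univ U) fun s _ hs => by
    rw [hz s hs, zero_mul], Finset.mul_sum]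
  exact Finset.sum_congr rfl fun s hs => by rw [hp s hs]

lemma measure_split_count_le [IsProbabilityMeasure P] (h : IsGaussianTrial P μ YC YT A I)
    (S : Finset (Fin n)) {t : ℝ} (ht : 0 < t) :
    P {ω | ¬ |((S ∩ I ω).card : ℝ) - S.card / 2| ≤ t} ≤
      ENNReal.ofReal (1 / 4 * S.card / t ^ 2) := by
  simp only [← sum_centredMem]
  refine measure_abs_sum_gt_le ht (fun i _ => ?_) (fun i _ => ?_) fun i _ j _ hij => ?_
  · refine MemLp.of_bound ?_ 1 (Eventually.of_forall fun ω => ?_)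
    · refine Measurable.aestronglyMeasurable ?_
      refine (Measurable.ite ?_ measurable_const measurable_const).sub_const _
      have : {ω | i ∈ I ω} = (fun ω => decide (i ∈ I ω)) ⁻¹' {true} := by ext; simp
      rw [this]
      exact h.measurable_split i (measurableSet_singleton _)
    · rw [Real.norm_eq_abs, abs_centredMem]
      norm_num
  · simp [centredMem_mul_self]
  · rw [h.integral_split fun s => centredMem i s * centredMem j s]
    exact mul_nonpos_of_nonneg_of_nonpos (by positivity) (sum_centredMem_mul_nonpos hij)

end

/-! ### Limits along a sequence of trials -/

section

variable {Ω : ℕ → Type*} [∀ n, MeasurableSpace (Ω n)] {P : (n : ℕ) → Measure (Ω n)}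
  [∀ n, IsProbabilityMeasure (P n)] {μ : (n : ℕ) → Fin n → ℝ}
  {YC YT : (n : ℕ) → Fin n → Ω n → ℝ} {A : (n : ℕ) → Fin n → Ω n → Bool}
  {I : (n : ℕ) → Ω n → Finset (Fin n)}

/-- `m / (m ^ (3/4)) ^ 2 → 0`: the rate of the laws of large numbers at precision `m ^ (-1/4)`. -/
lemma tendsto_const_mul_div_rpow_sq {m : ℕ → ℕ} (hm : Tendsto m atTop atTop) (C : ℝ) :
    Tendsto (fun n => C * (m n : ℝ) / ((m n : ℝ) ^ (3 / 4 : ℝ)) ^ 2) atTop (𝓝 0) := by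
  have h1 : Tendsto (fun n => (m n : ℝ)) atTop atTop := tendsto_natCast_atTop_atTop.comp hm
  have h2 := ((tendsto_rpow_neg_atTop (y := 1 / 2) (by norm_num)).comp h1).const_mul C
  rw [mul_zero] at h2
  refine h2.congr' ?_
  filter_upwards [h1.eventually_gt_atTop 0] with n hn
  simp only [Function.comp]
  rw [← Real.rpow_natCast, ← Real.rpow_mul hn.le, mul_div_assoc]
  congr 1
  rw [eq_div_iff (by positivity), ← Real.rpow_add hn]
  norm_num

lemma whp_weightedSum (h : ∀ n, IsGaussianTrial (P n) (μ n) (YC n) (YT n) (A n) (I n))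
    {S : (n : ℕ) → Finset (Fin n)} (hS : Tendsto (fun n => (S n).card) atTop atTop)
    {m w : Bool → ℝ} {k : ℝ → ℝ} (hk : Measurable k)
    (hk2 : MemLp k 2 (gaussianReal 0 1)) (hm : ∀ b, |m b| ≤ 1) (hw : ∀ b, |w b| ≤ 1)
    (h0 : (w true + w false) * ∫ x, k x ∂gaussianReal 0 1 = 0) :
    WithHighProb P (fun n ω => |∑ i ∈ S n, m (decide (i ∈ I n ω)) *
      (w (A n i ω) * k (noise (μ n) (YC n) (YT n) (A n) i ω))| ≤
        ((S n).card : ℝ) ^ (3 / 4 : ℝ)) := by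
  refine WithHighProb.of_le (tendsto_const_mul_div_rpow_sq hS (∫ x, k x * k x ∂gaussianReal 0 1)) ?_
  filter_upwards [hS.eventually_gt_atTop 0] with n hn
  exact (h n).measure_weightedSum_le (S n) hk hk2 hm hw h0
    (Real.rpow_pos_of_pos (by exact_mod_cast hn) _)

lemma whp_split_count (h : ∀ n, IsGaussianTrial (P n) (μ n) (YC n) (YT n) (A n) (I n))
    {S : (n : ℕ) → Finset (Fin n)} (hS : Tendsto (fun n => (S n).card) atTop atTop) :
    WithHighProb P (fun n ω => |((S n ∩ I n ω).card : ℝ) - (S n).card / 2| ≤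
        ((S n).card : ℝ) ^ (3 / 4 : ℝ)) := by
  refine WithHighProb.of_le (tendsto_const_mul_div_rpow_sq hS (1 / 4)) ?_
  filter_upwards [hS.eventually_gt_atTop 0] with n hn
  exact (h n).measure_split_count_le (S n) (Real.rpow_pos_of_pos (by exact_mod_cast hn) _)

lemma whp_card_large_noise (h : ∀ n, IsGaussianTrial (P n) (μ n) (YC n) (YT n) (A n) (I n))
    (S : (n : ℕ) → Finset (Fin n)) {K : ℕ → ℝ} (hK : Tendsto K atTop atTop) {η : ℝ} (hη : 0 < η) :
    WithHighProb P (fun n ω => (((S n).filter fun i =>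
      K n ≤ |noise (μ n) (YC n) (YT n) (A n) i ω|).card : ℝ) ≤ η * (S n).card) := by
  have hlim : Tendsto (fun n => 1 / (η * K n ^ 2)) atTop (𝓝 0) :=
    tendsto_const_nhds.div_atTop (((tendsto_pow_atTop two_ne_zero).comp hK).const_mul_atTop hη)
  refine WithHighProb.of_le hlim ?_
  filter_upwards [hK.eventually_gt_atTop 0] with n hn
  exact (h n).measure_card_large_noise_le (S n) hn hη

end

end CrossfitICube.IsGaussianTrial

/-! ### The exclusion order of Crossfit-I³ -/

lemma candidates_succ_subset {n : ℕ} (tie : TieRule n) (X : Fin n → ℝ) (A : Fin n → Bool)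
    (Y : Fin n → ℝ) (I : Finset (Fin n)) (t : ℕ) :
    candidates tie X A Y I (t + 1) ⊆ candidates tie X A Y I t := by
  rw [candidates]
  split_ifs
  · exact Finset.erase_subset _ _
  · exact subset_rfl

lemma candidates_antitone {n : ℕ} (tie : TieRule n) (X : Fin n → ℝ) (A : Fin n → Bool)
    (Y : Fin n → ℝ) (I : Finset (Fin n)) : Antitone (candidates tie X A Y I) :=
  antitone_nat_of_succ_le fun t => candidates_succ_subset tie X A Y I t

/-- As long as subjects outside `G` remain, and these all have lower predictions than those in `G`,
each step excludes one of them, whatever the tie rule. -/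
lemma inter_subset_candidates {n : ℕ} (tie : TieRule n) {X : Fin n → ℝ} {A : Fin n → Bool}
    {Y : Fin n → ℝ} {I G : Finset (Fin n)}
    (hlt : ∀ i ∉ G, ∀ j ∈ G, pred Iᶜ X A Y (X i) < pred Iᶜ X A Y (X j)) :
    ∀ t ≤ (I \ G).card, I ∩ G ⊆ candidates tie X A Y I t ∧
      (candidates tie X A Y I t \ G).card + t = (I \ G).card := by
  intro t
  induction t with
  | zero => intro _; exact ⟨Finset.inter_subset_left, by simp [candidates]⟩
  | succ t ih =>
    intro ht
    obtain ⟨hsub, hcard⟩ := ih (by omega)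
    set R := candidates tie X A Y I t with hR
    obtain ⟨i₀, hi₀⟩ : (R \ G).Nonempty := Finset.card_pos.1 (by omega)
    rw [Finset.mem_sdiff] at hi₀
    have hlow : ∀ i ∈ lowest (fun i => pred Iᶜ X A Y (X i)) R, i ∈ R ∧ i ∉ G := by
      intro i hi
      rw [lowest, Finset.mem_filter] at hi
      exact ⟨hi.1, fun hiG => absurd (hi.2 i₀ hi₀.1) (not_le.2 (hlt i₀ hi₀.2 i hiG))⟩
    have hC : (lowest (fun i => pred Iᶜ X A Y (X i)) R).Nonempty := by
      obtain ⟨i, hi, hmin⟩ := R.exists_min_image (fun i => pred Iᶜ X A Y (X i)) ⟨i₀, hi₀.1⟩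
      exact ⟨i, Finset.mem_filter.2 ⟨hi, hmin⟩⟩
    rw [candidates, ← hR, dif_pos hC]
    generalize hj : tie Y I _ _ _ hC = j
    obtain ⟨hjR, hjG⟩ := hlow j j.2
    refine ⟨fun i hi => Finset.mem_erase.2 ⟨?_, hsub hi⟩, ?_⟩
    · rintro rfl
      exact hjG (Finset.mem_inter.1 hi).2
    · rw [Finset.erase_sdiff_comm, Finset.card_erase_of_mem (Finset.mem_sdiff.2 ⟨hjR, hjG⟩)]
      have : 0 < (R \ G).card := Finset.card_pos.2 ⟨i₀, Finset.mem_sdiff.2 hi₀⟩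
      omega

/-- If the predictions separate `G` from the rest and the estimated false discovery rate of `I ∩ G`
is small enough, then the procedure stops no later than at `I ∩ G`, so that it rejects all members of
`I ∩ G` with a positive estimated effect. -/
lemma posPart_subset_iCube {n : ℕ} (tie : TieRule n) {a : ℝ} {X : Fin n → ℝ} {A : Fin n → Bool}
    {Y : Fin n → ℝ} {I G : Finset (Fin n)}
    (hlt : ∀ i ∉ G, ∀ j ∈ G, pred Iᶜ X A Y (X i) < pred Iᶜ X A Y (X j))
    (hfdr : fdrHat (effectEst Iᶜ X A Y) (I ∩ G) ≤ a) :
    posPart (effectEst Iᶜ X A Y) (I ∩ G) ⊆ iCube tie a X A Y I := by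
  classical
  obtain ⟨hsub, hcard⟩ := inter_subset_candidates tie hlt (I \ G).card le_rfl
  have hin : candidates tie X A Y I (I \ G).card ⊆ I :=
    candidates_antitone tie X A Y I (Nat.zero_le _)
  have heq : candidates tie X A Y I (I \ G).card = I ∩ G := by
    refine Finset.Subset.antisymm (fun i hi => Finset.mem_inter.2 ⟨hin hi, ?_⟩) hsub
    have h0 : (candidates tie X A Y I (I \ G).card \ G).card = 0 := by omega
    rw [Finset.card_eq_zero, Finset.sdiff_eq_empty_iff_subset] at h0
    exact h0 hi
  have hex : ∃ t, fdrHat (effectEst Iᶜ X A Y) (candidates tie X A Y I t) ≤ a :=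
    ⟨_, by rw [heq]; exact hfdr⟩
  have hfind : Nat.find hex ≤ (I \ G).card := Nat.find_min' hex (by rw [heq]; exact hfdr)
  rw [iCube, dif_pos hex]
  intro i hi
  rw [CrossfitICube.posPart, Finset.mem_filter] at hi ⊢
  refine ⟨?_, hi.2⟩
  have := candidates_antitone tie X A Y I hfind
  rw [heq] at this
  exact this hi.1

/-! ### Predictions and outcome model on a balanced half -/

/-- The training half `T` is balanced on the group `G`: it holds at least a quarter of the group,
about half of its members in `T` are treated, and their noise averages out, overall and between the
arms. -/
def BalancedOn {n : ℕ} (A : Fin n → Bool) (e : Fin n → ℝ) (G T : Finset (Fin n)) : Prop :=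
  (G.card : ℝ) / 4 ≤ (G ∩ T).card ∧
  |∑ i ∈ G ∩ T, ((if A i then 1 else 0) - 1 / 2 : ℝ)| ≤ G.card / 32 ∧
  |∑ i ∈ G ∩ T, e i| ≤ G.card / 4 ∧
  |∑ i ∈ G ∩ T, (if A i then 1 else -1 : ℝ) * e i| ≤ G.card / 4

/-- The group average of the outcomes is close to half of the common effect `c`, and the predicted
effect is close to `c`. -/
lemma BalancedOn.groupMean_pred {n : ℕ} {A : Fin n → Bool} {e X Y : Fin n → ℝ}
    {G T : Finset (Fin n)} {c x : ℝ} (h : BalancedOn A e G T) (hG : 0 < G.card) (hc : 0 ≤ c)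
    (hX : ∀ i, X i = x ↔ i ∈ G) (hY : ∀ i ∈ G, Y i = (if A i then c else 0) + e i) :
    |groupMean T X Y x - c / 2| ≤ c / 8 + 1 ∧ |pred T X A Y x - c| ≤ c / 16 + 5 / 2 := by
  obtain ⟨h1, h2, h3, h4⟩ := h
  have hH : ({k ∈ T | X k = x} : Finset (Fin n)) = G ∩ T := by
    ext i; simp [hX, and_comm]
  have hGpos : (0 : ℝ) < G.card := by exact_mod_cast hG
  set N : ℝ := ((G ∩ T).card : ℝ) with hN
  have hNpos : 0 < N := by linarith
  set a := ∑ i ∈ G ∩ T, ((if A i then 1 else 0) - 1 / 2 : ℝ) with ha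
  set s := ∑ i ∈ G ∩ T, e i with hs
  set d := ∑ i ∈ G ∩ T, (if A i then 1 else -1 : ℝ) * e i with hd
  have hm : groupMean T X Y x = c / 2 + c * (a / N) + s / N := by
    rw [groupMean, hH, ← hN]
    have : ∑ k ∈ G ∩ T, Y k = c / 2 * N + c * a + s := by
      rw [ha, hs, hN, Finset.mul_sum, mul_comm (c / 2), ← nsmul_eq_mul, ← Finset.sum_const,
        ← Finset.sum_add_distrib, ← Finset.sum_add_distrib]
      refine Finset.sum_congr rfl fun i hi => ?_
      rw [hY i (Finset.mem_inter.1 hi).1]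
      split_ifs <;> ring
    rw [this]
    field_simp
  have hp : pred T X A Y x = c + 2 * (d / N) + 2 * c * (a / N) - 4 * (a / N) * groupMean T X Y x := by
    rw [pred]
    conv_lhs => rw [groupMean, hH, ← hN]
    have : ∑ k ∈ G ∩ T, effectEst T X A Y k =
        c * N + 2 * d + 2 * c * a - 4 * groupMean T X Y x * a := by
      rw [ha, hd, hN, Finset.mul_sum, Finset.mul_sum, Finset.mul_sum, mul_comm c, ← nsmul_eq_mul,
        ← Finset.sum_const, ← Finset.sum_add_distrib, ← Finset.sum_add_distrib,
        ← Finset.sum_sub_distrib]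
      refine Finset.sum_congr rfl fun i hi => ?_
      have hiG := (Finset.mem_inter.1 hi).1
      rw [effectEst, (hX i).2 hiG, hY i hiG]
      split_ifs <;> ring
    rw [this]
    field_simp
  have bd : ∀ y K : ℝ, |y| ≤ K * (G.card / 4) → |y / N| ≤ K := fun y K hy => by
    have hK : 0 ≤ K := by
      by_contra hK
      nlinarith [abs_nonneg y]
    rw [abs_div, abs_of_pos hNpos, div_le_iff₀ hNpos]
    exact hy.trans (mul_le_mul_of_nonneg_left h1 hK)
  have ba := abs_le.1 (bd a (1 / 8) (by linarith))
  have bs := abs_le.1 (bd s 1 (by linarith))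
  have bdd := abs_le.1 (bd d 1 (by linarith))
  generalize a / N = u at *
  generalize s / N = v at *
  generalize d / N = w at *
  constructor
  · rw [hm, abs_le]
    constructor <;> nlinarith
  · have hpe : pred T X A Y x - c = 2 * w - 4 * c * u ^ 2 - 4 * (u * v) := by rw [hp, hm]; ring
    have hu2 : u ^ 2 ≤ 1 / 64 := by nlinarith
    have hcu : c * u ^ 2 ≤ c * (1 / 64) := mul_le_mul_of_nonneg_left hu2 hc
    have hcu0 : 0 ≤ c * u ^ 2 := by positivity
    have huv : |u * v| ≤ 1 / 8 := by
      rw [abs_mul]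
      nlinarith [abs_le.2 ba, abs_le.2 bs, abs_nonneg u, abs_nonneg v]
    have huv' := abs_le.1 huv
    rw [hpe, abs_le]
    constructor <;> linarith

/-! ### Power of Crossfit-I³ on the good event -/

lemma idealCovariate_eq_one_iff {n : ℕ} (μ : Fin n → ℝ) (i : Fin n) :
    idealCovariate μ i = 1 ↔ i ∈ nonNulls μ := by
  simp [idealCovariate, nonNulls]

lemma idealCovariate_eq_zero_iff {n : ℕ} (μ : Fin n → ℝ) (i : Fin n) :
    idealCovariate μ i = 0 ↔ i ∈ (nonNulls μ)ᶜ := by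
  simp [idealCovariate, nonNulls]

/-- The procedure run on one half, trained on the other, detects every non-null of that half whose
noise is below a quarter of the signal. -/
lemma mem_iCube_of_balanced {n : ℕ} (tie : TieRule n) {α c η : ℝ} (hα0 : 0 < α) (hα1 : α < 1)
    {μ e Y : Fin n → ℝ} {A : Fin n → Bool} {I : Finset (Fin n)} (hc : 8 < c)
    (hμ : ∀ i, μ i = 0 ∨ μ i = c) (hY : ∀ i, Y i = (if A i then μ i else 0) + e i)
    (hP : 1 ≤ η * (nonNulls μ).card) (hη : η ≤ α / 32) (hN : 0 < (nonNulls μ)ᶜ.card)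
    (hb1 : BalancedOn A e (nonNulls μ) Iᶜ) (hb0 : BalancedOn A e (nonNulls μ)ᶜ Iᶜ)
    (hI : ((nonNulls μ).card : ℝ) / 4 ≤ (nonNulls μ ∩ I).card)
    (hbad : (((nonNulls μ).filter fun i => c / 4 ≤ |e i|).card : ℝ) ≤ η * (nonNulls μ).card)
    {i : Fin n} (hi : i ∈ nonNulls μ) (hiI : i ∈ I) (hei : |e i| < c / 4) :
    i ∈ iCube tie (α / 2) (idealCovariate μ) A Y I := by
  set G := nonNulls μ with hG
  set X := idealCovariate μ with hX
  have hX1 : ∀ i ∈ G, X i = 1 := fun i hi => (idealCovariate_eq_one_iff μ i).2 hi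
  have hX0 : ∀ i ∈ Gᶜ, X i = 0 := fun i hi => (idealCovariate_eq_zero_iff μ i).2 hi
  have hGc : ∀ i ∈ G, μ i = c := fun i hi => by
    rcases hμ i with h | h
    · simp [hG, nonNulls, h] at hi
    · exact h
  have hG0 : ∀ i ∈ Gᶜ, μ i = 0 := fun i hi => by
    rcases hμ i with h | h
    · exact h
    · have : ¬ (0 < μ i) := by simpa [hG, nonNulls] using hi
      rw [h] at this
      linarith
  have hGpos : 0 < G.card := Finset.card_pos.2 ⟨i, hi⟩
  have hGposR : (0 : ℝ) < G.card := by exact_mod_cast hGpos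
  obtain ⟨hm1, hp1⟩ := hb1.groupMean_pred (X := X) (Y := Y) (x := 1) hGpos (by linarith : 0 ≤ c)
    (idealCovariate_eq_one_iff μ) fun i hi => by rw [hY, hGc i hi]
  obtain ⟨-, hp0⟩ := hb0.groupMean_pred (X := X) (Y := Y) (x := 0) (c := 0) hN le_rfl
    (idealCovariate_eq_zero_iff μ) fun i hi => by rw [hY, hG0 i hi]
  have hm1' := abs_le.1 hm1
  have hp1' := abs_le.1 hp1
  have hp0' := abs_le.1 hp0
  have hpos : ∀ j ∈ G, |e j| < c / 4 → 0 < effectEst Iᶜ X A Y j := by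
    intro j hj hej
    have hej' := abs_lt.1 hej
    rw [effectEst, hX1 j hj, hY j, hGc j hj]
    split_ifs
    · nlinarith
    · nlinarith
  refine posPart_subset_iCube tie (G := G) (fun i hi j hj => ?_) ?_
    (Finset.mem_filter.2 ⟨Finset.mem_inter.2 ⟨hiI, hi⟩, hpos i hi hei⟩)
  · rw [hX1 j hj, hX0 i (Finset.mem_compl.2 hi)]
    linarith
  · have hneg : negPart (effectEst Iᶜ X A Y) (I ∩ G) ⊆ G.filter fun i => c / 4 ≤ |e i| := by
      intro j hj
      rw [CrossfitICube.negPart, Finset.mem_filter, Finset.mem_inter] at hj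
      refine Finset.mem_filter.2 ⟨hj.1.2, ?_⟩
      by_contra hlt
      exact absurd (hpos j hj.1.2 (not_le.1 hlt)) (not_lt.2 hj.2)
    have hneg' : ((negPart (effectEst Iᶜ X A Y) (I ∩ G)).card : ℝ) ≤ η * G.card :=
      le_trans (by exact_mod_cast Finset.card_le_card hneg) hbad
    have hsplit : (posPart (effectEst Iᶜ X A Y) (I ∩ G)).card +
        (negPart (effectEst Iᶜ X A Y) (I ∩ G)).card = (G ∩ I).card := by
      rw [Finset.inter_comm G I, CrossfitICube.posPart, CrossfitICube.negPart,
        ← Finset.card_filter_add_card_filter_not (s := I ∩ G)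
          (p := fun i => 0 < effectEst Iᶜ X A Y i)]
      simp only [not_lt]
    have hsplit' : ((posPart (effectEst Iᶜ X A Y) (I ∩ G)).card : ℝ) +
        (negPart (effectEst Iᶜ X A Y) (I ∩ G)).card = (G ∩ I).card := by exact_mod_cast hsplit
    have hη' : η * G.card ≤ α / 32 * G.card := by gcongr
    have hαG : α * G.card ≤ 1 * G.card := by gcongr
    have hlow : (7 / 32 : ℝ) * G.card ≤ (posPart (effectEst Iᶜ X A Y) (I ∩ G)).card := by
      linarith
    rw [fdrHat, div_le_iff₀ (lt_max_of_lt_right one_pos)]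
    calc ((negPart (effectEst Iᶜ X A Y) (I ∩ G)).card : ℝ) + 1 ≤ α / 2 * (7 / 32 * G.card) := by
          nlinarith
      _ ≤ _ := by gcongr; exact hlow.trans (le_max_left _ _)

lemma le_card_crossfitICube_inter {n : ℕ} (tie : TieRule n) {α c η : ℝ} (hα0 : 0 < α) (hα1 : α < 1)
    {μ e Y : Fin n → ℝ} {A : Fin n → Bool} {I : Finset (Fin n)} (hc : 8 < c)
    (hμ : ∀ i, μ i = 0 ∨ μ i = c) (hY : ∀ i, Y i = (if A i then μ i else 0) + e i)
    (hP : 1 ≤ η * (nonNulls μ).card) (hη : η ≤ α / 32) (hN : 0 < (nonNulls μ)ᶜ.card)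
    (hb1 : BalancedOn A e (nonNulls μ) I) (hb0 : BalancedOn A e (nonNulls μ)ᶜ I)
    (hb1' : BalancedOn A e (nonNulls μ) Iᶜ) (hb0' : BalancedOn A e (nonNulls μ)ᶜ Iᶜ)
    (hbad : (((nonNulls μ).filter fun i => c / 4 ≤ |e i|).card : ℝ) ≤ η * (nonNulls μ).card) :
    (1 - η) * (nonNulls μ).card ≤
      ((crossfitICube tie α (idealCovariate μ) A Y I ∩ nonNulls μ).card : ℝ) := by
  have hsub : (nonNulls μ).filter (fun i => ¬ c / 4 ≤ |e i|) ⊆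
      crossfitICube tie α (idealCovariate μ) A Y I ∩ nonNulls μ := by
    intro i hi
    rw [Finset.mem_filter, not_le] at hi
    rw [crossfitICube, Finset.mem_inter, Finset.mem_union]
    refine ⟨?_, hi.1⟩
    by_cases hiI : i ∈ I
    · exact Or.inl (mem_iCube_of_balanced tie hα0 hα1 hc hμ hY hP hη hN hb1' hb0' hb1.1 hbad
        hi.1 hiI hi.2)
    · exact Or.inr (mem_iCube_of_balanced tie hα0 hα1 hc hμ hY hP hη hN
        (by rwa [compl_compl]) (by rwa [compl_compl]) hb1'.1 hbad hi.1
        (Finset.mem_compl.2 hiI) hi.2)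
  have h1 : (((nonNulls μ).filter fun i => ¬ c / 4 ≤ |e i|).card : ℝ) ≤ _ :=
    Nat.cast_le.2 (Finset.card_le_card hsub)
  have h2 : (((nonNulls μ).filter fun i => c / 4 ≤ |e i|).card : ℝ) +
      ((nonNulls μ).filter fun i => ¬ c / 4 ≤ |e i|).card = (nonNulls μ).card := by
    exact_mod_cast Finset.card_filter_add_card_filter_not _
  linarith

/-! ### Measurability of the rejection sets -/

section Measurability

variable {Ω : Type*} [MeasurableSpace Ω]

/-- A measurable property depending on a parameter of countable type remains measurable when a
measurable value is substituted for the parameter. -/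
lemma measurableSet_subst {β : Type*} [Countable β] {F : Ω → β} {p : β → Ω → Prop}
    (hF : ∀ b, MeasurableSet {x | F x = b}) (hp : ∀ b, MeasurableSet {x | p b x}) :
    MeasurableSet {x | p (F x) x} := by
  have : {x | p (F x) x} = ⋃ b, {x | F x = b} ∩ {x | p b x} := by
    ext x
    simp
  rw [this]
  exact MeasurableSet.iUnion fun b => (hF b).inter (hp b)

lemma measurableSet_prodMk_eq {β γ : Type*} {F : Ω → β} {G : Ω → γ}
    (hF : ∀ b, MeasurableSet {x | F x = b}) (hG : ∀ c, MeasurableSet {x | G x = c}) (y : β × γ) :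
    MeasurableSet {x | (F x, G x) = y} := by
  have : {x | (F x, G x) = y} = {x | F x = y.1} ∩ {x | G x = y.2} := by
    ext x
    simp [Prod.ext_iff]
  rw [this]
  exact (hF _).inter (hG _)

lemma measurableSet_finset_eq {ι : Type*} [Countable ι] {F : Ω → Finset ι}
    (hF : ∀ i, MeasurableSet {x | i ∈ F x}) (s : Finset ι) : MeasurableSet {x | F x = s} := by
  have : {x | F x = s} = ⋂ i, {x | i ∈ F x ↔ i ∈ s} := by
    ext x
    simp [Finset.ext_iff]
  rw [this]
  exact MeasurableSet.iInter fun i => (hF i).iff (MeasurableSet.const _)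

lemma measurableSet_comp_finset_eq {ι β : Type*} [Countable ι] {F : Ω → Finset ι}
    (hF : ∀ i, MeasurableSet {x | i ∈ F x}) (f : Finset ι → β) (b : β) :
    MeasurableSet {x | f (F x) = b} :=
  measurableSet_subst (p := fun s _ => f s = b) (measurableSet_finset_eq hF)
    fun _ => MeasurableSet.const _

lemma measurable_power_integrand {n : ℕ} (Pos : Finset (Fin n)) {R : Ω → Finset (Fin n)}
    (hR : ∀ i, MeasurableSet {x | i ∈ R x}) :
    Measurable fun x => ((R x ∩ Pos).card : ℝ) / max (Pos.card : ℝ) 1 := by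
  intro B _
  exact measurableSet_subst (F := R)
    (p := fun s _ => ((s ∩ Pos).card : ℝ) / max (Pos.card : ℝ) 1 ∈ B)
    (measurableSet_finset_eq hR) fun _ => MeasurableSet.const _

variable {n : ℕ}

@[fun_prop]
lemma measurable_groupMean (T : Finset (Fin n)) (X : Fin n → ℝ) {V : Ω → Fin n → ℝ}
    (hV : Measurable V) (x : ℝ) : Measurable fun ω => groupMean T X (V ω) x := by
  unfold groupMean
  fun_prop

@[fun_prop]
lemma measurable_effectEst (T : Finset (Fin n)) (X : Fin n → ℝ) (A : Fin n → Bool)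
    {Y : Ω → Fin n → ℝ} (hY : Measurable Y) (i : Fin n) :
    Measurable fun ω => effectEst T X A (Y ω) i := by
  unfold effectEst
  fun_prop

@[fun_prop]
lemma measurable_pred (T : Finset (Fin n)) (X : Fin n → ℝ) (A : Fin n → Bool)
    {Y : Ω → Fin n → ℝ} (hY : Measurable Y) (x : ℝ) :
    Measurable fun ω => pred T X A (Y ω) x := by
  unfold pred
  refine measurable_groupMean T X (measurable_pi_lambda _ fun i => ?_) x
  exact measurable_effectEst T X A hY i

lemma measurableSet_mem_posPart {Δ : Ω → Fin n → ℝ} (hΔ : ∀ i, Measurable fun ω => Δ ω i)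
    (R : Finset (Fin n)) (i : Fin n) :
    MeasurableSet {ω | i ∈ CrossfitICube.posPart (Δ ω) R} := by
  simp only [CrossfitICube.posPart, Finset.mem_filter]
  exact (MeasurableSet.const _).inter (measurableSet_lt measurable_const (hΔ i))

lemma measurableSet_mem_negPart {Δ : Ω → Fin n → ℝ} (hΔ : ∀ i, Measurable fun ω => Δ ω i)
    (R : Finset (Fin n)) (i : Fin n) :
    MeasurableSet {ω | i ∈ CrossfitICube.negPart (Δ ω) R} := by
  simp only [CrossfitICube.negPart, Finset.mem_filter]
  exact (MeasurableSet.const _).inter (measurableSet_le (hΔ i) measurable_const)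

lemma measurableSet_mem_lowest {f : Ω → Fin n → ℝ} (hf : ∀ i, Measurable fun ω => f ω i)
    (R : Finset (Fin n)) (i : Fin n) : MeasurableSet {ω | i ∈ lowest (f ω) R} := by
  have : {ω | i ∈ lowest (f ω) R} = {_ω : Ω | i ∈ R} ∩ ⋂ j ∈ R, {ω | f ω i ≤ f ω j} := by
    ext ω
    simp [lowest]
  rw [this]
  exact (MeasurableSet.const _).inter
    (Finset.measurableSet_biInter _ fun j _ => measurableSet_le (hf i) (hf j))

lemma measurableSet_fdrHat_le {Δ : Ω → Fin n → ℝ} (hΔ : ∀ i, Measurable fun ω => Δ ω i)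
    (R : Finset (Fin n)) (a : ℝ) : MeasurableSet {ω | fdrHat (Δ ω) R ≤ a} := by
  refine measurableSet_subst
    (F := fun ω => (CrossfitICube.negPart (Δ ω) R, CrossfitICube.posPart (Δ ω) R))
    (p := fun s _ => (s.1.card + 1 : ℝ) / max (s.2.card : ℝ) 1 ≤ a)
    (measurableSet_prodMk_eq ?_ ?_) fun _ => MeasurableSet.const _
  · exact measurableSet_finset_eq (measurableSet_mem_negPart hΔ R)
  · exact measurableSet_finset_eq (measurableSet_mem_posPart hΔ R)

lemma measurableSet_candidates_eq {tie : TieRule n} (htie : tie.IsMeasurable) (X : Fin n → ℝ)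
    (A : Fin n → Bool) (I : Finset (Fin n)) (t : ℕ) (s : Finset (Fin n)) :
    MeasurableSet {Y | candidates tie X A Y I t = s} := by
  induction t generalizing s with
  | zero => exact MeasurableSet.const (I = s)
  | succ t ih =>
    refine measurableSet_subst
      (F := fun Y => (candidates tie X A Y I t,
        lowest (fun i => pred Iᶜ X A Y (X i)) (candidates tie X A Y I t),
        (CrossfitICube.posPart (effectEst Iᶜ X A Y) (candidates tie X A Y I t)).card))
      (p := fun b Y => (if hC : b.2.1.Nonempty then
        b.1.erase (tie Y I (fun k => if k ∈ b.1 then none else some (A k)) b.2.2 b.2.1 hC)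
        else b.1) = s)
      (measurableSet_prodMk_eq ih (measurableSet_prodMk_eq (fun C => ?_) fun k => ?_)) ?_
    · exact measurableSet_subst (p := fun R Y => lowest (fun i => pred Iᶜ X A Y (X i)) R = C) ih
        fun R => measurableSet_finset_eq (measurableSet_mem_lowest
          (fun i => measurable_pred Iᶜ X A measurable_id (X i)) R) C
    · exact measurableSet_subst
        (p := fun R Y => (CrossfitICube.posPart (effectEst Iᶜ X A Y) R).card = k) ih
        fun R => measurableSet_comp_finset_eq (measurableSet_mem_posPart
          (fun i => measurable_effectEst Iᶜ X A measurable_id i) R) Finset.card k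
    · rintro ⟨R, C, k⟩
      by_cases hC : C.Nonempty
      · simp only [dif_pos hC]
        exact htie I (fun k => if k ∈ R then none else some (A k)) k C hC
          (MeasurableSet.of_discrete (s := {j | R.erase j = s}))
      · simp only [dif_neg hC]
        exact MeasurableSet.const _

lemma measurableSet_mem_iCube {tie : TieRule n} (htie : tie.IsMeasurable) (a : ℝ) (X : Fin n → ℝ)
    (A : Fin n → Bool) (I : Finset (Fin n)) (i : Fin n) :
    MeasurableSet {Y | i ∈ iCube tie a X A Y I} := by
  classical
  have hΔ : ∀ i, Measurable fun Y => effectEst Iᶜ X A Y i := fun i =>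
    measurable_effectEst Iᶜ X A measurable_id i
  have hfdr : ∀ t, MeasurableSet
      {Y | fdrHat (effectEst Iᶜ X A Y) (candidates tie X A Y I t) ≤ a} := fun t =>
    measurableSet_subst (p := fun R Y => fdrHat (effectEst Iᶜ X A Y) R ≤ a)
      (measurableSet_candidates_eq htie X A I t) fun R => measurableSet_fdrHat_le hΔ R a
  have hmem : ∀ t, MeasurableSet
      {Y | i ∈ CrossfitICube.posPart (effectEst Iᶜ X A Y) (candidates tie X A Y I t)} := fun t =>
    measurableSet_subst (p := fun R Y => i ∈ CrossfitICube.posPart (effectEst Iᶜ X A Y) R)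
      (measurableSet_candidates_eq htie X A I t) fun R => measurableSet_mem_posPart hΔ R i
  have heq : {Y | i ∈ iCube tie a X A Y I} =
      ⋃ t, ({Y | fdrHat (effectEst Iᶜ X A Y) (candidates tie X A Y I t) ≤ a} ∩
        ⋂ s ∈ Finset.range t,
          {Y | fdrHat (effectEst Iᶜ X A Y) (candidates tie X A Y I s) ≤ a}ᶜ) ∩
        {Y | i ∈ CrossfitICube.posPart (effectEst Iᶜ X A Y) (candidates tie X A Y I t)} := by
    ext Y
    simp only [Set.mem_ofPred_eq, Set.mem_iUnion, Set.mem_inter_iff, Set.mem_iInter,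
      Set.mem_compl_iff, Finset.mem_range]
    by_cases h : ∃ t, fdrHat (effectEst Iᶜ X A Y) (candidates tie X A Y I t) ≤ a
    · rw [iCube, dif_pos h]
      constructor
      · exact fun hi => ⟨Nat.find h, ⟨Nat.find_spec h, fun s hs => Nat.find_min h hs⟩, hi⟩
      · rintro ⟨t, ⟨ht, hmin⟩, hi⟩
        rwa [(Nat.find_eq_iff h).2 ⟨ht, hmin⟩]
    · rw [iCube, dif_neg h]
      push Not at h
      simp [h]
  rw [heq]
  exact MeasurableSet.iUnion fun t => ((hfdr t).inter
    (Finset.measurableSet_biInter _ fun s _ => (hfdr s).compl)).inter (hmem t)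

lemma measurableSet_mem_crossfitICube {tie : TieRule n} (htie : tie.IsMeasurable) (α : ℝ)
    (X : Fin n → ℝ) (A : Fin n → Bool) (I : Finset (Fin n)) (i : Fin n) :
    MeasurableSet {Y | i ∈ crossfitICube tie α X A Y I} := by
  simp only [crossfitICube, Finset.mem_union]
  exact (measurableSet_mem_iCube htie _ X A I i).union (measurableSet_mem_iCube htie _ X A Iᶜ i)

@[fun_prop]
lemma measurable_olsFit (X : Fin n → ℝ) (A : Fin n → Bool) (a : Bool) (x : ℝ) :
    Measurable fun Y => olsFit X A Y a x := by
  simp only [olsFit, olsCoef, dotProduct, Matrix.mulVec, Finset.sum_apply, Pi.smul_apply]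
  fun_prop

lemma measurable_noiseVar (X : Fin n → ℝ) (A : Fin n → Bool) (a : Bool) :
    Measurable fun Y => noiseVar X A Y a := by
  unfold noiseVar
  fun_prop

lemma measurable_imputed (X : Fin n → ℝ) (A : Fin n → Bool) (a : Bool) (i : Fin n) :
    Measurable fun Y => imputed X A Y a i := by
  unfold imputed
  split_ifs <;> fun_prop

lemma measurable_imputedVar (X : Fin n → ℝ) (A : Fin n → Bool) (a : Bool) (i : Fin n) :
    Measurable fun Y => imputedVar X A Y a i := by
  unfold imputedVar fitVar
  have := measurable_noiseVar X A a
  split_ifs <;> fun_prop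

lemma measurable_linearPValue (X : Fin n → ℝ) (A : Fin n → Bool) (i : Fin n) :
    Measurable fun Y => linearPValue X A Y i := by
  unfold linearPValue
  refine measurable_const.sub ((monotone_cdf _).measurable.comp ?_)
  exact ((measurable_imputed X A true i).sub (measurable_imputed X A false i)).div
    ((measurable_imputedVar X A true i).add (measurable_imputedVar X A false i)).sqrt

lemma measurableSet_mem_bhReject (α : ℝ) {p : Ω → Fin n → ℝ}
    (hp : ∀ i, Measurable fun ω => p ω i) (i : Fin n) :
    MeasurableSet {ω | i ∈ bhReject α (p ω)} := by
  have hcount : Measurable fun ω => bhCount α (p ω) := by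
    refine measurable_findGreatest fun k _ => ?_
    refine measurableSet_subst (F := fun ω => ({i | p ω i ≤ k * α / n} : Finset (Fin n)))
      (p := fun s _ => k ≤ s.card) (measurableSet_finset_eq fun j => ?_)
      fun _ => MeasurableSet.const _
    simp only [Finset.mem_filter, Finset.mem_univ, true_and]
    exact measurableSet_le (hp j) measurable_const
  simp only [bhReject, Finset.mem_filter, Finset.mem_univ, true_and]
  exact measurableSet_subst (F := fun ω => bhCount α (p ω))
    (p := fun (k : ℕ) ω => 0 < k ∧ p ω i ≤ k * α / n)
    (fun k => hcount (measurableSet_singleton k))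
    fun k => (MeasurableSet.const _).inter (measurableSet_le (hp i) measurable_const)

end Measurability

namespace CrossfitICube.IsGaussianTrial

variable {Ω : Type*} [MeasurableSpace Ω] {P : Measure Ω} {n : ℕ}
  {μ : Fin n → ℝ} {YC YT : Fin n → Ω → ℝ} {A : Fin n → Ω → Bool} {I : Ω → Finset (Fin n)}

lemma measurable_observed (h : IsGaussianTrial P μ YC YT A I) :
    Measurable fun ω => observed (fun i => A i ω) (fun i => YC i ω) (fun i => YT i ω) :=
  measurable_pi_lambda _ fun i => by
    unfold observed
    exact Measurable.ite (h.measurableSet_arm i true) (h.measurable_YT i) (h.measurable_YC i)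

lemma measurableSet_assignment (h : IsGaussianTrial P μ YC YT A I) (a : Fin n → Bool) :
    MeasurableSet {ω | (fun i => A i ω) = a} :=
  measurable_pi_lambda (fun ω i => A i ω) h.measurable_A (measurableSet_singleton a)

lemma measurableSet_mem_crossfitICube (h : IsGaussianTrial P μ YC YT A I) {tie : TieRule n}
    (htie : tie.IsMeasurable) (α : ℝ) (X : Fin n → ℝ) (i : Fin n) :
    MeasurableSet {ω | i ∈ crossfitICube tie α X (fun i => A i ω)
      (observed (fun i => A i ω) (fun i => YC i ω) (fun i => YT i ω)) (I ω)} :=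
  measurableSet_subst (F := fun ω => ((fun i => A i ω), I ω))
    (p := fun b ω => i ∈ crossfitICube tie α X b.1
      (observed (fun i => A i ω) (fun i => YC i ω) (fun i => YT i ω)) b.2)
    (measurableSet_prodMk_eq h.measurableSet_assignment h.measurableSet_split)
    fun b => h.measurable_observed
      (_root_.measurableSet_mem_crossfitICube htie α X b.1 b.2 i)

lemma measurableSet_mem_linearBH (h : IsGaussianTrial P μ YC YT A I) (α : ℝ) (X : Fin n → ℝ)
    (i : Fin n) :
    MeasurableSet {ω | i ∈ linearBH α X (fun i => A i ω)
      (observed (fun i => A i ω) (fun i => YC i ω) (fun i => YT i ω))} :=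
  measurableSet_subst (F := fun ω i => A i ω)
    (p := fun a ω => i ∈ linearBH α X a
      (observed (fun i => A i ω) (fun i => YC i ω) (fun i => YT i ω)))
    h.measurableSet_assignment
    fun a => h.measurable_observed
      (measurableSet_mem_bhReject α (fun i => measurable_linearPValue X a i) i)

end CrossfitICube.IsGaussianTrial

/-! ### Least squares with a binary regressor -/

/-- The members of `G` in the arm `a`. -/
def armOf {n : ℕ} (A : Fin n → Bool) (a : Bool) (G : Finset (Fin n)) : Finset (Fin n) :=
  {i ∈ G | A i = a}

section OLS

variable {n : ℕ} {μ : Fin n → ℝ} {A : Fin n → Bool} {a : Bool}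

lemma sum_arm_eq {M : Type*} [AddCommMonoid M] (A : Fin n → Bool) (a : Bool) (G : Finset (Fin n))
    (f : Fin n → M) :
    ∑ i with A i = a, f i = ∑ i ∈ armOf A a Gᶜ, f i + ∑ i ∈ armOf A a G, f i := by
  rw [armOf, armOf, ← Finset.sum_union]
  · congr 1
    ext i
    by_cases hi : i ∈ G <;> simp [hi]
  · exact Finset.disjoint_filter_filter (disjoint_compl_left)

lemma regressor_of_mem {i : Fin n} (hi : i ∈ armOf A a (nonNulls μ)) :
    regressor (idealCovariate μ i) = ![1, 1] := by
  rw [(idealCovariate_eq_one_iff μ i).2 (Finset.mem_filter.1 hi).1, regressor]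

lemma regressor_of_mem_compl {i : Fin n} (hi : i ∈ armOf A a (nonNulls μ)ᶜ) :
    regressor (idealCovariate μ i) = ![1, 0] := by
  rw [(idealCovariate_eq_zero_iff μ i).2 (Finset.mem_filter.1 hi).1, regressor]

lemma gram_idealCovariate (μ : Fin n → ℝ) (A : Fin n → Bool) (a : Bool) :
    gram (idealCovariate μ) A a =
      !![((armOf A a (nonNulls μ)ᶜ).card + (armOf A a (nonNulls μ)).card : ℝ),
          ((armOf A a (nonNulls μ)).card : ℝ);
        ((armOf A a (nonNulls μ)).card : ℝ), ((armOf A a (nonNulls μ)).card : ℝ)] := by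
  rw [gram, sum_arm_eq A a (nonNulls μ), Finset.sum_congr rfl fun i hi => by
    rw [regressor_of_mem_compl hi], Finset.sum_congr (s₁ := armOf A a (nonNulls μ)) rfl
    fun i hi => by rw [regressor_of_mem hi], Finset.sum_const, Finset.sum_const]
  ext j k
  fin_cases j <;> fin_cases k <;> simp [Matrix.vecMulVec]

lemma gram_inv (h0 : (armOf A a (nonNulls μ)ᶜ).card ≠ 0) (h1 : (armOf A a (nonNulls μ)).card ≠ 0) :
    (gram (idealCovariate μ) A a)⁻¹ =
      !![(1 / (armOf A a (nonNulls μ)ᶜ).card : ℝ), (-1 / (armOf A a (nonNulls μ)ᶜ).card : ℝ);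
        (-1 / (armOf A a (nonNulls μ)ᶜ).card : ℝ),
        (1 / (armOf A a (nonNulls μ)ᶜ).card + 1 / (armOf A a (nonNulls μ)).card : ℝ)] := by
  have h0' : ((armOf A a (nonNulls μ)ᶜ).card : ℝ) ≠ 0 := by exact_mod_cast h0
  have h1' : ((armOf A a (nonNulls μ)).card : ℝ) ≠ 0 := by exact_mod_cast h1
  refine Matrix.inv_eq_right_inv ?_
  rw [gram_idealCovariate, Matrix.mul_fin_two, Matrix.one_fin_two]
  ext j k
  fin_cases j <;> fin_cases k <;> simp <;> field_simp <;> ring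

variable (Y : Fin n → ℝ)

lemma sum_smul_regressor :
    ∑ i with A i = a, Y i • regressor (idealCovariate μ i) =
      ![∑ i ∈ armOf A a (nonNulls μ)ᶜ, Y i + ∑ i ∈ armOf A a (nonNulls μ), Y i,
        ∑ i ∈ armOf A a (nonNulls μ), Y i] := by
  rw [sum_arm_eq A a (nonNulls μ), Finset.sum_congr rfl fun i hi => by
    rw [regressor_of_mem_compl hi], Finset.sum_congr (s₁ := armOf A a (nonNulls μ)) rfl
    fun i hi => by rw [regressor_of_mem hi], ← Finset.sum_smul, ← Finset.sum_smul]
  ext j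
  fin_cases j <;> simp

/-- The fit is saturated: it predicts the mean outcome of the group. -/
lemma olsFit_zero (h0 : (armOf A a (nonNulls μ)ᶜ).card ≠ 0)
    (h1 : (armOf A a (nonNulls μ)).card ≠ 0) :
    olsFit (idealCovariate μ) A Y a 0 =
      (∑ i ∈ armOf A a (nonNulls μ)ᶜ, Y i) / (armOf A a (nonNulls μ)ᶜ).card := by
  have h0' : ((armOf A a (nonNulls μ)ᶜ).card : ℝ) ≠ 0 := by exact_mod_cast h0
  rw [olsFit, olsCoef, gram_inv h0 h1, sum_smul_regressor]
  simp [regressor, Matrix.mulVec, dotProduct, Fin.sum_univ_two]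
  field_simp
  ring

lemma olsFit_one (h0 : (armOf A a (nonNulls μ)ᶜ).card ≠ 0)
    (h1 : (armOf A a (nonNulls μ)).card ≠ 0) :
    olsFit (idealCovariate μ) A Y a 1 =
      (∑ i ∈ armOf A a (nonNulls μ), Y i) / (armOf A a (nonNulls μ)).card := by
  have h0' : ((armOf A a (nonNulls μ)ᶜ).card : ℝ) ≠ 0 := by exact_mod_cast h0
  have h1' : ((armOf A a (nonNulls μ)).card : ℝ) ≠ 0 := by exact_mod_cast h1
  rw [olsFit, olsCoef, gram_inv h0 h1, sum_smul_regressor]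
  simp [regressor, Matrix.mulVec, dotProduct, Fin.sum_univ_two]
  field_simp
  ring

lemma fitVar_zero (h0 : (armOf A a (nonNulls μ)ᶜ).card ≠ 0)
    (h1 : (armOf A a (nonNulls μ)).card ≠ 0) :
    fitVar (idealCovariate μ) A Y a 0 =
      noiseVar (idealCovariate μ) A Y a / (armOf A a (nonNulls μ)ᶜ).card := by
  rw [fitVar, gram_inv h0 h1]
  simp [regressor, Matrix.mulVec, dotProduct, Fin.sum_univ_two]
  ring

lemma fitVar_one (h0 : (armOf A a (nonNulls μ)ᶜ).card ≠ 0)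
    (h1 : (armOf A a (nonNulls μ)).card ≠ 0) :
    fitVar (idealCovariate μ) A Y a 1 =
      noiseVar (idealCovariate μ) A Y a / (armOf A a (nonNulls μ)).card := by
  rw [fitVar, gram_inv h0 h1]
  simp [regressor, Matrix.mulVec, dotProduct, Fin.sum_univ_two]
  ring

lemma sum_sq_sub_mean (H : Finset (Fin n)) (hH : H.card ≠ 0) (e : Fin n → ℝ) :
    ∑ i ∈ H, (e i - (∑ j ∈ H, e j) / H.card) ^ 2 =
      H.card + ∑ i ∈ H, (e i ^ 2 - 1) - (∑ i ∈ H, e i) ^ 2 / H.card := by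
  have hH' : (H.card : ℝ) ≠ 0 := by exact_mod_cast hH
  set s := ∑ j ∈ H, e j with hs
  have : ∀ i ∈ H, (e i - s / H.card) ^ 2 =
      1 + (e i ^ 2 - 1) - 2 * (s / H.card) * e i + (s / H.card) ^ 2 := fun i _ => by ring
  rw [Finset.sum_congr rfl this, Finset.sum_add_distrib, Finset.sum_sub_distrib,
    Finset.sum_add_distrib, ← Finset.mul_sum, ← hs]
  simp only [Finset.sum_const, nsmul_eq_mul, mul_one]
  field_simp
  ring

/-- On the members of the group `G` in the arm `a`, the noise `e` obeys the laws of large numbers at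
precision `|G| ^ (-1/4)`. -/
def ArmRegular (A : Fin n → Bool) (e : Fin n → ℝ) (G : Finset (Fin n)) (a : Bool) : Prop :=
  (G.card : ℝ) / 4 ≤ (armOf A a G).card ∧
  |∑ i ∈ armOf A a G, e i| ≤ (G.card : ℝ) ^ (3 / 4 : ℝ) ∧
  |∑ i ∈ armOf A a G, (e i ^ 2 - 1)| ≤ (G.card : ℝ) ^ (3 / 4 : ℝ)

lemma ArmRegular.card_ne_zero {e : Fin n → ℝ} {G : Finset (Fin n)} (h : ArmRegular A e G a)
    (hG : 0 < G.card) : (armOf A a G).card ≠ 0 := by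
  have hG' : (0 : ℝ) < G.card := by exact_mod_cast hG
  have : (0 : ℝ) < (armOf A a G).card := by linarith [h.1]
  exact_mod_cast this.ne'

lemma rpow_three_quarters_sq {g : ℝ} (hg : 1 ≤ g) :
    (g ^ (3 / 4 : ℝ)) ^ 2 ≤ g ^ (3 / 4 : ℝ) * g := by
  have h0 : (0 : ℝ) ≤ g := by linarith
  rw [sq]
  gcongr
  calc g ^ (3 / 4 : ℝ) ≤ g ^ (1 : ℝ) := Real.rpow_le_rpow_of_exponent_le hg (by norm_num)
    _ = g := Real.rpow_one g

lemma ArmRegular.abs_mean_le {e : Fin n → ℝ} {G : Finset (Fin n)} (h : ArmRegular A e G a)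
    (hG : 0 < G.card) :
    |(∑ i ∈ armOf A a G, e i) / (armOf A a G).card| ≤ 4 * (G.card : ℝ) ^ (-(1 / 4) : ℝ) := by
  obtain ⟨h1, h2, -⟩ := h
  have hG' : (0 : ℝ) < G.card := by exact_mod_cast hG
  have hN : (0 : ℝ) < (armOf A a G).card := by linarith
  rw [abs_div, abs_of_pos hN, div_le_iff₀ hN]
  calc _ ≤ (G.card : ℝ) ^ (3 / 4 : ℝ) := h2
    _ = 4 * (G.card : ℝ) ^ (-(1 / 4) : ℝ) * (G.card / 4) := by
        rw [show (3 / 4 : ℝ) = -(1 / 4) + 1 by norm_num, Real.rpow_add hG', Real.rpow_one]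
        ring
    _ ≤ _ := by gcongr

lemma ArmRegular.sq_sum_div_le {e : Fin n → ℝ} {G : Finset (Fin n)} (h : ArmRegular A e G a)
    (hG : 0 < G.card) :
    (∑ i ∈ armOf A a G, e i) ^ 2 / (armOf A a G).card ≤ 4 * (G.card : ℝ) ^ (3 / 4 : ℝ) := by
  obtain ⟨h1, h2, -⟩ := h
  have hG' : (1 : ℝ) ≤ G.card := by exact_mod_cast hG
  have hN : (0 : ℝ) < (armOf A a G).card := by linarith
  rw [div_le_iff₀ hN]
  have hR : 0 ≤ (G.card : ℝ) ^ (3 / 4 : ℝ) := by positivity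
  calc (∑ i ∈ armOf A a G, e i) ^ 2 ≤ ((G.card : ℝ) ^ (3 / 4 : ℝ)) ^ 2 := sq_le_sq' (by
          linarith [(abs_le.1 h2).1]) (abs_le.1 h2).2
    _ ≤ (G.card : ℝ) ^ (3 / 4 : ℝ) * G.card := rpow_three_quarters_sq hG'
    _ = 4 * (G.card : ℝ) ^ (3 / 4 : ℝ) * (G.card / 4) := by ring
    _ ≤ _ := by gcongr

variable {e : Fin n → ℝ} {Y}

lemma mean_observed {G : Finset (Fin n)} (hG : (armOf A a G).card ≠ 0) {c : ℝ}
    (hY : ∀ i ∈ armOf A a G, Y i = c + e i) :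
    (∑ i ∈ armOf A a G, Y i) / (armOf A a G).card =
      c + (∑ i ∈ armOf A a G, e i) / (armOf A a G).card := by
  have hG' : ((armOf A a G).card : ℝ) ≠ 0 := by exact_mod_cast hG
  rw [Finset.sum_congr rfl hY, Finset.sum_add_distrib, Finset.sum_const, nsmul_eq_mul]
  field_simp

/-- The residual variance of a regular arm is one up to `O(n ^ (-1/4))`. -/
lemma abs_noiseVar_sub_one_le {c₀ c₁ : ℝ} (hr0 : ArmRegular A e (nonNulls μ)ᶜ a)
    (hr1 : ArmRegular A e (nonNulls μ) a) (hg0 : 0 < (nonNulls μ)ᶜ.card)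
    (hg1 : 0 < (nonNulls μ).card) (hn : 16 ≤ n)
    (hY0 : ∀ i ∈ armOf A a (nonNulls μ)ᶜ, Y i = c₀ + e i)
    (hY1 : ∀ i ∈ armOf A a (nonNulls μ), Y i = c₁ + e i) :
    |noiseVar (idealCovariate μ) A Y a - 1| ≤ 96 * (n : ℝ) ^ (-(1 / 4) : ℝ) := by
  have n0 := hr0.card_ne_zero hg0
  have n1 := hr1.card_ne_zero hg1
  have hcardn : ((nonNulls μ)ᶜ.card : ℝ) + (nonNulls μ).card = n := by
    have := Finset.card_compl_add_card (nonNulls μ)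
    rw [Fintype.card_fin] at this
    exact_mod_cast this
  have hn' : (16 : ℝ) ≤ n := by exact_mod_cast hn
  set R := (n : ℝ) ^ (3 / 4 : ℝ) with hR
  have hR1 : 1 ≤ R := Real.one_le_rpow (by linarith) (by norm_num)
  have hpow : ∀ G : Finset (Fin n), (G.card : ℝ) ^ (3 / 4 : ℝ) ≤ R := fun G => by
    refine Real.rpow_le_rpow (Nat.cast_nonneg _) ?_ (by norm_num)
    exact_mod_cast (Finset.card_le_univ G).trans_eq (Fintype.card_fin n)
  set N0 := ((armOf A a (nonNulls μ)ᶜ).card : ℝ) with hN0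
  set N1 := ((armOf A a (nonNulls μ)).card : ℝ) with hN1
  have hNn : (n : ℝ) / 4 ≤ N0 + N1 := by
    have h1 := hr0.1
    have h2 := hr1.1
    linarith
  have hcard : ((({i | A i = a} : Finset (Fin n)).card : ℝ)) = N0 + N1 := by
    have := sum_arm_eq A a (nonNulls μ) (fun _ => (1 : ℝ))
    simpa using this
  have hres : ∑ i with A i = a, (Y i - olsFit (idealCovariate μ) A Y a (idealCovariate μ i)) ^ 2 =
      (N0 + ∑ i ∈ armOf A a (nonNulls μ)ᶜ, (e i ^ 2 - 1) -
        (∑ i ∈ armOf A a (nonNulls μ)ᶜ, e i) ^ 2 / N0) +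
      (N1 + ∑ i ∈ armOf A a (nonNulls μ), (e i ^ 2 - 1) -
        (∑ i ∈ armOf A a (nonNulls μ), e i) ^ 2 / N1) := by
    rw [sum_arm_eq A a (nonNulls μ), ← sum_sq_sub_mean _ n0, ← sum_sq_sub_mean _ n1]
    congr 1
    · refine Finset.sum_congr rfl fun i hi => ?_
      rw [(idealCovariate_eq_zero_iff μ i).2 (Finset.mem_filter.1 hi).1, olsFit_zero Y n0 n1,
        mean_observed n0 hY0, hY0 i hi]
      ring
    · refine Finset.sum_congr rfl fun i hi => ?_
      rw [(idealCovariate_eq_one_iff μ i).2 (Finset.mem_filter.1 hi).1, olsFit_one Y n0 n1,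
        mean_observed n1 hY1, hY1 i hi]
      ring
  have q0 := abs_le.1 (hr0.2.2.trans (hpow _))
  have q1 := abs_le.1 (hr1.2.2.trans (hpow _))
  have s0 := (hr0.sq_sum_div_le hg0).trans (mul_le_mul_of_nonneg_left (hpow _) (by norm_num))
  have s1 := (hr1.sq_sum_div_le hg1).trans (mul_le_mul_of_nonneg_left (hpow _) (by norm_num))
  have s0' : 0 ≤ (∑ i ∈ armOf A a (nonNulls μ)ᶜ, e i) ^ 2 / N0 := by positivity
  have s1' : 0 ≤ (∑ i ∈ armOf A a (nonNulls μ), e i) ^ 2 / N1 := by positivity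
  have hD : (n : ℝ) / 8 ≤ N0 + N1 - 1 - 1 := by linarith
  have hDpos : 0 < N0 + N1 - 1 - 1 := by linarith
  have hRn : 96 * (n : ℝ) ^ (-(1 / 4) : ℝ) * (n / 8) = 12 * R := by
    rw [hR, show (3 / 4 : ℝ) = -(1 / 4) + 1 by norm_num, Real.rpow_add (by linarith : (0 : ℝ) < n),
      Real.rpow_one]
    ring
  rw [noiseVar, hres, hcard, div_sub_one hDpos.ne', abs_div, abs_of_pos hDpos, div_le_iff₀ hDpos]
  refine le_trans ?_ (mul_le_mul_of_nonneg_left hD (by positivity))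
  rw [hRn, abs_le]
  constructor <;> linarith

end OLS

/-! ### The p-values of linear-BH -/

/-- The p-values in the group `G` are those of `z`-scores `μ + g` up to an error `h` in location and
in scale. -/
def PValueApprox {n : ℕ} (p μ g : Fin n → ℝ) (G : Finset (Fin n)) (h : ℝ) : Prop :=
  ∀ i ∈ G, ∃ δ s : ℝ, |δ| ≤ h ∧ |s - 1| ≤ h ∧ p i = gaussianTail ((μ i + g i + δ) / s)

lemma abs_sqrt_sub_one_le {v : ℝ} (hv : 0 ≤ v) : |Real.sqrt v - 1| ≤ |v - 1| := by
  have h1 : v - 1 = (Real.sqrt v - 1) * (Real.sqrt v + 1) := by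
    nlinarith [Real.sq_sqrt hv]
  rw [h1, abs_mul]
  refine le_mul_of_one_le_right (abs_nonneg _) ?_
  rw [abs_of_nonneg (by positivity)]
  linarith [Real.sqrt_nonneg v]

/-- A common form of the p-values in either group: `m a` and `N a` are the mean noise and the size of
the group in the arm `a`. -/
lemma exists_pValue_approx {n : ℕ} {X Y : Fin n → ℝ} {A : Fin n → Bool} {i : Fin n}
    {μi ei κ γ d : ℝ} {m N : Bool → ℝ} (hYi : Y i = (if A i then μi else 0) + ei)
    (hfit : ∀ a, olsFit X A Y a (X i) = (if a then μi else 0) + m a)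
    (hvar : ∀ a, fitVar X A Y a (X i) = noiseVar X A Y a / N a)
    (hκ : ∀ a, |noiseVar X A Y a - 1| ≤ κ) (hκ1 : κ ≤ 1) (hN0 : ∀ a, 0 < N a)
    (hN : ∀ a, 1 / N a ≤ γ) (hm : ∀ a, |m a| ≤ d) :
    ∃ δ s : ℝ, |δ| ≤ d ∧ |s - 1| ≤ κ + 2 * γ ∧
      linearPValue X A Y i = gaussianTail ((μi + (if A i then ei else -ei) + δ) / s) := by
  have hv0 : ∀ a, 0 ≤ noiseVar X A Y a := fun a => by linarith [(abs_le.1 (hκ a)).1]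
  have hv2 : ∀ a, noiseVar X A Y a ≤ 2 := fun a => by linarith [(abs_le.1 (hκ a)).2]
  have hs : ∀ a b, |Real.sqrt (noiseVar X A Y a + noiseVar X A Y b / N b) - 1| ≤ κ + 2 * γ := by
    intro a b
    have h1 : 0 ≤ noiseVar X A Y b / N b := div_nonneg (hv0 b) (hN0 b).le
    have h2 : noiseVar X A Y b / N b ≤ 2 * γ := by
      rw [div_eq_mul_one_div]
      exact mul_le_mul (hv2 b) (hN b) (one_div_pos.2 (hN0 b)).le zero_le_two
    refine (abs_sqrt_sub_one_le (add_nonneg (hv0 a) h1)).trans ?_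
    have := abs_le.1 (hκ a)
    rw [abs_le]
    constructor <;> linarith
  cases hA : A i with
  | true =>
    refine ⟨-m false, _, by rw [abs_neg]; exact hm false, hs true false, ?_⟩
    have hYi' : Y i = μi + ei := by rw [hYi, hA, if_pos rfl]
    simp only [linearPValue, imputed, imputedVar, hA, if_true, Bool.true_eq_false, if_false, hfit,
      hvar, hYi', gaussianTail, Bool.false_eq_true]
    congr 3
    ring
  | false =>
    refine ⟨m true, _, hm true, hs false true, ?_⟩
    have hYi' : Y i = ei := by rw [hYi, hA]; simp
    simp only [linearPValue, imputed, imputedVar, hA, if_true, Bool.false_eq_true, if_false, hfit,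
      hvar, hYi', gaussianTail]
    rw [add_comm (_ / _)]
    congr 3
    ring

lemma pValueApprox_of_regular {n : ℕ} {μ e Y : Fin n → ℝ} {A : Fin n → Bool} {c : ℝ}
    (hμ0 : ∀ i ∈ (nonNulls μ)ᶜ, μ i = 0) (hμ1 : ∀ i ∈ nonNulls μ, μ i = c)
    (hY : ∀ i, Y i = (if A i then μ i else 0) + e i)
    (hr0 : ∀ a, ArmRegular A e (nonNulls μ)ᶜ a) (hr1 : ∀ a, ArmRegular A e (nonNulls μ) a)
    (hg0 : 0 < (nonNulls μ)ᶜ.card) (hg1 : 0 < (nonNulls μ).card) (hn : 16 ≤ n)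
    (hκ : 96 * (n : ℝ) ^ (-(1 / 4) : ℝ) ≤ 1) {G : Finset (Fin n)}
    (hG : G = nonNulls μ ∨ G = (nonNulls μ)ᶜ) :
    PValueApprox (linearPValue (idealCovariate μ) A Y) μ (fun i => if A i then e i else -e i) G
      (96 * (n : ℝ) ^ (-(1 / 4) : ℝ) + 8 * (G.card : ℝ) ^ (-(1 / 4) : ℝ)) := by
  have hY1 : ∀ a, ∀ i ∈ armOf A a (nonNulls μ), Y i = (if a then c else 0) + e i := by
    intro a i hi
    rw [armOf, Finset.mem_filter] at hi
    rw [hY, hi.2, hμ1 i hi.1]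
  have hY0 : ∀ a, ∀ i ∈ armOf A a (nonNulls μ)ᶜ, Y i = 0 + e i := by
    intro a i hi
    rw [armOf, Finset.mem_filter] at hi
    rw [hY, hμ0 i hi.1, ite_self]
  have hv : ∀ a, |noiseVar (idealCovariate μ) A Y a - 1| ≤ 96 * (n : ℝ) ^ (-(1 / 4) : ℝ) :=
    fun a => abs_noiseVar_sub_one_le (hr0 a) (hr1 a) hg0 hg1 hn (hY0 a) (hY1 a)
  have n0 := fun a => (hr0 a).card_ne_zero hg0
  have n1 := fun a => (hr1 a).card_ne_zero hg1
  have hGpos : 0 < G.card := by rcases hG with rfl | rfl <;> assumption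
  have hr : ∀ a, ArmRegular A e G a := by rcases hG with rfl | rfl <;> assumption
  have hG1 : (1 : ℝ) ≤ G.card := by exact_mod_cast hGpos
  have hγ : ∀ a, 1 / ((armOf A a G).card : ℝ) ≤ 4 * (G.card : ℝ) ^ (-(1 / 4) : ℝ) := by
    intro a
    have h1 := (hr a).1
    calc 1 / ((armOf A a G).card : ℝ) ≤ 1 / (G.card / 4) :=
          one_div_le_one_div_of_le (by linarith) h1
      _ = 4 * (G.card : ℝ) ^ (-1 : ℝ) := by rw [Real.rpow_neg_one]; field_simp
      _ ≤ _ := by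
          gcongr
          norm_num
  have hNpos : ∀ a, (0 : ℝ) < (armOf A a G).card := fun a => by linarith [(hr a).1]
  have key : ∀ i ∈ G, ∀ a,
      olsFit (idealCovariate μ) A Y a (idealCovariate μ i) =
        (if a then μ i else 0) + (∑ i ∈ armOf A a G, e i) / (armOf A a G).card ∧
      fitVar (idealCovariate μ) A Y a (idealCovariate μ i) =
        noiseVar (idealCovariate μ) A Y a / (armOf A a G).card := by
    intro i hi a
    rcases hG with rfl | rfl
    · rw [(idealCovariate_eq_one_iff μ i).2 hi, olsFit_one Y (n0 a) (n1 a),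
        fitVar_one Y (n0 a) (n1 a), mean_observed (n1 a) (hY1 a), hμ1 i hi]
      exact ⟨rfl, rfl⟩
    · rw [(idealCovariate_eq_zero_iff μ i).2 hi, olsFit_zero Y (n0 a) (n1 a),
        fitVar_zero Y (n0 a) (n1 a), mean_observed (n0 a) (hY0 a), hμ0 i hi, ite_self]
      exact ⟨rfl, rfl⟩
  intro i hi
  obtain ⟨δ, s, h1, h2, h3⟩ := exists_pValue_approx (X := idealCovariate μ) (hY i)
    (m := fun a => (∑ i ∈ armOf A a G, e i) / (armOf A a G).card)
    (N := fun a => ((armOf A a G).card : ℝ)) (fun a => (key i hi a).1) (fun a => (key i hi a).2)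
    hv hκ hNpos hγ fun a => (hr a).abs_mean_le hGpos
  have hp1 : 0 ≤ (n : ℝ) ^ (-(1 / 4) : ℝ) := by positivity
  have hp2 : 0 ≤ (G.card : ℝ) ^ (-(1 / 4) : ℝ) := by positivity
  exact ⟨δ, s, by linarith, by linarith, h3⟩

/-! ### Asymptotics of the sparse model -/

namespace CrossfitICube.IsSparse

variable {r β : ℝ} {μ : (n : ℕ) → Fin n → ℝ}

lemma eventually_card_bounds (h : IsSparse r β μ) :
    ∀ᶠ n : ℕ in atTop, (n : ℝ) ^ (1 - β) / 2 ≤ (nonNulls (μ n)).card ∧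
      ((nonNulls (μ n)).card : ℝ) ≤ 2 * (n : ℝ) ^ (1 - β) := by
  filter_upwards [h.2.eventually (lt_mem_nhds (by norm_num : (1 / 2 : ℝ) < 1)),
    h.2.eventually (gt_mem_nhds (by norm_num : (1 : ℝ) < 2)), eventually_gt_atTop 0] with n h1 h2 hn
  have hn' : (0 : ℝ) < n := by exact_mod_cast hn
  have hpow : (n : ℝ) ^ (1 - β) = n * (n : ℝ) ^ (-β) := by
    rw [sub_eq_add_neg, Real.rpow_add hn', Real.rpow_one]
  have hp : 0 < (n : ℝ) ^ (-β) := Real.rpow_pos_of_pos hn' _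
  rw [lt_div_iff₀ hp, lt_div_iff₀ hn'] at h1
  rw [div_lt_iff₀ hp, div_lt_iff₀ hn'] at h2
  rw [hpow]
  constructor <;> nlinarith

lemma tendsto_card_nonNulls (h : IsSparse r β μ) (hβ : β < 1) :
    Tendsto (fun n => (nonNulls (μ n)).card) atTop atTop := by
  rw [← tendsto_natCast_atTop_iff (R := ℝ)]
  have h1 : Tendsto (fun n : ℕ => (n : ℝ) ^ (1 - β) / 2) atTop atTop :=
    ((tendsto_rpow_atTop (by linarith)).comp tendsto_natCast_atTop_atTop).atTop_div_const two_pos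
  exact tendsto_atTop_mono' _ (h.eventually_card_bounds.mono fun n hn => hn.1) h1

lemma card_compl (μ : (n : ℕ) → Fin n → ℝ) (n : ℕ) :
    ((nonNulls (μ n))ᶜ.card : ℝ) + (nonNulls (μ n)).card = n := by
  have := Finset.card_compl_add_card (nonNulls (μ n))
  rw [Fintype.card_fin] at this
  exact_mod_cast this

lemma eventually_card_nulls (h : IsSparse r β μ) (hβ : 0 < β) :
    ∀ᶠ n : ℕ in atTop, (n : ℝ) / 2 ≤ (nonNulls (μ n))ᶜ.card := by
  have h1 : Tendsto (fun n : ℕ => (n : ℝ) ^ (-β)) atTop (𝓝 0) :=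
    (tendsto_rpow_neg_atTop hβ).comp tendsto_natCast_atTop_atTop
  filter_upwards [h.eventually_card_bounds, eventually_gt_atTop 0,
    h1.eventually (gt_mem_nhds (by norm_num : (0 : ℝ) < 1 / 4))] with n hn hn0 hs
  have hn' : (0 : ℝ) < n := by exact_mod_cast hn0
  have hpow : (n : ℝ) ^ (1 - β) = n * (n : ℝ) ^ (-β) := by
    rw [sub_eq_add_neg, Real.rpow_add hn', Real.rpow_one]
  have := card_compl μ n
  have h2 := hn.2
  rw [hpow] at h2
  nlinarith

lemma tendsto_card_nulls (h : IsSparse r β μ) (hβ : 0 < β) :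
    Tendsto (fun n => (nonNulls (μ n))ᶜ.card) atTop atTop := by
  rw [← tendsto_natCast_atTop_iff (R := ℝ)]
  exact tendsto_atTop_mono' _ (h.eventually_card_nulls hβ)
    (tendsto_natCast_atTop_atTop.atTop_div_const two_pos)

lemma eq_signal (h : IsSparse r β μ) {n : ℕ} {i : Fin n} (hi : i ∈ nonNulls (μ n)) :
    μ n i = signal r n := by
  rcases h.1 n i with h0 | h1
  · simp [nonNulls, h0] at hi
  · exact h1

lemma eq_zero (h : IsSparse r β μ) {n : ℕ} {i : Fin n} (hi : i ∈ (nonNulls (μ n))ᶜ) :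
    μ n i = 0 := by
  rcases h.1 n i with h0 | h1
  · exact h0
  · have : ¬ 0 < μ n i := by simpa [nonNulls] using hi
    have h2 : 0 ≤ signal r n := Real.sqrt_nonneg _
    linarith

end CrossfitICube.IsSparse

/-- The unit of the signal strengths: `√(2 log n)`. -/
noncomputable def logScale (n : ℕ) : ℝ := Real.sqrt (2 * Real.log n)

lemma logScale_sq (n : ℕ) : logScale n ^ 2 = 2 * Real.log n :=
  Real.sq_sqrt (mul_nonneg zero_le_two (Real.log_natCast_nonneg n))

lemma signal_eq {r : ℝ} (hr : 0 ≤ r) (n : ℕ) : signal r n = Real.sqrt r * logScale n := by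
  rw [signal, logScale, ← Real.sqrt_mul hr]
  congr 1
  ring

lemma tendsto_logScale : Tendsto logScale atTop atTop :=
  Real.tendsto_sqrt_atTop.comp ((Real.tendsto_log_atTop.comp
    tendsto_natCast_atTop_atTop).const_mul_atTop two_pos)

lemma rpow_neg_eq_exp_logScale {n : ℕ} (hn : 0 < n) (q : ℝ) :
    (n : ℝ) ^ (-q) = Real.exp (-(q * logScale n ^ 2) / 2) := by
  rw [Real.rpow_def_of_pos (by exact_mod_cast hn), logScale_sq]
  congr 1
  ring

lemma eventually_rpow_le_mul {m : ℕ → ℕ} (hm : Tendsto m atTop atTop) {c : ℝ} (hc : 0 < c) :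
    ∀ᶠ n in atTop, (m n : ℝ) ^ (3 / 4 : ℝ) ≤ c * m n := by
  have h1 : Tendsto (fun n => (m n : ℝ)) atTop atTop := tendsto_natCast_atTop_atTop.comp hm
  have h2 := (tendsto_rpow_neg_atTop (y := 1 / 4) (by norm_num)).comp h1
  filter_upwards [h2.eventually (gt_mem_nhds hc), h1.eventually_gt_atTop 0] with n hn hpos
  rw [show (3 / 4 : ℝ) = -(1 / 4) + 1 by norm_num, Real.rpow_add hpos, Real.rpow_one]
  exact mul_le_mul_of_nonneg_right hn.le hpos.le

lemma memLp_sq_sub_one : MemLp (fun x : ℝ => x ^ 2 - 1) 2 (gaussianReal 0 1) := by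
  rw [memLp_two_iff_integrable_sq (by fun_prop)]
  have h4 : Integrable (fun x : ℝ => x ^ 4) (gaussianReal 0 1) := by
    have := (memLp_id_gaussianReal' (μ := 0) (v := 1) 4 (by simp)).integrable_norm_pow (by norm_num)
    refine this.congr (Eventually.of_forall fun x => ?_)
    simp only [id, Real.norm_eq_abs]
    exact Even.pow_abs (by decide) x
  have h2 : Integrable (fun x : ℝ => x ^ 2) (gaussianReal 0 1) :=
    (memLp_id_gaussianReal' 2 (by simp)).integrable_sq
  refine ((h4.sub (h2.const_mul 2)).add (integrable_const 1)).congr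
    (Eventually.of_forall fun x => ?_)
  simp only [Pi.add_apply, Pi.sub_apply]
  ring

lemma integral_sq_sub_one : ∫ x : ℝ, (x ^ 2 - 1) ∂gaussianReal 0 1 = 0 := by
  have hL := memLp_id_gaussianReal' (μ := 0) (v := 1) 2 (by simp)
  have hv := variance_eq_sub hL
  simp only [variance_id_gaussianReal, Pi.pow_apply, id_eq, integral_id_gaussianReal,
    NNReal.coe_one] at hv
  have hI : Integrable (fun x : ℝ => x ^ 2) (gaussianReal 0 1) := hL.integrable_sq
  rw [integral_sub hI (integrable_const _)]
  simp only [integral_const, probReal_univ, smul_eq_mul, mul_one]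
  linarith

lemma sum_mask_mem {n : ℕ} (S T : Finset (Fin n)) (f : Fin n → ℝ) :
    ∑ i ∈ S, (if decide (i ∈ T) then 1 else 0) * f i = ∑ i ∈ S ∩ T, f i := by
  rw [← Finset.filter_mem_eq_inter, Finset.sum_filter]
  exact Finset.sum_congr rfl fun i _ => by by_cases h : i ∈ T <;> simp [h]

lemma sum_mask_notMem {n : ℕ} (S T : Finset (Fin n)) (f : Fin n → ℝ) :
    ∑ i ∈ S, (if decide (i ∈ T) then 0 else 1) * f i = ∑ i ∈ S ∩ Tᶜ, f i := by
  rw [← sum_mask_mem]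
  exact Finset.sum_congr rfl fun i _ => by by_cases h : i ∈ T <;> simp [h]

namespace CrossfitICube.IsGaussianTrial

variable {Ω : ℕ → Type*} [∀ n, MeasurableSpace (Ω n)] {P : (n : ℕ) → Measure (Ω n)}
  [∀ n, IsProbabilityMeasure (P n)] {μ : (n : ℕ) → Fin n → ℝ}
  {YC YT : (n : ℕ) → Fin n → Ω n → ℝ} {A : (n : ℕ) → Fin n → Ω n → Bool}
  {I : (n : ℕ) → Ω n → Finset (Fin n)}

/-- Both halves of the split are balanced on every large group. -/
lemma whp_balancedOn (h : ∀ n, IsGaussianTrial (P n) (μ n) (YC n) (YT n) (A n) (I n))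
    {S : (n : ℕ) → Finset (Fin n)} (hS : Tendsto (fun n => (S n).card) atTop atTop) :
    WithHighProb P (fun n ω =>
      BalancedOn (fun i => A n i ω) (fun i => noise (μ n) (YC n) (YT n) (A n) i ω) (S n) (I n ω) ∧
      BalancedOn (fun i => A n i ω) (fun i => noise (μ n) (YC n) (YT n) (A n) i ω) (S n)
        (I n ω)ᶜ) := by
  have hid : MemLp (fun x : ℝ => x) 2 (gaussianReal 0 1) := memLp_id_gaussianReal' 2 (by simp)
  have hsum : ∀ m : Bool → ℝ, (∀ b, |m b| ≤ 1) → WithHighProb P (fun n ω =>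
      |∑ i ∈ S n, m (decide (i ∈ I n ω)) * ((if A n i ω then 1 else 0) - 1 / 2)| ≤
        ((S n).card : ℝ) ^ (3 / 4 : ℝ) ∧
      |∑ i ∈ S n, m (decide (i ∈ I n ω)) * noise (μ n) (YC n) (YT n) (A n) i ω| ≤
        ((S n).card : ℝ) ^ (3 / 4 : ℝ) ∧
      |∑ i ∈ S n, m (decide (i ∈ I n ω)) *
        ((if A n i ω then 1 else -1) * noise (μ n) (YC n) (YT n) (A n) i ω)| ≤
        ((S n).card : ℝ) ^ (3 / 4 : ℝ)) := by
    intro m hm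
    have e1 := whp_weightedSum h hS (m := m) (w := fun b => (if b then 1 else 0) - 1 / 2)
      (k := fun _ => 1) measurable_const (memLp_const 1) hm
      (fun b => by cases b <;> norm_num [abs_of_pos, abs_of_neg]) (by norm_num)
    have e2 := whp_weightedSum h hS (m := m) (w := fun _ => 1)
      (k := fun x => x) measurable_id hid hm (fun b => by simp) (by simp)
    have e3 := whp_weightedSum h hS (m := m) (w := fun b => if b then 1 else -1)
      (k := fun x => x) measurable_id hid hm (fun b => by cases b <;> simp) (by simp)
    refine (e1.and (e2.and e3)).mono (Eventually.of_forall fun n ω hω => ?_)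
    simpa only [mul_one, one_mul] using hω
  have hin := hsum (fun b => if b then 1 else 0) (fun b => by cases b <;> simp)
  have hout := hsum (fun b => if b then 0 else 1) (fun b => by cases b <;> simp)
  refine ((whp_split_count h hS).and (hin.and hout)).mono ?_
  filter_upwards [eventually_rpow_le_mul hS (by norm_num : (0 : ℝ) < 1 / 32)] with n hn ω hω
  simp only [sum_mask_mem, sum_mask_notMem] at hω
  obtain ⟨hc, ⟨a1, a2, a3⟩, b1, b2, b3⟩ := hω
  have hc' := abs_le.1 hc
  have hcompl : ((S n ∩ I n ω).card : ℝ) + (S n ∩ (I n ω)ᶜ).card = (S n).card := by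
    have := Finset.card_inter_add_card_sdiff (S n) (I n ω)
    rw [Finset.sdiff_eq_inter_compl] at this
    exact_mod_cast this
  have hpos : (0 : ℝ) ≤ (S n).card := Nat.cast_nonneg _
  refine ⟨⟨?_, ?_, ?_, ?_⟩, ?_, ?_, ?_, ?_⟩ <;> linarith

/-- Both arms are regular on every large group. -/
lemma whp_armRegular (h : ∀ n, IsGaussianTrial (P n) (μ n) (YC n) (YT n) (A n) (I n))
    {S : (n : ℕ) → Finset (Fin n)} (hS : Tendsto (fun n => (S n).card) atTop atTop) :
    WithHighProb P (fun n ω => ∀ a, ArmRegular (fun i => A n i ω)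
      (fun i => noise (μ n) (YC n) (YT n) (A n) i ω) (S n) a) := by
  have hid : MemLp (fun x : ℝ => x) 2 (gaussianReal 0 1) := memLp_id_gaussianReal' 2 (by simp)
  have harm : ∀ a, WithHighProb P (fun n ω => ArmRegular (fun i => A n i ω)
      (fun i => noise (μ n) (YC n) (YT n) (A n) i ω) (S n) a) := by
    intro a
    have e1 := whp_weightedSum h hS (m := fun _ => 1) (w := fun b => (if b = a then 1 else 0) - 1 / 2)
      (k := fun _ => 1) measurable_const (memLp_const 1) (by simp)
      (fun b => by split_ifs <;> norm_num [abs_of_pos, abs_of_neg])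
      (by cases a <;> norm_num)
    have e2 := whp_weightedSum h hS (m := fun _ => 1) (w := fun b => if b = a then 1 else 0)
      (k := fun x => x) measurable_id hid (by simp) (fun b => by split_ifs <;> simp) (by simp)
    have e3 := whp_weightedSum h hS (m := fun _ => 1) (w := fun b => if b = a then 1 else 0)
      (k := fun x => x ^ 2 - 1) (by fun_prop) memLp_sq_sub_one (by simp)
      (fun b => by split_ifs <;> simp) (by rw [integral_sq_sub_one, mul_zero])
    refine (e1.and (e2.and e3)).mono ?_
    filter_upwards [eventually_rpow_le_mul hS (by norm_num : (0 : ℝ) < 1 / 4)] with n hn ω hω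
    have hf : ∀ f : Fin n → ℝ, ∑ i ∈ S n, (if A n i ω = a then 1 else 0) * f i =
        ∑ i ∈ armOf (fun i => A n i ω) a (S n), f i := fun f => by
      rw [armOf, Finset.sum_filter]
      exact Finset.sum_congr rfl fun i _ => by split_ifs <;> simp
    simp only [one_mul, hf, mul_one] at hω
    obtain ⟨h1, h2, h3⟩ := hω
    refine ⟨?_, h2, h3⟩
    have hcount : ∑ i ∈ S n, ((if A n i ω = a then 1 else 0) - 1 / 2 : ℝ) =
        (armOf (fun i => A n i ω) a (S n)).card - (S n).card / 2 := by
      have h4 := hf fun _ => 1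
      simp only [mul_one, Finset.sum_const, nsmul_eq_mul] at h4
      rw [Finset.sum_sub_distrib, h4, Finset.sum_const, nsmul_eq_mul]
      ring
    rw [hcount] at h1
    have := abs_le.1 h1
    linarith
  refine ((harm true).and (harm false)).mono (Eventually.of_forall fun n ω hω a => ?_)
  cases a
  exacts [hω.2, hω.1]

/-! ### Crossfit-I³ -/

theorem tendsto_power_crossfitICube {r β α : ℝ} (hμ : IsSparse r β μ)
    (h : ∀ n, IsGaussianTrial (P n) (μ n) (YC n) (YT n) (A n) (I n))
    (hα0 : 0 < α) (hα1 : α < 1) (hr : 0 < r) (hβ0 : 0 < β) (hβ1 : β < 1)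
    {tie : (n : ℕ) → TieRule n} (htie : ∀ n, (tie n).IsMeasurable) :
    Tendsto (fun n => power (P n) (nonNulls (μ n)) (fun ω =>
        crossfitICube (tie n) α (idealCovariate (μ n)) (fun i => A n i ω)
          (observed (fun i => A n i ω) (fun i => YC n i ω) (fun i => YT n i ω)) (I n ω)))
      atTop (𝓝 1) := by
  have hS1 := hμ.tendsto_card_nonNulls hβ1
  have hS0 := hμ.tendsto_card_nulls hβ0
  have hsig : Tendsto (fun n => signal r n) atTop atTop := by
    simp only [signal_eq hr.le]
    exact tendsto_logScale.const_mul_atTop (Real.sqrt_pos.2 hr)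
  refine WithHighProb.tendsto_integral_one (fun n => measurable_power_integrand _ fun i =>
    (h n).measurableSet_mem_crossfitICube (htie n) α _ i) (fun n ω => by positivity)
    (fun n ω => ?_) fun η hη => ?_
  · refine div_le_one_of_le₀ (le_max_of_le_left ?_) (by positivity)
    exact_mod_cast Finset.card_le_card Finset.inter_subset_right
  set η' := min η (α / 32) with hη'
  have hη'0 : 0 < η' := lt_min hη (by positivity)
  refine ((whp_balancedOn h hS1).and ((whp_balancedOn h hS0).and (whp_card_large_noise h
    (fun n => nonNulls (μ n)) (hsig.atTop_div_const four_pos) hη'0))).mono ?_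
  filter_upwards [hsig.eventually_gt_atTop 8, hS0.eventually_gt_atTop 0, hS1.eventually_gt_atTop 0,
    (tendsto_natCast_atTop_atTop.comp hS1).eventually_ge_atTop (1 / η')] with n hn8 hn0 hn1 hnη ω hω
  obtain ⟨⟨b1, b1'⟩, ⟨b0, b0'⟩, hbad⟩ := hω
  have hP : 1 ≤ η' * (nonNulls (μ n)).card := by
    simp only [Function.comp] at hnη
    rwa [div_le_iff₀' hη'0] at hnη
  have key := le_card_crossfitICube_inter (tie n) hα0 hα1 hn8 (hμ.1 n)
    (observed_eq_add_noise (μ n) (YC n) (YT n) (A n) · ω) hP (min_le_right _ _) hn0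
    b1 b0 b1' b0' hbad
  have hcard : (1 : ℝ) ≤ (nonNulls (μ n)).card := by exact_mod_cast hn1
  rw [max_eq_left hcard, le_div_iff₀ (by linarith)]
  refine le_trans ?_ key
  have : η' ≤ η := min_le_left _ _
  gcongr

end CrossfitICube.IsGaussianTrial

/-! ### The Benjamini-Hochberg procedure -/

lemma filter_subset_bhReject {n k : ℕ} {α : ℝ} {p : Fin n → ℝ} (hα : 0 ≤ α) (hk : 0 < k)
    (hle : k ≤ ({i | p i ≤ k * α / n} : Finset (Fin n)).card) :
    ({i | p i ≤ k * α / n} : Finset (Fin n)) ⊆ bhReject α p := by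
  have hkn : k ≤ n := hle.trans ((Finset.card_le_univ _).trans_eq (Fintype.card_fin n))
  have hcount : k ≤ bhCount α p := Nat.le_findGreatest hkn hle
  intro i hi
  simp only [Finset.mem_filter, Finset.mem_univ, true_and, bhReject] at hi ⊢
  refine ⟨hk.trans_le hcount, hi.trans ?_⟩
  gcongr

lemma bhCount_le_card {n : ℕ} {α : ℝ} {p : Fin n → ℝ} (h : 0 < bhCount α p) :
    bhCount α p ≤ ({i | p i ≤ bhCount α p * α / n} : Finset (Fin n)).card :=
  Nat.findGreatest_of_ne_zero (P := fun k => k ≤ ({i | p i ≤ k * α / n} : Finset (Fin n)).card)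
    rfl h.ne'

namespace CrossfitICube.IsGaussianTrial

variable {Ω : ℕ → Type*} [∀ n, MeasurableSpace (Ω n)] {P : (n : ℕ) → Measure (Ω n)}
  [∀ n, IsProbabilityMeasure (P n)] {μ : (n : ℕ) → Fin n → ℝ}
  {YC YT : (n : ℕ) → Fin n → Ω n → ℝ} {A : (n : ℕ) → Fin n → Ω n → Bool}
  {I : (n : ℕ) → Ω n → Finset (Fin n)} {r β α : ℝ}

/-- The p-values of linear-BH are those of `z`-scores with the signed noise, up to a constant error
on the non-nulls and an error `n ^ (-1/8)` on the nulls. -/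
lemma whp_pValueApprox (hμ : IsSparse r β μ)
    (h : ∀ n, IsGaussianTrial (P n) (μ n) (YC n) (YT n) (A n) (I n))
    (hβ0 : 0 < β) (hβ1 : β < 1) {η : ℝ} (hη : 0 < η) :
    WithHighProb P (fun n ω =>
      PValueApprox (linearPValue (idealCovariate (μ n)) (fun i => A n i ω)
        (observed (fun i => A n i ω) (fun i => YC n i ω) (fun i => YT n i ω))) (μ n)
        (fun i => signedNoise (μ n) (YC n) (YT n) (A n) i ω) (nonNulls (μ n)) η ∧
      PValueApprox (linearPValue (idealCovariate (μ n)) (fun i => A n i ω)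
        (observed (fun i => A n i ω) (fun i => YC n i ω) (fun i => YT n i ω))) (μ n)
        (fun i => signedNoise (μ n) (YC n) (YT n) (A n) i ω) (nonNulls (μ n))ᶜ
        ((n : ℝ) ^ (-(1 / 8) : ℝ))) := by
  have hS1 := hμ.tendsto_card_nonNulls hβ1
  have hS0 := hμ.tendsto_card_nulls hβ0
  have hpow : ∀ y : ℝ, 0 < y → Tendsto (fun n : ℕ => (n : ℝ) ^ (-y)) atTop (𝓝 0) := fun y hy =>
    (tendsto_rpow_neg_atTop hy).comp tendsto_natCast_atTop_atTop
  have herr1 : Tendsto (fun n : ℕ => 96 * (n : ℝ) ^ (-(1 / 4) : ℝ) +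
      8 * ((nonNulls (μ n)).card : ℝ) ^ (-(1 / 4) : ℝ)) atTop (𝓝 0) := by
    have := ((hpow (1 / 4) (by norm_num)).const_mul 96).add
      (((hpow (1 / 4) (by norm_num)).comp hS1).const_mul 8)
    simpa using this
  refine ((whp_armRegular h hS1).and (whp_armRegular h hS0)).mono ?_
  filter_upwards [hS0.eventually_gt_atTop 0, hS1.eventually_gt_atTop 0, eventually_ge_atTop 16,
    (hpow (1 / 4) (by norm_num)).eventually (gt_mem_nhds (by norm_num : (0 : ℝ) < 1 / 96)),
    herr1.eventually (gt_mem_nhds hη),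
    (hpow (1 / 8) (by norm_num)).eventually (gt_mem_nhds (by norm_num : (0 : ℝ) < 1 / 112)),
    hμ.eventually_card_nulls hβ0] with n hg0 hg1 hn hκ he1 he0 hhalf ω hω
  have hn' : (0 : ℝ) < n := by exact_mod_cast (by omega : 0 < n)
  have hmain : ∀ G, G = nonNulls (μ n) ∨ G = (nonNulls (μ n))ᶜ → _ := fun G hG =>
    pValueApprox_of_regular (fun i hi => hμ.eq_zero hi) (fun i hi => hμ.eq_signal hi)
      (observed_eq_add_noise (μ n) (YC n) (YT n) (A n) · ω) hω.2 hω.1 hg0 hg1 hn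
      (by linarith) (G := G) hG
  have hmono : ∀ {p m g : Fin n → ℝ} {G : Finset (Fin n)} {a b : ℝ}, PValueApprox p m g G a →
      a ≤ b → PValueApprox p m g G b := fun hp hab i hi => by
    obtain ⟨δ, s, h1, h2, h3⟩ := hp i hi
    exact ⟨δ, s, h1.trans hab, h2.trans hab, h3⟩
  refine ⟨hmono (hmain _ (Or.inl rfl)) he1.le, hmono (hmain _ (Or.inr rfl)) ?_⟩
  have hq : ((nonNulls (μ n))ᶜ.card : ℝ) ^ (-(1 / 4) : ℝ) ≤ 2 * (n : ℝ) ^ (-(1 / 4) : ℝ) := by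
    calc ((nonNulls (μ n))ᶜ.card : ℝ) ^ (-(1 / 4) : ℝ) ≤ ((n : ℝ) / 2) ^ (-(1 / 4) : ℝ) :=
          Real.rpow_le_rpow_of_nonpos (by linarith) hhalf (by norm_num)
      _ = (2 : ℝ) ^ (1 / 4 : ℝ) * (n : ℝ) ^ (-(1 / 4) : ℝ) := by
          rw [Real.div_rpow hn'.le zero_le_two, Real.rpow_neg zero_le_two, div_inv_eq_mul, mul_comm]
      _ ≤ 2 * (n : ℝ) ^ (-(1 / 4) : ℝ) := by
          gcongr
          calc (2 : ℝ) ^ (1 / 4 : ℝ) ≤ 2 ^ (1 : ℝ) :=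
                Real.rpow_le_rpow_of_exponent_le one_le_two (by norm_num)
            _ = 2 := Real.rpow_one 2
  have hsq : (n : ℝ) ^ (-(1 / 4) : ℝ) = (n : ℝ) ^ (-(1 / 8) : ℝ) * (n : ℝ) ^ (-(1 / 8) : ℝ) := by
    rw [← Real.rpow_add hn']
    norm_num
  have h8 : 0 < (n : ℝ) ^ (-(1 / 8) : ℝ) := Real.rpow_pos_of_pos hn' _
  rw [hsq] at hq ⊢
  nlinarith

lemma power_linearBH_integrand_le_one {n : ℕ} (α : ℝ) (X Y : Fin n → ℝ) (a : Fin n → Bool)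
    (G : Finset (Fin n)) : ((linearBH α X a Y ∩ G).card : ℝ) / max (G.card : ℝ) 1 ≤ 1 := by
  refine div_le_one_of_le₀ (le_max_of_le_left ?_) (by positivity)
  exact_mod_cast Finset.card_le_card Finset.inter_subset_right

/-- Above the threshold: the non-nulls alone have enough p-values below `n ^ (-q)`, `β < q < r`, for
the procedure to reject almost all of them. -/
theorem tendsto_power_linearBH_one (hμ : IsSparse r β μ)
    (h : ∀ n, IsGaussianTrial (P n) (μ n) (YC n) (YT n) (A n) (I n))
    (hα0 : 0 < α) (hr1 : r < 1) (hβ0 : 0 < β) (hβ1 : β < 1) (hβr : β < r) :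
    Tendsto (fun n => power (P n) (nonNulls (μ n)) (fun ω =>
        linearBH α (idealCovariate (μ n)) (fun i => A n i ω)
          (observed (fun i => A n i ω) (fun i => YC n i ω) (fun i => YT n i ω))))
      atTop (𝓝 1) := by
  have hS1 := hμ.tendsto_card_nonNulls hβ1
  obtain ⟨q, hβq, hqr⟩ := exists_between hβr
  have hq0 : 0 < q := hβ0.trans hβq
  set η₀ := (Real.sqrt r - Real.sqrt q) / 4 with hη₀
  have hη₀pos : 0 < η₀ := by
    have := Real.sqrt_lt_sqrt hq0.le hqr
    rw [hη₀]; linarith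
  have hsq1 : Real.sqrt q ≤ 1 := Real.sqrt_le_one.2 (by linarith)
  have hsr1 : Real.sqrt r ≤ 1 := Real.sqrt_le_one.2 hr1.le
  have hη₀1 : η₀ ≤ 1 / 4 := by
    rw [hη₀]; linarith [Real.sqrt_nonneg q]
  refine WithHighProb.tendsto_integral_one (fun n => measurable_power_integrand _ fun i =>
    (h n).measurableSet_mem_linearBH α _ i) (fun n ω => by positivity)
    (fun n ω => power_linearBH_integrand_le_one _ _ _ _ _) fun η hη => ?_
  set η' := min η (1 / 2) with hη'
  have hη'0 : 0 < η' := lt_min hη (by norm_num)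
  have hK : Tendsto (fun n => 2 * η₀ * logScale n) atTop atTop :=
    tendsto_logScale.const_mul_atTop (by positivity)
  have hsparse : Tendsto (fun n : ℕ => (n : ℝ) ^ (-(q - β))) atTop (𝓝 0) :=
    (tendsto_rpow_neg_atTop (by linarith)).comp tendsto_natCast_atTop_atTop
  refine ((whp_pValueApprox hμ h hβ0 hβ1 hη₀pos).and (whp_card_large_noise h
    (fun n => nonNulls (μ n)) hK hη'0)).mono ?_
  filter_upwards [hS1.eventually_gt_atTop 0, eventually_gt_atTop 0, hμ.eventually_card_bounds,
    tendsto_logScale.eventually_ge_atTop 1,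
    hsparse.eventually (gt_mem_nhds (by positivity : 0 < α / 4))] with n hg1 hn hbounds hL hsp ω hω
  obtain ⟨⟨hap, -⟩, hbad⟩ := hω
  have hn' : (0 : ℝ) < n := by exact_mod_cast hn
  have hcard : (1 : ℝ) ≤ (nonNulls (μ n)).card := by exact_mod_cast hg1
  set G := nonNulls (μ n) with hG
  set p := linearPValue (idealCovariate (μ n)) (fun i => A n i ω)
    (observed (fun i => A n i ω) (fun i => YC n i ω) (fun i => YT n i ω)) with hp
  set g := fun i => signedNoise (μ n) (YC n) (YT n) (A n) i ω with hg
  set good := G.filter fun i => ¬ 2 * η₀ * logScale n ≤ |noise (μ n) (YC n) (YT n) (A n) i ω|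
    with hgood
  have hsplit : ((G.filter fun i =>
      2 * η₀ * logScale n ≤ |noise (μ n) (YC n) (YT n) (A n) i ω|).card : ℝ) + good.card = G.card := by
    exact_mod_cast Finset.card_filter_add_card_filter_not _
  have hgoodcard : (1 - η') * G.card ≤ good.card := by linarith
  have hη'2 : η' ≤ 1 / 2 := min_le_right _ _
  have hgoodhalf : (1 / 2 : ℝ) * G.card ≤ good.card := by nlinarith
  have hgoodpos : 0 < good.card := by
    have : (0 : ℝ) < good.card := by linarith
    exact_mod_cast this
  have hpv : ∀ i ∈ good, p i ≤ (n : ℝ) ^ (-q) := by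
    intro i hi
    rw [hgood, Finset.mem_filter, not_le, ← abs_signedNoise] at hi
    obtain ⟨δ, s, hδ, hs, hpi⟩ := hap i hi.1
    have h1 := abs_lt.1 hi.2
    have h2 := abs_le.1 hδ
    have h3 := abs_le.1 hs
    have hspos : 0 < s := by linarith
    rw [hpi, hμ.eq_signal hi.1, signal_eq (hq0.le.trans hqr.le),
      rpow_neg_eq_exp_logScale hn]
    have hz : Real.sqrt q * logScale n ≤
        (Real.sqrt r * logScale n + signedNoise (μ n) (YC n) (YT n) (A n) i ω + δ) / s := by
      rw [le_div_iff₀ hspos]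
      have e1 : Real.sqrt r * logScale n = Real.sqrt q * logScale n + 4 * η₀ * logScale n := by
        rw [hη₀]; ring
      have hql : 0 ≤ Real.sqrt q * logScale n := by positivity
      have e2 : Real.sqrt q * logScale n * s ≤ Real.sqrt q * logScale n * (1 + η₀) :=
        mul_le_mul_of_nonneg_left (by linarith) hql
      have e3 : Real.sqrt q * logScale n * η₀ ≤ 1 * logScale n * η₀ := by gcongr
      have e4 : η₀ * 1 ≤ η₀ * logScale n := by gcongr
      linarith
    refine (gaussianTail_antitone hz).trans ((gaussianTail_le_exp (by positivity)).trans ?_)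
    rw [mul_pow, Real.sq_sqrt hq0.le]
  have hthr : (n : ℝ) ^ (-q) ≤ good.card * α / n := by
    rw [le_div_iff₀ hn']
    have e1 : (n : ℝ) ^ (-q) * n = (n : ℝ) ^ (-(q - β)) * (n : ℝ) ^ (1 - β) := by
      rw [← Real.rpow_add hn', ← Real.rpow_add_one hn'.ne']
      congr 1; ring
    have e2 : 0 < (n : ℝ) ^ (1 - β) := Real.rpow_pos_of_pos hn' _
    rw [e1]
    calc (n : ℝ) ^ (-(q - β)) * (n : ℝ) ^ (1 - β) ≤ α / 4 * (n : ℝ) ^ (1 - β) := by gcongr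
      _ = (1 / 2 * ((n : ℝ) ^ (1 - β) / 2)) * α := by ring
      _ ≤ (1 / 2 * G.card) * α := by gcongr; exact hbounds.1
      _ ≤ good.card * α := by gcongr
  have hgs : good ⊆ ({i | p i ≤ good.card * α / n} : Finset (Fin n)) := fun i hi =>
    Finset.mem_filter.2 ⟨Finset.mem_univ _, (hpv i hi).trans hthr⟩
  have hrej : good ⊆ bhReject α p ∩ G := fun i hi =>
    Finset.mem_inter.2 ⟨filter_subset_bhReject hα0.le hgoodpos (Finset.card_le_card hgs) (hgs hi),
      (Finset.mem_filter.1 hi).1⟩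
  rw [max_eq_left hcard, le_div_iff₀ (by linarith)]
  have hη'' : η' ≤ η := min_le_left _ _
  calc (1 - η) * (G.card : ℝ) ≤ (1 - η') * G.card := by gcongr
    _ ≤ good.card := hgoodcard
    _ ≤ _ := by exact_mod_cast Finset.card_le_card hrej

end CrossfitICube.IsGaussianTrial

/-! ### Uniform control of the null p-values -/

lemma tendsto_rpow_neg_mul_log (c : ℝ) :
    Tendsto (fun n : ℕ => (n : ℝ) ^ (-(1 / 8) : ℝ) * (c + 8 * Real.log n)) atTop (𝓝 0) := by
  have h1 : Tendsto (fun x : ℝ => x ^ (-(1 / 8) : ℝ)) atTop (𝓝 0) :=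
    tendsto_rpow_neg_atTop (by norm_num)
  have h2 : Tendsto (fun x : ℝ => Real.log x / x ^ (1 / 8 : ℝ)) atTop (𝓝 0) :=
    (isLittleO_log_rpow_atTop (by norm_num)).tendsto_div_nhds_zero
  have h3 := (h1.mul_const c).add (h2.const_mul 8)
  simp only [zero_mul, mul_zero, add_zero] at h3
  have h4 : Tendsto (fun x : ℝ => x ^ (-(1 / 8) : ℝ) * (c + 8 * Real.log x)) atTop (𝓝 0) := by
    refine h3.congr' ?_
    filter_upwards [eventually_ge_atTop 0] with x hx
    rw [Real.rpow_neg hx]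
    ring
  exact h4.comp tendsto_natCast_atTop_atTop

/-- A deterministic threshold for the signed noise of the nulls that accounts for the errors in
location and scale: it is exceeded whenever the p-value is at most `k α / n`, and still with
probability at most `ρ k / n`, for a fixed `ρ > α`, uniformly in `k`. -/
lemma eventually_exists_threshold {α ρ : ℝ} (hα0 : 0 < α) (hα1 : α < 1) (hαρ : α < ρ) :
    ∀ᶠ n : ℕ in atTop, ∀ k : ℕ, 1 ≤ k → k ≤ n → ∃ t : ℝ, gaussianTail t ≤ ρ * (k / n) ∧
      ∀ x δ s : ℝ, |δ| ≤ (n : ℝ) ^ (-(1 / 8) : ℝ) → |s - 1| ≤ (n : ℝ) ^ (-(1 / 8) : ℝ) →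
        gaussianTail ((x + δ) / s) ≤ k * α / n → t ≤ x := by
  obtain ⟨L, hL⟩ := exists_gaussianTail_gt hα1
  have hκ := tendsto_rpow_neg_mul_log (2 * (|L| + 3) ^ 2)
  have hinv : Tendsto (fun n : ℕ => 1 / (n : ℝ)) atTop (𝓝 0) := tendsto_one_div_atTop_nhds_zero_nat
  have hexp : Tendsto (fun n : ℕ => Real.exp ((n : ℝ) ^ (-(1 / 8) : ℝ) *
      (2 * (|L| + 3) ^ 2 + 8 * Real.log n)) * α + 1 / (n : ℝ)) atTop (𝓝 α) := by
    have := (((Real.continuous_exp.tendsto 0).comp hκ).mul_const α).add hinv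
    simpa using this
  filter_upwards [eventually_gt_atTop 0, hexp.eventually (gt_mem_nhds hαρ),
    hκ.eventually (gt_mem_nhds (by norm_num : (0 : ℝ) < 1 / 2)),
    hinv.eventually (gt_mem_nhds hα0)] with n hn hexpn hκn hinvn k hk hkn
  have hn' : (0 : ℝ) < n := by exact_mod_cast hn
  have hk' : (1 : ℝ) ≤ k := by exact_mod_cast hk
  have hkn' : (k : ℝ) ≤ n := by exact_mod_cast hkn
  set h := (n : ℝ) ^ (-(1 / 8) : ℝ) with hh
  have hpos : 0 < h := Real.rpow_pos_of_pos hn' _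
  set l := 2 * Real.sqrt (Real.log n) with hl
  have hl0 : 0 ≤ l := by positivity
  have hl2 : l ^ 2 = 4 * Real.log n := by
    rw [hl, mul_pow, Real.sq_sqrt (Real.log_natCast_nonneg n)]; norm_num
  set B := |L| + l with hB
  have hL0 := abs_nonneg L
  have hsq : (B + 3) ^ 2 ≤ 2 * (|L| + 3) ^ 2 + 8 * Real.log n := by
    rw [hB]
    nlinarith [sq_nonneg (|L| + 3 - l)]
  have hB3 : 3 ≤ B + 3 := by linarith
  have hκB : h * (B + 3) ^ 2 ≤ h * (2 * (|L| + 3) ^ 2 + 8 * Real.log n) := by gcongr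
  have hshift0 : 0 ≤ h * (B + 3) := by positivity
  have hMh : (l + 1) * (h * (B + 3)) ≤ h * (2 * (|L| + 3) ^ 2 + 8 * Real.log n) := by
    refine le_trans ?_ hκB
    calc (l + 1) * (h * (B + 3)) ≤ (B + 3) * (h * (B + 3)) :=
          mul_le_mul_of_nonneg_right (by linarith) hshift0
      _ = h * (B + 3) ^ 2 := by ring
  have hshift1 : h * (B + 3) ≤ 1 := by
    calc h * (B + 3) ≤ h * (B + 3) ^ 2 := by
          gcongr
          exact le_self_pow₀ (by linarith) two_ne_zero
      _ ≤ 1 := by linarith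
  have hh1 : h ≤ 1 / 2 := by
    calc h = h * 1 := (mul_one h).symm
      _ ≤ h * (B + 3) ^ 2 := by
          gcongr
          exact one_le_pow₀ (by linarith)
      _ ≤ 1 / 2 := by linarith
  have htail : gaussianTail l ≤ 1 / n * (1 / n) := by
    refine (gaussianTail_le_exp hl0).trans (le_of_eq ?_)
    rw [hl2, show -(4 * Real.log n) / 2 = -Real.log n + -Real.log n by ring, Real.exp_add,
      Real.exp_neg, Real.exp_log hn', one_div]
  have hinv0 : 0 ≤ 1 / (n : ℝ) := by positivity
  have hv1 : gaussianTail l ≤ k * α / n := by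
    calc gaussianTail l ≤ 1 / n * (1 / n) := htail
      _ ≤ 1 / n * (k * α) := by
          gcongr
          exact hinvn.le.trans (le_mul_of_one_le_left hα0.le hk')
      _ = k * α / n := by ring
  have hv2 : k * α / n < gaussianTail L := by
    refine lt_of_le_of_lt ?_ hL
    rw [div_le_iff₀ hn', mul_comm]
    gcongr
  obtain ⟨τ, hLτ, hτl, hτ, hτz⟩ := exists_gaussianTail_le hv2 hv1 hpos
  refine ⟨τ - h * (B + 3), ?_, fun x δ s hδ hs hx => ?_⟩
  · calc gaussianTail (τ - h * (B + 3))
        ≤ Real.exp ((l + 1) * (h * (B + 3))) * gaussianTail τ +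
          gaussianTail (l + 1 - h * (B + 3)) := gaussianTail_sub_le hshift0
      _ ≤ Real.exp (h * (2 * (|L| + 3) ^ 2 + 8 * Real.log n)) * (k * α / n) + gaussianTail l := by
          gcongr
          · exact gaussianTail_nonneg τ
          · exact gaussianTail_antitone (by linarith)
      _ ≤ Real.exp (h * (2 * (|L| + 3) ^ 2 + 8 * Real.log n)) * (k * α / n) + 1 / n * (k / n) := by
          refine add_le_add le_rfl (htail.trans ?_)
          gcongr
      _ = (Real.exp (h * (2 * (|L| + 3) ^ 2 + 8 * Real.log n)) * α + 1 / n) * (k / n) := by ring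
      _ ≤ ρ * (k / n) := by gcongr
  · have hz := hτz _ hx
    have hδ' := abs_le.1 hδ
    have hs' := abs_le.1 hs
    have hspos : 0 < s := by linarith
    rw [le_div_iff₀ hspos] at hz
    have habs : |τ - h| ≤ B + 1 := by
      rw [abs_le]
      constructor
      · linarith [neg_abs_le L]
      · linarith
    have hprod : |(τ - h) * (s - 1)| ≤ (B + 1) * h := by
      rw [abs_mul]
      gcongr
    have hprod' := abs_le.1 hprod
    have hexpand : (τ - h) * s = τ - h + (τ - h) * (s - 1) := by ring
    linarith

namespace CrossfitICube.IsGaussianTrial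

variable {Ω : ℕ → Type*} [∀ n, MeasurableSpace (Ω n)] {P : (n : ℕ) → Measure (Ω n)}
  [∀ n, IsProbabilityMeasure (P n)] {μ : (n : ℕ) → Fin n → ℝ}
  {YC YT : (n : ℕ) → Fin n → Ω n → ℝ} {A : (n : ℕ) → Fin n → Ω n → Bool}
  {I : (n : ℕ) → Ω n → Finset (Fin n)} {r β α : ℝ}

/-- If the thresholds `t n k` are exceeded with probability at most `ρ k / n`, then for all `k` above
a power of `n` simultaneously there are fewer than `ρ' k` exceedances, `ρ' > ρ`. The exponential
bounds of Chernoff survive the union over `k`. -/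
lemma whp_exceedances_lt (h : ∀ n, IsGaussianTrial (P n) (μ n) (YC n) (YT n) (A n) (I n))
    (S : (n : ℕ) → Finset (Fin n)) {t : ℕ → ℕ → ℝ} {ρ ρ' γ : ℝ} (hρ : 0 < ρ) (hρρ' : ρ < ρ')
    (hγ : 0 < γ)
    (ht : ∀ᶠ n : ℕ in atTop, ∀ k : ℕ, 1 ≤ k → k ≤ n → gaussianTail (t n k) ≤ ρ * (k / n)) :
    WithHighProb P (fun n ω => ∀ k : ℕ, (n : ℝ) ^ γ ≤ k → k ≤ n →
      (((S n).filter fun i => t n k ≤ signedNoise (μ n) (YC n) (YT n) (A n) i ω).card : ℝ)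
        < ρ' * k) := by
  have hρ' : 0 < ρ' := hρ.trans hρρ'
  -- the exponent that optimizes Chernoff's bound, and the resulting rate
  set l := Real.log (ρ' / ρ) with hl
  have hl0 : 0 ≤ l := Real.log_nonneg ((one_le_div hρ).2 hρρ'.le)
  have hel : Real.exp l = ρ' / ρ := Real.exp_log (by positivity)
  set c := l * ρ' - ρ * (Real.exp l - 1) with hc
  have hcpos : 0 < c := by
    have h1 : Real.log (ρ / ρ') < ρ / ρ' - 1 :=
      Real.log_lt_sub_one_of_pos (by positivity) ((div_lt_one hρ').2 hρρ').ne
    have h2 : Real.log (ρ / ρ') = -l := by rw [hl, ← Real.log_inv, inv_div]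
    rw [h2] at h1
    have h3 : -l * ρ' < ρ - ρ' := by
      calc -l * ρ' < (ρ / ρ' - 1) * ρ' := by gcongr
        _ = ρ - ρ' := by field_simp
    have h4 : ρ * (Real.exp l - 1) = ρ' - ρ := by rw [hel]; field_simp
    rw [hc, h4]
    linarith
  have hlim : Tendsto (fun n : ℕ => 2 * ((((n : ℝ) ^ γ) ^ (1 / γ : ℝ)) *
      Real.exp (-c * (n : ℝ) ^ γ))) atTop (𝓝 0) := by
    have h1 := tendsto_rpow_mul_exp_neg_mul_atTop_nhds_zero (1 / γ) c hcpos
    have h2 := (h1.comp ((tendsto_rpow_atTop hγ).comp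
      tendsto_natCast_atTop_atTop)).const_mul 2
    rw [mul_zero] at h2
    exact h2
  refine WithHighProb.of_le hlim ?_
  filter_upwards [ht, eventually_gt_atTop 0] with n htn hn
  have hn' : (0 : ℝ) < n := by exact_mod_cast hn
  set K := (Finset.range (n + 1)).filter fun k : ℕ => (n : ℝ) ^ γ ≤ k with hK
  have hsub : {ω | ¬ ∀ k : ℕ, (n : ℝ) ^ γ ≤ k → k ≤ n →
      (((S n).filter fun i => t n k ≤ signedNoise (μ n) (YC n) (YT n) (A n) i ω).card : ℝ)
        < ρ' * k} ⊆ ⋃ k ∈ K, {ω | ρ' * k ≤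
      (((S n).filter fun i => t n k ≤ signedNoise (μ n) (YC n) (YT n) (A n) i ω).card : ℝ)} := by
    intro ω hω
    simp only [Set.mem_ofPred_eq, not_forall, not_lt] at hω
    obtain ⟨k, h1, h2, h3⟩ := hω
    simp only [Set.mem_iUnion]
    exact ⟨k, Finset.mem_filter.2 ⟨Finset.mem_range.2 (by omega), h1⟩, h3⟩
  have hone : ∀ k ∈ K, P n {ω | ρ' * k ≤
      (((S n).filter fun i => t n k ≤ signedNoise (μ n) (YC n) (YT n) (A n) i ω).card : ℝ)} ≤
      ENNReal.ofReal (Real.exp (-c * (n : ℝ) ^ γ)) := by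
    intro k hk
    rw [hK, Finset.mem_filter, Finset.mem_range] at hk
    have hk0 : (0 : ℝ) < k := (Real.rpow_pos_of_pos hn' γ).trans_le hk.2
    have hk1 : 1 ≤ k := by exact_mod_cast hk0
    refine ((h n).measure_card_exceedances_le (S n) hl0).trans (ENNReal.ofReal_le_ofReal ?_)
    refine Real.exp_le_exp.2 ?_
    have hScard : ((S n).card : ℝ) ≤ n := by
      exact_mod_cast (Finset.card_le_univ (S n)).trans_eq (Fintype.card_fin n)
    have he : 0 ≤ Real.exp l - 1 := sub_nonneg.2 (Real.one_le_exp hl0)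
    calc ((S n).card : ℝ) * (gaussianTail (t n k) * (Real.exp l - 1)) - l * (ρ' * k)
        ≤ n * (ρ * (k / n) * (Real.exp l - 1)) - l * (ρ' * k) := by
          have := htn k hk1 (by omega)
          have h0 := gaussianTail_nonneg (t n k)
          gcongr
      _ = -c * k := by
          rw [hc]
          field_simp
          ring
      _ ≤ -c * (n : ℝ) ^ γ := by nlinarith [hk.2]
  calc P n _ ≤ ∑ k ∈ K, P n {ω | ρ' * k ≤
        (((S n).filter fun i => t n k ≤ signedNoise (μ n) (YC n) (YT n) (A n) i ω).card : ℝ)} :=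
        (measure_mono hsub).trans (measure_biUnion_finset_le _ _)
    _ ≤ K.card • ENNReal.ofReal (Real.exp (-c * (n : ℝ) ^ γ)) := Finset.sum_le_card_nsmul _ _ _ hone
    _ = ENNReal.ofReal (K.card * Real.exp (-c * (n : ℝ) ^ γ)) := by
        rw [nsmul_eq_mul, ENNReal.ofReal_mul (Nat.cast_nonneg _), ENNReal.ofReal_natCast]
    _ ≤ _ := by
        refine ENNReal.ofReal_le_ofReal ?_
        rw [← Real.rpow_mul hn'.le, mul_one_div_cancel hγ.ne', Real.rpow_one, ← mul_assoc]
        gcongr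
        have h1 : K.card ≤ n + 1 := (Finset.card_filter_le _ _).trans_eq (Finset.card_range _)
        have h2 : K.card ≤ 2 * n := by omega
        exact_mod_cast h2

/-! ### Linear-BH below the threshold -/

lemma eventually_rpow_lt_gaussianTail {q q' : ℝ} (hq0 : 0 ≤ q) (hq : q < q') (hq1 : q ≤ 1) :
    ∀ᶠ n : ℕ in atTop, (n : ℝ) ^ (-q') < gaussianTail (Real.sqrt q * logScale n) := by
  set C := Real.log (Real.sqrt (2 * Real.pi)) + 1 / 2 with hC
  have hlim : Tendsto (fun n => logScale n * ((q' - q) / 2 * logScale n - 1)) atTop atTop :=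
    tendsto_logScale.atTop_mul_atTop₀ (tendsto_atTop_add_const_right _ _
      (tendsto_logScale.const_mul_atTop (by linarith)))
  filter_upwards [hlim.eventually_gt_atTop C, eventually_gt_atTop 0] with n hn hn0
  have hL : 0 ≤ logScale n := Real.sqrt_nonneg _
  refine lt_of_lt_of_le ?_ (le_gaussianTail (by positivity))
  have hpi : 0 < Real.sqrt (2 * Real.pi) := by positivity
  rw [rpow_neg_eq_exp_logScale hn0, ← Real.exp_log (inv_pos.2 hpi), ← Real.exp_add, Real.log_inv]
  refine Real.exp_lt_exp.2 ?_
  have h1 : (Real.sqrt q * logScale n + 1) ^ 2 =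
      q * logScale n ^ 2 + 2 * (Real.sqrt q * logScale n) + 1 := by
    rw [add_sq, mul_pow, Real.sq_sqrt hq0]
    ring
  have h2 : Real.sqrt q * logScale n ≤ 1 * logScale n := by
    gcongr
    exact Real.sqrt_le_one.2 hq1
  rw [h1]
  nlinarith

/-- Below the threshold: for `r < q < q' < β`, more than `n ^ (1 - q')` rejections would consist
almost only of nulls, and there are not enough null p-values for that. So the rejected p-values are
below `n ^ (-q')`, which few non-nulls reach. -/
theorem tendsto_power_linearBH_zero (hμ : IsSparse r β μ)
    (h : ∀ n, IsGaussianTrial (P n) (μ n) (YC n) (YT n) (A n) (I n))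
    (hα0 : 0 < α) (hα1 : α < 1) (hr0 : 0 < r) (hβ0 : 0 < β) (hβ1 : β < 1) (hrβ : r < β) :
    Tendsto (fun n => power (P n) (nonNulls (μ n)) (fun ω =>
        linearBH α (idealCovariate (μ n)) (fun i => A n i ω)
          (observed (fun i => A n i ω) (fun i => YC n i ω) (fun i => YT n i ω))))
      atTop (𝓝 0) := by
  obtain ⟨q, hrq, hqβ⟩ := exists_between hrβ
  obtain ⟨q', hqq', hq'β⟩ := exists_between hqβ
  have hq0 : 0 < q := hr0.trans hrq
  obtain ⟨ρ, hαρ, hρ1⟩ := exists_between hα1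
  obtain ⟨ρ', hρρ', hρ'1⟩ := exists_between hρ1
  have hS1 := hμ.tendsto_card_nonNulls hβ1
  set η₀ := (Real.sqrt q - Real.sqrt r) / 4 with hη₀
  have hη₀pos : 0 < η₀ := by
    have := Real.sqrt_lt_sqrt hr0.le hrq
    rw [hη₀]; linarith
  have hsq1 : Real.sqrt q ≤ 1 := Real.sqrt_le_one.2 (by linarith)
  have hη₀1 : η₀ ≤ 1 / 4 := by
    rw [hη₀]; linarith [Real.sqrt_nonneg r]
  refine WithHighProb.tendsto_integral_zero (fun n => measurable_power_integrand _ fun i =>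
    (h n).measurableSet_mem_linearBH α _ i) (fun n ω => by positivity)
    (fun n ω => power_linearBH_integrand_le_one _ _ _ _ _) fun η hη => ?_
  have hK : Tendsto (fun n => 2 * η₀ * logScale n) atTop atTop :=
    tendsto_logScale.const_mul_atTop (by positivity)
  have hsparse : Tendsto (fun n : ℕ => (n : ℝ) ^ (-(β - q'))) atTop (𝓝 0) :=
    (tendsto_rpow_neg_atTop (by linarith)).comp tendsto_natCast_atTop_atTop
  obtain ⟨N₀, hN₀⟩ := eventually_atTop.1 (eventually_exists_threshold hα0 hα1 hαρ)
  have hthr : ∀ n k : ℕ, ∃ t : ℝ, N₀ ≤ n → 1 ≤ k → k ≤ n → gaussianTail t ≤ ρ * (k / n) ∧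
      ∀ x δ s : ℝ, |δ| ≤ (n : ℝ) ^ (-(1 / 8) : ℝ) → |s - 1| ≤ (n : ℝ) ^ (-(1 / 8) : ℝ) →
        gaussianTail ((x + δ) / s) ≤ k * α / n → t ≤ x := by
    intro n k
    by_cases hc : N₀ ≤ n ∧ 1 ≤ k ∧ k ≤ n
    · obtain ⟨t, ht⟩ := hN₀ n hc.1 k hc.2.1 hc.2.2
      exact ⟨t, fun _ _ _ => ht⟩
    · exact ⟨0, fun h1 h2 h3 => absurd ⟨h1, h2, h3⟩ hc⟩
  choose t ht using hthr
  have hexc := whp_exceedances_lt h (fun n => (nonNulls (μ n))ᶜ) (t := t) (γ := 1 - q')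
    (hα0.trans hαρ) hρρ' (by linarith)
    ((eventually_ge_atTop N₀).mono fun n hn k h1 h2 => (ht n k hn h1 h2).1)
  refine ((whp_pValueApprox hμ h hβ0 hβ1 hη₀pos).and (hexc.and (whp_card_large_noise h
    (fun n => nonNulls (μ n)) hK hη))).mono ?_
  filter_upwards [hS1.eventually_gt_atTop 0, eventually_gt_atTop 0, hμ.eventually_card_bounds,
    tendsto_logScale.eventually_ge_atTop 1, eventually_ge_atTop N₀,
    hsparse.eventually (gt_mem_nhds (by linarith : 0 < (1 - ρ') / 2)),
    eventually_rpow_lt_gaussianTail hq0.le hqq' (by linarith)]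
    with n hg1 hn hbounds hL hnN hsp hlow ω hω
  obtain ⟨⟨hap1, hap0⟩, hex, hbad⟩ := hω
  have hn' : (0 : ℝ) < n := by exact_mod_cast hn
  have hcard : (1 : ℝ) ≤ (nonNulls (μ n)).card := by exact_mod_cast hg1
  set G := nonNulls (μ n) with hG
  set p := linearPValue (idealCovariate (μ n)) (fun i => A n i ω)
    (observed (fun i => A n i ω) (fun i => YC n i ω) (fun i => YT n i ω)) with hp
  rw [max_eq_left hcard, div_le_iff₀ (by linarith)]
  refine le_trans ?_ hbad
  refine Nat.cast_le.2 (Finset.card_le_card fun i hi => ?_)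
  rw [Finset.mem_inter, linearBH, bhReject, Finset.mem_filter, ← hp] at hi
  obtain ⟨⟨-, hkpos, hpi⟩, hiG⟩ := hi
  set k := bhCount α p with hk
  have hkn : k ≤ n := Nat.findGreatest_le n
  -- the number of rejections is below `n ^ (1 - q')`
  have hksmall : (k : ℝ) < (n : ℝ) ^ (1 - q') := by
    by_contra hge
    rw [not_lt] at hge
    have hsub : ({i | p i ≤ k * α / n} : Finset (Fin n)) ⊆ G ∪
        (Gᶜ.filter fun i => t n k ≤ signedNoise (μ n) (YC n) (YT n) (A n) i ω) := by
      intro j hj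
      rw [Finset.mem_filter] at hj
      by_cases hjG : j ∈ G
      · exact Finset.mem_union_left _ hjG
      · have hjc : j ∈ Gᶜ := Finset.mem_compl.2 hjG
        obtain ⟨δ, s, hδ, hs, hpj⟩ := hap0 j hjc
        have hle := hj.2
        rw [hpj, hμ.eq_zero hjc, zero_add] at hle
        exact Finset.mem_union_right _ (Finset.mem_filter.2
          ⟨hjc, (ht n k hnN hkpos hkn).2 _ δ s hδ hs hle⟩)
    have h1 : (k : ℝ) ≤ G.card + ((Gᶜ.filter fun i =>
        t n k ≤ signedNoise (μ n) (YC n) (YT n) (A n) i ω).card : ℝ) := by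
      exact_mod_cast (bhCount_le_card hkpos).trans
        ((Finset.card_le_card hsub).trans (Finset.card_union_le _ _))
    have h2 := hex k hge hkn
    have h3 := hbounds.2
    have e1 : (n : ℝ) ^ (1 - β) = (n : ℝ) ^ (-(β - q')) * (n : ℝ) ^ (1 - q') := by
      rw [← Real.rpow_add hn']
      congr 1; ring
    have e2 : 0 < (n : ℝ) ^ (1 - q') := Real.rpow_pos_of_pos hn' _
    have e3 : (n : ℝ) ^ (1 - β) < (1 - ρ') / 2 * (n : ℝ) ^ (1 - q') := by
      rw [e1]; gcongr
    have e4 : (1 - ρ') * (n : ℝ) ^ (1 - q') ≤ (1 - ρ') * k :=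
      mul_le_mul_of_nonneg_left hge (by linarith)
    linarith
  have hpsmall : p i ≤ (n : ℝ) ^ (-q') := by
    refine hpi.trans ?_
    rw [div_le_iff₀ hn', ← Real.rpow_add_one hn'.ne', neg_add_eq_sub]
    calc (k : ℝ) * α ≤ k * 1 := by gcongr
      _ ≤ _ := by rw [mul_one]; exact hksmall.le
  refine Finset.mem_filter.2 ⟨hiG, ?_⟩
  rw [← abs_signedNoise]
  refine le_trans ?_ (le_abs_self _)
  obtain ⟨δ, s, hδ, hs, hpe⟩ := hap1 i hiG
  have hδ' := abs_le.1 hδ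
  have hs' := abs_le.1 hs
  have hspos : 0 < s := by linarith
  rw [hpe, hμ.eq_signal hiG, signal_eq hr0.le] at hpsmall
  have hz : Real.sqrt q * logScale n ≤
      (Real.sqrt r * logScale n + signedNoise (μ n) (YC n) (YT n) (A n) i ω + δ) / s := by
    by_contra hlt
    exact absurd (hlow.trans_le (gaussianTail_antitone (not_le.1 hlt).le)) (not_lt.2 hpsmall)
  rw [le_div_iff₀ hspos] at hz
  have e1 : Real.sqrt q * logScale n = Real.sqrt r * logScale n + 4 * η₀ * logScale n := by
    rw [hη₀]; ring
  have hql : 0 ≤ Real.sqrt q * logScale n := by positivity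
  have e2 : Real.sqrt q * logScale n * (1 - η₀) ≤ Real.sqrt q * logScale n * s :=
    mul_le_mul_of_nonneg_left (by linarith) hql
  have e3 : Real.sqrt q * logScale n * η₀ ≤ 1 * logScale n * η₀ := by gcongr
  have e4 : η₀ * 1 ≤ η₀ * logScale n := by gcongr
  linarith

end CrossfitICube.IsGaussianTrial

theorem theorem4
    (α r β : ℝ) (hα : α ∈ Set.Ioo (0 : ℝ) 1) (hr : r ∈ Set.Ioo (0 : ℝ) 1)
    (hβ : β ∈ Set.Ioo (0 : ℝ) 1)
    (μ : (n : ℕ) → Fin n → ℝ) (hμ : IsSparse r β μ)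
    {Ω : ℕ → Type*} [∀ n, MeasurableSpace (Ω n)] (P : (n : ℕ) → Measure (Ω n))
    [∀ n, IsProbabilityMeasure (P n)]
    (YC YT : (n : ℕ) → Fin n → Ω n → ℝ) (A : (n : ℕ) → Fin n → Ω n → Bool)
    (I : (n : ℕ) → Ω n → Finset (Fin n))
    (hmodel : ∀ n, IsGaussianTrial (P n) (μ n) (YC n) (YT n) (A n) (I n))
    (tie : (n : ℕ) → TieRule n) (htie : ∀ n, (tie n).IsMeasurable) :
    Tendsto (fun n => power (P n) (nonNulls (μ n)) (fun ω =>
        crossfitICube (tie n) α (idealCovariate (μ n)) (fun i => A n i ω)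
          (observed (fun i => A n i ω) (fun i => YC n i ω) (fun i => YT n i ω)) (I n ω)))
      atTop (𝓝 1) ∧
    (r < β → Tendsto (fun n => power (P n) (nonNulls (μ n)) (fun ω =>
        linearBH α (idealCovariate (μ n)) (fun i => A n i ω)
          (observed (fun i => A n i ω) (fun i => YC n i ω) (fun i => YT n i ω))))
      atTop (𝓝 0)) ∧
    (β < r → Tendsto (fun n => power (P n) (nonNulls (μ n)) (fun ω =>
        linearBH α (idealCovariate (μ n)) (fun i => A n i ω)
          (observed (fun i => A n i ω) (fun i => YC n i ω) (fun i => YT n i ω))))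
      atTop (𝓝 1)) :=
  ⟨IsGaussianTrial.tendsto_power_crossfitICube hμ hmodel hα.1 hα.2 hr.1 hβ.1 hβ.2 htie,
    IsGaussianTrial.tendsto_power_linearBH_zero hμ hmodel hα.1 hα.2 hr.1 hβ.1 hβ.2,
    IsGaussianTrial.tendsto_power_linearBH_one hμ hmodel hα.1 hr.2 hβ.1 hβ.2⟩
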